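/- Let $m>1$, $0<P_M\le P_H$, $A,\gamma>0$, and let $G:[0,\infty)\to\mathbb R$ be non-increasing with $G(P_M)=0$, continuous on $[0,P_H]$ and $C^2$ on $(0,P_H]$, such that for all $p\in(0,P_H]$ $$3G'(p)+2p\,G''(p)\le 0,\qquad |G'(p)|+|p\,G''(p)|\le A\,p^{\gamma-1}.$$ For $\alpha\in[0,1]$, a function $f\ge 0$ on $\mathbb R^N$ is called $\alpha$-concave if its support $\{f>0\}$ is convex and $f^\alpha$ (if $\alpha=0$: $\log f$) is concave on it. Consider $$\partial_t u=\Delta u^m+u\,G(P),\qquad P=\tfrac{m}{m-1}u^{m-1}\qquad\text{in }\mathbb R^N\times(0,T),\quad T>0. \tag{E}$$ A solution of (E) on $[0,T)$ with initial pressure $P_0$ is a continuous function $u\ge0$ on $\mathbb R^N\times[0,T)$, bounded on $\mathbb R^N\times[0,S]$ for every $S<T$, which satisfies (E) in the sense of distributions and whose pressure at $t=0$ is $P_0$. (1) Let $0\le P_0\le P_H$ be compactly supported and $\tfrac12$-concave, and let $u$ be a solution of (E) on $[0,T)$ with initial pressure $P_0$ whose pressure $P$ is smooth up to the boundary of its support,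 i.e. $P$ coincides on $\{(x,t):0\le t<T,\ P(x,t)>0\}$ with a function that is $C^\infty$ on $\mathbb R^N\times(-\infty,T)$. Then $P(\cdot,t)$ is $\tfrac12$-concave for every $t\in[0,T)$. (2) Let $N\ge2$, $\alpha\in[0,1]\setminus\{\tfrac12\}$, and let $B$ be the open unit ball of $\mathbb R^N$. There is a function $v_0\in C^\infty(\overline B)$, extended by zero outside $B$, with $0<v_0\le P_H$ in $B$ and $v_0=0$ on $\partial B$, such that $v_0$ is $\alpha$-concave, $\nabla v_0$ vanishes at no point of $\partial B$, and the following holds: for every $T>0$ and every solution $u$ of (E) on $[0,T)$ with initial pressure $v_0$ whose pressure $P$ is $C^2$ in $(x,t)$ on $\{(x,t):0\le t<T,\ P(x,t)>0\}$, there is $\delta\in(0,T]$ such that $P(\cdot,t)$ is not $\alpha$-concave for any $t\in(0,\delta)$. -/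

import Mathlib

open Set MeasureTheory
open scoped ContDiff

/-- `f` is `α`-concave: `f ^ α` (`log f` if `α = 0`) is concave on the support of `f`.
As usual, concavity on a set includes convexity of that set. -/
def PowerConcave {N : ℕ} (α : ℝ) (f : EuclideanSpace ℝ (Fin N) → ℝ) : Prop :=
  (α = 0 → ConcaveOn ℝ (Function.support f) (fun x => Real.log (f x))) ∧
  (α ≠ 0 → ConcaveOn ℝ (Function.support f) (fun x => f x ^ α))

/-- The pressure `m / (m - 1) * s ^ (m - 1)` of the density `s`. -/
noncomputable def pressure (m s : ℝ) : ℝ := m / (m - 1) * s ^ (m - 1)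

/-- `u` is a nonnegative, continuous, locally in time bounded weak solution of
`∂ₜ u = Δ (u ^ m) + u G(P)`, `P = pressure m u`, in `ℝᴺ × (0, T)`, continuous down to `t = 0`. -/
structure IsWeakSolution {N : ℕ} (m : ℝ) (G : ℝ → ℝ) (T : ℝ)
    (u : ℝ → EuclideanSpace ℝ (Fin N) → ℝ) : Prop where
  continuousOn : ContinuousOn (fun z : ℝ × EuclideanSpace ℝ (Fin N) => u z.1 z.2)
    (Ico 0 T ×ˢ univ)
  nonneg : ∀ t ∈ Ico 0 T, ∀ x, 0 ≤ u t x
  bounded : ∀ S < T, ∃ M : ℝ, ∀ t ∈ Icc 0 S, ∀ x, u t x ≤ M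
  weak : ∀ φ : ℝ × EuclideanSpace ℝ (Fin N) → ℝ, ContDiff ℝ ∞ φ → HasCompactSupport φ →
    tsupport φ ⊆ Ioo 0 T ×ˢ univ →
    ∫ z : ℝ × EuclideanSpace ℝ (Fin N),
      (u z.1 z.2 * deriv (fun s => φ (s, z.2)) z.1
        + u z.1 z.2 ^ m * Laplacian.laplacian (fun y => φ (z.1, y)) z.2
        + u z.1 z.2 * G (pressure m (u z.1 z.2)) * φ z) = 0

/-- The positivity set of `P` in space-time, over the time interval `[0, T)`. -/
def positivitySet {N : ℕ} (T : ℝ) (P : ℝ → EuclideanSpace ℝ (Fin N) → ℝ) :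
    Set (ℝ × EuclideanSpace ℝ (Fin N)) :=
  {z | z.1 ∈ Ico 0 T ∧ 0 < P z.1 z.2}

/-- `P` is smooth up to the boundary of its support for `0 ≤ t < T`: on its positivity set it
coincides with a function that is `C^∞` on the space-time `(-∞, T) × ℝᴺ`. -/
def SmoothUpToFreeBoundary {N : ℕ} (T : ℝ) (P : ℝ → EuclideanSpace ℝ (Fin N) → ℝ) : Prop :=
  ∃ Q : ℝ × EuclideanSpace ℝ (Fin N) → ℝ, ContDiffOn ℝ ∞ Q (Iio T ×ˢ univ) ∧
    ∀ z ∈ positivitySet T P, Q z = P z.1 z.2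

/-! Write `a = m - 1`. Testing the weak equation where `u` is regular and multiplying by `m u^(m-2)`
gives the classical pressure equation `P_t = a P ΔP + |∇P|² + a P G(P)` on `{P > 0}`. As `G` may
jump above `P_H`, the equation is first used with bounds on `G`
(`IsWeakSolution.pressure_equation_bounds`); this suffices for comparison, which then keeps the
pressure below `P_H`, where `G` is continuous.

Preservation. The second derivative of `√P` along `ξ` is `F(ξ) / (4 P^(3/2))` with `F(ξ) = 2 P
D²P(ξ,ξ) - (DP ξ)²`, so the aim is `F ≤ 0`. If `F(e)`, `‖e‖ = 1`, touches `4 P Θ` from below, then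
`Θ` is a subsolution of a linear drift-diffusion equation at that point (`evolution_at_touching`).
The reaction does no harm because `3G' + 2pG'' ≤ 0` says exactly that `v ↦ v G(v²)`, the reaction
felt by `v = √P` up to a factor, is concave; its tangent lines give supporting functions `κ√p + c p`
of `p G(p)` (`exists_reaction_support`).

The equation degenerates at the free boundary, and no boundary condition is available there. Hence
`F/(4P)` is compared with `e^{Kt}` times the weight `ε (1 - η P^σ + 1/θ)`, `θ = P + |∇P|²`. The term
`1/θ` keeps extremal sequences away from boundary points with vanishing gradient, and is a
supersolution up to a multiple of itself (`degeneracy_estimates`). The term `-P^σ`, `σ < 1`, has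
infinite slope at regular boundary points, whereas everything else is smooth up to the boundary; so
no extremum sits there (`not_touching_boundary`). Interior touching is excluded by taking `K` large
(`not_touching`), and `ε → 0` gives `F ≤ 0`.

This is local concavity. The support stays bounded (`SmoothPressure.support_bounded`), does not
shrink (`SmoothPressure.pos_of_pos`) and gains no component (`SmoothPressure.isPreconnected_slice`).
A nonnegative continuous function that is locally concave on its connected positivity set is concave
there, and that set is convex (`concaveOn_of_locally_concave`).

Loss. Let `H` be `log` or the power `α`, with inverse `E`. The initial pressure is the paraboloid `p
(1 - |x|²)` near the sphere and, at three equidistant collinear points, `E` of a concave function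
`l` (up to a constant), glued by a smooth minimum in the gauge `H`. The second difference of `l`
over the three points is zero, so concavity is lost at once if the initial time derivative of `H ∘
P` has a positive second difference there (`IsWeakSolution.exists_not_concaveOn`). With `r = 1/α`
and `g` the value of `H ∘ P`, that derivative is `(a(r-1)+r) g^(r-1) |∇l|² + a g^r Δl` plus a
reaction term. For `α < 1/2` the function `g^(r-1)` is strictly convex, and an affine `l` with a
steep slope near the sphere makes the first term dominate; the logarithm is similar with `exp`. For
`α > 1/2` the profile `l` is affine on an axis but bent across it, with `Δl` a large multiple of
`-g^(-r/2)`; then `a g^r Δl` is a large multiple of `-g^(r/2)`, strictly convex since `r < 2`. This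
needs a transverse direction, hence `N ≥ 2`. -/

open Filter Topology

/-! ### Second order jets of functions of one real variable -/

/-- `f` is twice differentiable at `0`, with value `f₀`, first derivative `f₁` and second
derivative `f₂`. -/
def HasJet (f : ℝ → ℝ) (f₀ f₁ f₂ : ℝ) : Prop :=
  ∃ f' : ℝ → ℝ, (∀ᶠ s in 𝓝 0, HasDerivAt f (f' s) s) ∧ HasDerivAt f' f₂ 0 ∧ f 0 = f₀ ∧ f' 0 = f₁

namespace HasJet

variable {f g : ℝ → ℝ} {f₀ f₁ f₂ g₀ g₁ g₂ : ℝ}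

theorem hasDerivAt (hf : HasJet f f₀ f₁ f₂) : HasDerivAt f f₁ 0 := by
  obtain ⟨f', h1, -, -, h4⟩ := hf
  exact h4 ▸ h1.self_of_nhds

theorem unique (hf : HasJet f f₀ f₁ f₂) (hg : HasJet f g₀ g₁ g₂) :
    f₀ = g₀ ∧ f₁ = g₁ ∧ f₂ = g₂ := by
  refine ⟨?_, hf.hasDerivAt.unique hg.hasDerivAt, ?_⟩
  · obtain ⟨-, -, -, h, -⟩ := hf
    obtain ⟨-, -, -, h', -⟩ := hg
    exact h ▸ h'
  · obtain ⟨f', h1, h2, -, -⟩ := hf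
    obtain ⟨g', k1, k2, -, -⟩ := hg
    have : f' =ᶠ[𝓝 0] g' := by
      filter_upwards [h1, k1] with s hs ks using hs.unique ks
    exact (h2.congr_of_eventuallyEq this.symm).unique k2

theorem congr (hf : HasJet f f₀ f₁ f₂) (h : ∀ᶠ s in 𝓝 0, g s = f s) : HasJet g f₀ f₁ f₂ := by
  obtain ⟨f', h1, h2, h3, h4⟩ := hf
  refine ⟨f', ?_, h2, ?_, h4⟩
  · filter_upwards [h1, h.eventually_nhds] with s hs ks using hs.congr_of_eventuallyEq ks
  · rw [← h3]; exact h.self_of_nhds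

theorem cast (hf : HasJet f f₀ f₁ f₂) (h0 : f₀ = g₀) (h1 : f₁ = g₁) (h2 : f₂ = g₂) :
    HasJet f g₀ g₁ g₂ := by
  subst h0 h1 h2; exact hf

theorem const (c : ℝ) : HasJet (fun _ => c) c 0 0 :=
  ⟨fun _ => 0, Eventually.of_forall fun s => hasDerivAt_const s c, hasDerivAt_const _ _, rfl, rfl⟩

theorem id : HasJet (fun s => s) 0 1 0 :=
  ⟨fun _ => 1, Eventually.of_forall fun s => hasDerivAt_id s, hasDerivAt_const _ _, rfl, rfl⟩

theorem add (hf : HasJet f f₀ f₁ f₂) (hg : HasJet g g₀ g₁ g₂) :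
    HasJet (fun s => f s + g s) (f₀ + g₀) (f₁ + g₁) (f₂ + g₂) := by
  obtain ⟨f', h1, h2, h3, h4⟩ := hf
  obtain ⟨g', k1, k2, k3, k4⟩ := hg
  refine ⟨fun s => f' s + g' s, ?_, h2.add k2, by simp [h3, k3], by simp [h4, k4]⟩
  filter_upwards [h1, k1] with s hs ks using hs.add ks

theorem mul (hf : HasJet f f₀ f₁ f₂) (hg : HasJet g g₀ g₁ g₂) :
    HasJet (fun s => f s * g s) (f₀ * g₀) (f₁ * g₀ + f₀ * g₁)
      (f₂ * g₀ + 2 * (f₁ * g₁) + f₀ * g₂) := by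
  have hf1 := hf.hasDerivAt
  have hg1 := hg.hasDerivAt
  obtain ⟨f', h1, h2, h3, h4⟩ := hf
  obtain ⟨g', k1, k2, k3, k4⟩ := hg
  refine ⟨fun s => f' s * g s + f s * g' s, ?_, ?_, by simp [h3, k3], by simp [h3, k3, h4, k4]⟩
  · filter_upwards [h1, k1] with s hs ks using hs.mul ks
  · refine ((h2.mul hg1).add (hf1.mul k2)).congr_deriv ?_
    rw [h3, k3, h4, k4]; ring

theorem const_mul (c : ℝ) (hf : HasJet f f₀ f₁ f₂) :
    HasJet (fun s => c * f s) (c * f₀) (c * f₁) (c * f₂) :=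
  ((HasJet.const c).mul hf).cast rfl (by ring) (by ring)

theorem neg (hf : HasJet f f₀ f₁ f₂) : HasJet (fun s => -f s) (-f₀) (-f₁) (-f₂) := by
  simpa using hf.const_mul (-1)

theorem sub (hf : HasJet f f₀ f₁ f₂) (hg : HasJet g g₀ g₁ g₂) :
    HasJet (fun s => f s - g s) (f₀ - g₀) (f₁ - g₁) (f₂ - g₂) := by
  simpa [sub_eq_add_neg] using hf.add hg.neg

theorem pow_two (hf : HasJet f f₀ f₁ f₂) :
    HasJet (fun s => f s ^ 2) (f₀ ^ 2) (2 * (f₀ * f₁)) (2 * f₁ ^ 2 + 2 * (f₀ * f₂)) :=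
  ((hf.mul hf).congr (Eventually.of_forall fun s => _root_.pow_two (f s))).cast (by ring) (by ring)
    (by ring)

theorem sum {ι : Type*} (t : Finset ι) {F : ι → ℝ → ℝ} {F₀ F₁ F₂ : ι → ℝ}
    (h : ∀ i ∈ t, HasJet (F i) (F₀ i) (F₁ i) (F₂ i)) :
    HasJet (fun s => ∑ i ∈ t, F i s) (∑ i ∈ t, F₀ i) (∑ i ∈ t, F₁ i) (∑ i ∈ t, F₂ i) := by
  classical
  induction t using Finset.induction_on with
  | empty => simpa using HasJet.const 0
  | insert i t hi ih =>
    simp only [Finset.sum_insert hi]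
    exact (h i (Finset.mem_insert_self i t)).add
      (ih fun j hj => h j (Finset.mem_insert_of_mem hj))

theorem comp {φ φ' : ℝ → ℝ} {φ₂ : ℝ} (hf : HasJet f f₀ f₁ f₂)
    (h1 : ∀ᶠ y in 𝓝 f₀, HasDerivAt φ (φ' y) y) (h2 : HasDerivAt φ' φ₂ f₀) :
    HasJet (fun s => φ (f s)) (φ f₀) (φ' f₀ * f₁) (φ₂ * f₁ ^ 2 + φ' f₀ * f₂) := by
  have hf1 := hf.hasDerivAt
  obtain ⟨f', k1, k2, k3, k4⟩ := hf
  have hc : Tendsto f (𝓝 0) (𝓝 f₀) := by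
    have := hf1.continuousAt.tendsto
    rwa [k3] at this
  refine ⟨fun s => φ' (f s) * f' s, ?_, ?_, by simp [k3], by simp [k3, k4]⟩
  · filter_upwards [hc.eventually h1, k1] with s hs ks using hs.comp s ks
  · have h3 : HasDerivAt (fun s => φ' (f s)) (φ₂ * f₁) 0 := by
      have h2' : HasDerivAt φ' φ₂ (f 0) := by rwa [k3]
      exact h2'.comp 0 hf1
    refine (h3.mul k2).congr_deriv ?_
    rw [k3, k4]; ring

theorem rpow (hf : HasJet f f₀ f₁ f₂) (h : 0 < f₀) (p : ℝ) :
    HasJet (fun s => f s ^ p) (f₀ ^ p) (p * f₀ ^ (p - 1) * f₁)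
      (p * (p - 1) * f₀ ^ (p - 2) * f₁ ^ 2 + p * f₀ ^ (p - 1) * f₂) := by
  have h1 : ∀ᶠ y in 𝓝 f₀, HasDerivAt (fun y : ℝ => y ^ p) (p * y ^ (p - 1)) y := by
    filter_upwards [isOpen_ne.mem_nhds h.ne'] with y hy
    exact Real.hasDerivAt_rpow_const (Or.inl hy)
  have h2 : HasDerivAt (fun y : ℝ => p * y ^ (p - 1)) (p * (p - 1) * f₀ ^ (p - 2)) f₀ := by
    refine ((Real.hasDerivAt_rpow_const (p := p - 1) (Or.inl h.ne')).const_mul p).congr_deriv ?_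
    rw [show p - 1 - 1 = p - 2 by ring]; ring
  exact hf.comp h1 h2

theorem sqrt (hf : HasJet f f₀ f₁ f₂) (h : 0 < f₀) :
    HasJet (fun s => √(f s)) √f₀ (f₁ / (2 * √f₀))
      ((2 * f₀ * f₂ - f₁ ^ 2) / (4 * √f₀ ^ 3)) := by
  have hs : 0 < √f₀ := Real.sqrt_pos.2 h
  have h1 : ∀ᶠ y in 𝓝 f₀, HasDerivAt (fun y : ℝ => √y) (1 / (2 * √y)) y := by
    filter_upwards [isOpen_ne.mem_nhds h.ne'] with y hy using Real.hasDerivAt_sqrt hy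
  have h2 : HasDerivAt (fun y : ℝ => 1 / (2 * √y)) (-(1 / (4 * √f₀ ^ 3))) f₀ := by
    have := ((Real.hasDerivAt_sqrt h.ne').const_mul 2).inv (by positivity)
    refine (this.congr_of_eventuallyEq (Eventually.of_forall fun y => one_div _)).congr_deriv ?_
    field_simp
    norm_num
  refine (hf.comp h1 h2).cast rfl (by ring) ?_
  have : f₀ = √f₀ ^ 2 := (Real.sq_sqrt h.le).symm
  generalize √f₀ = v at *
  subst this
  field_simp
  ring

theorem exp (hf : HasJet f f₀ f₁ f₂) :
    HasJet (fun s => Real.exp (f s)) (Real.exp f₀) (Real.exp f₀ * f₁)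
      (Real.exp f₀ * f₁ ^ 2 + Real.exp f₀ * f₂) :=
  hf.comp (Eventually.of_forall Real.hasDerivAt_exp) (Real.hasDerivAt_exp f₀)

/-- The second derivative test. -/
theorem of_isLocalMax (hf : HasJet f f₀ f₁ f₂) (h : IsLocalMax f 0) : f₁ = 0 ∧ f₂ ≤ 0 := by
  have hf1 := h.hasDerivAt_eq_zero hf.hasDerivAt
  refine ⟨hf1, ?_⟩
  by_contra! h2
  have hf' := hf
  obtain ⟨f', k1, k2, k3, k4⟩ := hf
  have hd : deriv f =ᶠ[𝓝 0] f' := k1.mono fun s hs => hs.deriv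
  have hd2 : deriv (deriv f) 0 = f₂ := by
    rw [hd.deriv_eq]; exact k2.deriv
  -- A positive second derivative would make `0` a local minimum too, so `f` would be locally
  -- constant, with vanishing second derivative.
  have hmin : IsLocalMin f 0 := isLocalMin_of_deriv_deriv_pos (by rw [hd2]; exact h2)
    (by rw [hf'.hasDerivAt.deriv, hf1]) hf'.hasDerivAt.continuousAt
  have hc : ∀ᶠ s in 𝓝 0, f s = f₀ := by
    filter_upwards [h, hmin] with s hs ks
    rw [← k3]; exact le_antisymm hs ks
  have := hf'.unique ((HasJet.const f₀).congr hc)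
  linarith [this.2.2]

end HasJet

/-! ### Directional derivatives -/

theorem two_le_infty : (2 : ℕ∞ω) ≤ ∞ := by
  rw [show (2 : ℕ∞ω) = ((2 : ℕ∞) : ℕ∞ω) from rfl]
  exact WithTop.coe_le_coe.2 le_top

section DirDeriv

variable {V : Type*} [NormedAddCommGroup V] [NormedSpace ℝ V]

/-- The directional derivative of `f` along `v`, as a function of the base point. -/
noncomputable def dirDeriv (v : V) (f : V → ℝ) : V → ℝ := fun z => fderiv ℝ f z v

variable {f g : V → ℝ} {z v w : V} {O : Set V}

theorem dirDeriv_add_vec : dirDeriv (v + w) f z = dirDeriv v f z + dirDeriv w f z := by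
  simp [dirDeriv]

theorem dirDeriv_smul_vec (c : ℝ) : dirDeriv (c • v) f z = c * dirDeriv v f z := by
  simp [dirDeriv]

theorem dirDeriv_congr (h : f =ᶠ[𝓝 z] g) : dirDeriv v f z = dirDeriv v g z := by
  simp [dirDeriv, h.fderiv_eq]

theorem dirDeriv_eqOn (hO : IsOpen O) (h : EqOn f g O) :
    EqOn (dirDeriv v f) (dirDeriv v g) O := fun _ hz =>
  dirDeriv_congr (h.eventuallyEq_of_mem (hO.mem_nhds hz))

theorem ContDiffOn.dirDeriv {m n : ℕ∞ω} (hf : ContDiffOn ℝ n f O) (hO : IsOpen O)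
    (hmn : m + 1 ≤ n) : ContDiffOn ℝ m (dirDeriv v f) O :=
  (hf.fderiv_of_isOpen hO hmn).clm_apply contDiffOn_const

theorem ContDiffOn.dirDeriv_infty (hf : ContDiffOn ℝ ∞ f O) (hO : IsOpen O) :
    ContDiffOn ℝ ∞ (_root_.dirDeriv v f) O := hf.dirDeriv hO (by simp)

theorem ContDiff.dirDeriv_infty (hf : ContDiff ℝ ∞ f) : ContDiff ℝ ∞ (_root_.dirDeriv v f) := by
  rw [← contDiffOn_univ] at *
  exact hf.dirDeriv_infty isOpen_univ

theorem hasDerivAt_comp_line {s : ℝ} (hf : DifferentiableAt ℝ f (z + s • v)) :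
    HasDerivAt (fun s : ℝ => f (z + s • v)) (dirDeriv v f (z + s • v)) s := by
  have h1 : HasDerivAt (fun s : ℝ => z + s • v) v s := by
    simpa using ((hasDerivAt_id s).smul_const v).const_add z
  exact hf.hasFDerivAt.comp_hasDerivAt s h1

theorem tendsto_line (z v : V) : Tendsto (fun s : ℝ => z + s • v) (𝓝 0) (𝓝 z) := by
  have : Continuous fun s : ℝ => z + s • v := by fun_prop
  simpa using this.tendsto 0

/-- Bridge between iterated directional derivatives and one-variable jets: with uniqueness of jets,
derivatives of composite expressions are found by computing along lines. -/
theorem hasJet_line (hO : IsOpen O) (hf : ContDiffOn ℝ 2 f O) (hz : z ∈ O) :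
    HasJet (fun s : ℝ => f (z + s • v)) (f z) (dirDeriv v f z) (dirDeriv v (dirDeriv v f) z) := by
  have h1 : ∀ y ∈ O, DifferentiableAt ℝ f y := fun y hy =>
    (hf.contDiffAt (hO.mem_nhds hy)).differentiableAt (by norm_num)
  have h2 : DifferentiableAt ℝ (dirDeriv v f) z :=
    ((hf.dirDeriv (m := 1) hO (by norm_num)).contDiffAt (hO.mem_nhds hz)).differentiableAt
      (by norm_num)
  refine ⟨fun s => dirDeriv v f (z + s • v), ?_, ?_, by simp, by simp⟩
  · filter_upwards [(tendsto_line z v).eventually (hO.mem_nhds hz)] with s hs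
    exact hasDerivAt_comp_line (h1 _ hs)
  · have := hasDerivAt_comp_line (s := 0) (v := v) (f := dirDeriv v f) (z := z) (by simpa using h2)
    simpa using this

theorem hasJet_line_infty (hO : IsOpen O) (hf : ContDiffOn ℝ ∞ f O) (hz : z ∈ O) :
    HasJet (fun s : ℝ => f (z + s • v)) (f z) (dirDeriv v f z) (dirDeriv v (dirDeriv v f) z) :=
  hasJet_line hO (hf.of_le two_le_infty) hz

theorem dirDeriv_comm (hO : IsOpen O) (hf : ContDiffOn ℝ 2 f O) (hz : z ∈ O) :
    dirDeriv v (dirDeriv w f) z = dirDeriv w (dirDeriv v f) z := by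
  have hf' := hf.contDiffAt (hO.mem_nhds hz)
  have h1 : DifferentiableAt ℝ (fderiv ℝ f) z :=
    (hf'.fderiv_right (m := 1) (by norm_num)).differentiableAt (by norm_num)
  have h2 := hf'.isSymmSndFDerivAt (by simp)
  have key : ∀ v w : V, dirDeriv v (dirDeriv w f) z = fderiv ℝ (fderiv ℝ f) z v w := by
    intro v w
    change fderiv ℝ (fun z => fderiv ℝ f z w) z v = _
    rw [fderiv_clm_apply h1 (differentiableAt_const w)]
    simp
  rw [key, key]
  exact h2 v w

theorem dirDeriv_comm_infty (hO : IsOpen O) (hf : ContDiffOn ℝ ∞ f O) :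
    EqOn (dirDeriv v (dirDeriv w f)) (dirDeriv w (dirDeriv v f)) O := fun _ hz =>
  dirDeriv_comm hO (hf.of_le two_le_infty) hz

theorem HasJet.dirDeriv_eq {f₀ f₁ f₂ : ℝ} (hO : IsOpen O) (hf : ContDiffOn ℝ 2 f O) (hz : z ∈ O)
    (h : HasJet (fun s : ℝ => f (z + s • v)) f₀ f₁ f₂) :
    f z = f₀ ∧ dirDeriv v f z = f₁ ∧ dirDeriv v (dirDeriv v f) z = f₂ :=
  (hasJet_line hO hf hz).unique h

end DirDeriv

/-! ### Space-time directions -/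

section SpaceTime

variable {N : ℕ}

instance : (volume : Measure (ℝ × EuclideanSpace ℝ (Fin N))).IsAddHaarMeasure :=
  Measure.prod.instIsAddHaarMeasure volume volume

/-- The unit vector of the time axis. -/
def timeDir (N : ℕ) : ℝ × EuclideanSpace ℝ (Fin N) := (1, 0)

/-- The spatial direction `ξ`, as a vector of space-time. -/
def spaceDir (ξ : EuclideanSpace ℝ (Fin N)) : ℝ × EuclideanSpace ℝ (Fin N) := (0, ξ)

/-- The `i`-th coordinate direction of space-time. -/
noncomputable def coordDir (i : Fin N) : ℝ × EuclideanSpace ℝ (Fin N) :=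
  spaceDir (EuclideanSpace.single i 1)

/-- The spatial Laplacian of a function of space-time. -/
noncomputable def spaceLaplacian (f : ℝ × EuclideanSpace ℝ (Fin N) → ℝ) :
    ℝ × EuclideanSpace ℝ (Fin N) → ℝ :=
  fun z => ∑ i, dirDeriv (coordDir i) (dirDeriv (coordDir i) f) z

/-- The square of the norm of the spatial gradient of a function of space-time. -/
noncomputable def gradSq (f : ℝ × EuclideanSpace ℝ (Fin N) → ℝ) :
    ℝ × EuclideanSpace ℝ (Fin N) → ℝ :=
  fun z => ∑ i, dirDeriv (coordDir i) f z ^ 2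

theorem deriv_time_eq_dirDeriv {f : ℝ × EuclideanSpace ℝ (Fin N) → ℝ}
    {z : ℝ × EuclideanSpace ℝ (Fin N)} (hf : DifferentiableAt ℝ f z) :
    deriv (fun s => f (s, z.2)) z.1 = dirDeriv (timeDir N) f z := by
  have h1 : HasDerivAt (fun s : ℝ => (s, z.2)) (timeDir N) z.1 :=
    (hasDerivAt_id z.1).prodMk (hasDerivAt_const z.1 z.2)
  exact (hf.hasFDerivAt.comp_hasDerivAt z.1 h1).deriv

theorem fderiv_slice {f : ℝ × EuclideanSpace ℝ (Fin N) → ℝ} {t : ℝ} {x : EuclideanSpace ℝ (Fin N)}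
    (hf : DifferentiableAt ℝ f (t, x)) (ξ : EuclideanSpace ℝ (Fin N)) :
    fderiv ℝ (fun y => f (t, y)) x ξ = dirDeriv (spaceDir ξ) f (t, x) := by
  have h1 := hf.hasFDerivAt.comp x (hasFDerivAt_prodMk_right t x)
  have h2 := h1.fderiv
  simp only [Function.comp_def] at h2
  rw [h2]
  rfl

theorem laplacian_slice {f : ℝ × EuclideanSpace ℝ (Fin N) → ℝ} (hf : ContDiff ℝ 2 f)
    (z : ℝ × EuclideanSpace ℝ (Fin N)) :
    Laplacian.laplacian (fun y => f (z.1, y)) z.2 = spaceLaplacian f z := by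
  rw [InnerProductSpace.laplacian_eq_iteratedFDeriv_orthonormalBasis _
    (EuclideanSpace.basisFun (Fin N) ℝ)]
  refine Finset.sum_congr rfl fun i _ => ?_
  have hd : Differentiable ℝ f := hf.differentiable (by norm_num)
  have hd2 : Differentiable ℝ (dirDeriv (coordDir i) f) := by
    have := (contDiffOn_univ.2 hf).dirDeriv (v := coordDir i) (m := 1) isOpen_univ (by norm_num)
    exact (contDiffOn_univ.1 this).differentiable (by norm_num)
  have hg : ContDiff ℝ 2 (fun y => f (z.1, y)) := hf.comp (by fun_prop)
  have hg1 : Differentiable ℝ (fderiv ℝ (fun y => f (z.1, y))) :=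
    (hg.fderiv_right (m := 1) (by norm_num)).differentiable (by norm_num)
  rw [iteratedFDeriv_two_apply]
  simp only [Matrix.cons_val_zero, Matrix.cons_val_one, EuclideanSpace.basisFun_apply]
  have h1 : (fun y => fderiv ℝ (fun y => f (z.1, y)) y (EuclideanSpace.single i 1))
      = fun y => dirDeriv (coordDir i) f (z.1, y) := by
    funext y
    exact fderiv_slice (hd _) _
  have h2 := fderiv_slice (x := z.2) (t := z.1) (hd2 (z.1, z.2)) (EuclideanSpace.single i 1)
  rw [← h1, fderiv_clm_apply (hg1 _) (differentiableAt_const _)] at h2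
  simpa [coordDir] using h2

end SpaceTime

/-! ### Integration against test functions -/

section DirDerivSupport

variable {V : Type*} [NormedAddCommGroup V] [NormedSpace ℝ V] {g : V → ℝ}

theorem tsupport_dirDeriv_subset (v : V) (g : V → ℝ) : tsupport (dirDeriv v g) ⊆ tsupport g := by
  refine (closure_mono fun x hx => ?_).trans (tsupport_fderiv_subset ℝ (f := g))
  intro h
  exact hx (by simp [dirDeriv, h])

theorem HasCompactSupport.dirDeriv (hg : HasCompactSupport g) (v : V) :
    HasCompactSupport (dirDeriv v g) :=
  hg.of_isClosed_subset (isClosed_tsupport _) (tsupport_dirDeriv_subset v g)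

end DirDerivSupport

section Integration

variable {V : Type*} [NormedAddCommGroup V] {f g : V → ℝ} {O : Set V}

/-- Off the support of `g` the product vanishes identically, so regularity of `f` on `O` alone
suffices. This lets test functions see only the region where the solution is regular. -/
theorem continuous_mul_of_tsupport (hO : IsOpen O) (hf : ContinuousOn f O) (hg : Continuous g)
    (hs : tsupport g ⊆ O) : Continuous fun z => f z * g z := by
  refine continuous_iff_continuousAt.2 fun z => ?_
  by_cases hz : z ∈ tsupport g
  · exact (hf.continuousAt (hO.mem_nhds (hs hz))).mul hg.continuousAt
  · have : (fun z => f z * g z) =ᶠ[𝓝 z] fun _ => 0 := by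
      filter_upwards [(isClosed_tsupport g).isOpen_compl.mem_nhds hz] with y hy
      rw [image_eq_zero_of_notMem_tsupport hy, mul_zero]
    exact continuousAt_const.congr this.symm

variable [MeasurableSpace V] [BorelSpace V] {μ : Measure V}

theorem integrable_mul_of_tsupport [IsFiniteMeasureOnCompacts μ] (hO : IsOpen O)
    (hf : ContinuousOn f O) (hg : Continuous g) (hc : HasCompactSupport g) (hs : tsupport g ⊆ O) :
    Integrable (fun z => f z * g z) μ :=
  (continuous_mul_of_tsupport hO hf hg hs).integrable_of_hasCompactSupport hc.mul_left

variable [NormedSpace ℝ V]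


theorem integral_mul_dirDeriv [FiniteDimensional ℝ V] [μ.IsAddHaarMeasure] (hO : IsOpen O)
    (hf : ContDiffOn ℝ 1 f O) (hg : ContDiff ℝ 1 g) (hc : HasCompactSupport g)
    (hs : tsupport g ⊆ O) (v : V) :
    ∫ z, f z * dirDeriv v g z ∂μ = -∫ z, dirDeriv v f z * g z ∂μ := by
  have hdg : Continuous (dirDeriv v g) := by
    have := (contDiffOn_univ.2 hg).dirDeriv (v := v) (m := 0) isOpen_univ (by norm_num)
    exact (contDiffOn_univ.1 this).continuous
  have hdf : ContinuousOn (dirDeriv v f) O :=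
    (hf.dirDeriv (v := v) (m := 0) hO (by norm_num)).continuousOn
  exact integral_mul_fderiv_eq_neg_fderiv_mul_of_integrable
    (integrable_mul_of_tsupport hO hdf hg.continuous hc hs)
    (integrable_mul_of_tsupport hO hf.continuousOn hdg (hc.dirDeriv v)
      ((tsupport_dirDeriv_subset v g).trans hs))
    (integrable_mul_of_tsupport hO hf.continuousOn hg.continuous hc hs)
    (fun x hx => (hf.contDiffAt (hO.mem_nhds (hs hx))).differentiableAt (by norm_num))
    (fun x _ => hg.differentiable (by norm_num) x)

theorem integral_mul_dirDeriv_dirDeriv [FiniteDimensional ℝ V] [μ.IsAddHaarMeasure]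
    (hO : IsOpen O) (hf : ContDiffOn ℝ 2 f O) (hg : ContDiff ℝ 2 g) (hc : HasCompactSupport g)
    (hs : tsupport g ⊆ O) (v : V) :
    ∫ z, f z * dirDeriv v (dirDeriv v g) z ∂μ = ∫ z, dirDeriv v (dirDeriv v f) z * g z ∂μ := by
  have hg1 : ContDiff ℝ 1 (dirDeriv v g) :=
    contDiffOn_univ.1 ((contDiffOn_univ.2 hg).dirDeriv isOpen_univ (by norm_num))
  rw [integral_mul_dirDeriv hO (hf.of_le (by norm_num)) hg1 (hc.dirDeriv v)
    ((tsupport_dirDeriv_subset v g).trans hs),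
    integral_mul_dirDeriv hO (hf.dirDeriv hO (by norm_num)) (hg.of_le (by norm_num)) hc hs, neg_neg]

end Integration

/-! ### Weak solutions satisfy the equation classically where they are regular -/

section Classical

variable {N : ℕ} {m T : ℝ} {G : ℝ → ℝ} {u : ℝ → EuclideanSpace ℝ (Fin N) → ℝ}
  {O : Set (ℝ × EuclideanSpace ℝ (Fin N))}

/-- A monotone function is measurable; truncating the argument at `0` extends the monotonicity of
`G` from the half-line to all of `ℝ`. Continuity of `G` cannot be used, as it is not assumed for
large pressures. -/
theorem measurable_reaction (hG : AntitoneOn G (Ici 0)) :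
    Measurable fun s : ℝ => s * G (max (pressure m s) 0) := by
  have h1 : Antitone fun s : ℝ => G (max s 0) := fun a b hab =>
    hG (mem_Ici.2 (le_max_right _ _)) (mem_Ici.2 (le_max_right _ _)) (max_le_max_right 0 hab)
  have h2 : Measurable (pressure m) := by unfold pressure; fun_prop
  exact measurable_id.mul (h1.measurable.comp h2)

theorem pressure_nonneg (hm : 1 < m) {s : ℝ} (hs : 0 ≤ s) : 0 ≤ pressure m s := by
  have : 0 < m - 1 := by linarith
  unfold pressure; positivity

theorem pressure_pos (hm : 1 < m) {s : ℝ} (hs : 0 < s) : 0 < pressure m s := by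
  have : 0 < m - 1 := by linarith
  unfold pressure; positivity

theorem pressure_mono (hm : 1 < m) {s t : ℝ} (hs : 0 ≤ s) (hst : s ≤ t) :
    pressure m s ≤ pressure m t := by
  have : 0 < m - 1 := by linarith
  unfold pressure
  gcongr

theorem pressure_zero (hm : 1 < m) : pressure m 0 = 0 := by
  unfold pressure
  rw [Real.zero_rpow (by linarith), mul_zero]

theorem pressure_pos_iff (hm : 1 < m) {s : ℝ} (hs : 0 ≤ s) : 0 < pressure m s ↔ 0 < s := by
  refine ⟨fun h => ?_, pressure_pos hm⟩
  rcases hs.lt_or_eq with h' | h'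
  · exact h'
  · rw [← h', pressure_zero hm] at h
    exact absurd h (lt_irrefl 0)

theorem continuous_pressure (hm : 1 < m) : Continuous (pressure m) := by
  unfold pressure
  exact continuous_const.mul (Real.continuous_rpow_const (by linarith))

/-- On a compact set the density is at most `|M|`, and monotonicity traps `G` between its values at
the pressure of `|M|` and at `0`. -/
theorem integrableOn_reaction (hm : 1 < m) (hG : AntitoneOn G (Ici 0))
    {U : ℝ × EuclideanSpace ℝ (Fin N) → ℝ} {K : Set (ℝ × EuclideanSpace ℝ (Fin N))}
    (hK : IsCompact K) (hU : ContinuousOn U K) (hpos : ∀ z ∈ K, 0 ≤ U z) :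
    IntegrableOn (fun z => U z * G (pressure m (U z))) K := by
  obtain ⟨M, hM⟩ := hK.exists_bound_of_continuousOn hU
  have hM' : ∀ z ∈ K, U z ≤ |M| := fun z hz =>
    (le_abs_self _).trans ((hM z hz).trans (le_abs_self M))
  have h1 : AEStronglyMeasurable (fun z => U z * G (pressure m (U z))) (volume.restrict K) := by
    have h2 : AEMeasurable U (volume.restrict K) := hU.aemeasurable hK.measurableSet
    refine (((measurable_reaction (m := m) hG).comp_aemeasurable h2).congr ?_).aestronglyMeasurable
    filter_upwards [ae_restrict_mem hK.measurableSet] with z hz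
    simp [max_eq_left (pressure_nonneg hm (hpos z hz))]
  have : IsFiniteMeasure (volume.restrict K) :=
    ⟨by simpa using hK.measure_lt_top⟩
  refine Integrable.of_bound (μ := volume.restrict K) (C := |M| * (|G 0| + |G (pressure m |M|)|)) h1 ?_
  filter_upwards [ae_restrict_mem hK.measurableSet] with z hz
  have h0 := pressure_nonneg hm (hpos z hz)
  have hle := pressure_mono hm (hpos z hz) (hM' z hz)
  have e1 : G (pressure m (U z)) ≤ G 0 := hG self_mem_Ici h0 h0
  have e2 : G (pressure m |M|) ≤ G (pressure m (U z)) := hG h0 (h0.trans hle) hle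
  rw [norm_mul, Real.norm_eq_abs, Real.norm_eq_abs, abs_of_nonneg (hpos z hz)]
  refine mul_le_mul (hM' z hz) ?_ (abs_nonneg _) (abs_nonneg _)
  rw [abs_le]
  constructor
  · linarith [neg_abs_le (G (pressure m |M|)), abs_nonneg (G 0)]
  · linarith [le_abs_self (G 0), abs_nonneg (G (pressure m |M|))]

/-- Integrate by parts against test functions supported in `O` and apply the fundamental lemma of
the calculus of variations. Only an almost-everywhere identity results, since the reaction term may
be discontinuous. -/
theorem IsWeakSolution.ae_eq (hu : IsWeakSolution m G T u) (hm : 1 < m)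
    (hG : AntitoneOn G (Ici 0)) (hO : IsOpen O) (hOT : O ⊆ Ioo 0 T ×ˢ univ)
    (hC : ContDiffOn ℝ 2 (fun z : ℝ × EuclideanSpace ℝ (Fin N) => u z.1 z.2) O)
    (hpos : ∀ z ∈ O, 0 < u z.1 z.2) :
    ∀ᵐ z : ℝ × EuclideanSpace ℝ (Fin N), z ∈ O →
      spaceLaplacian (fun z => u z.1 z.2 ^ m) z + u z.1 z.2 * G (pressure m (u z.1 z.2))
        - dirDeriv (timeDir N) (fun z => u z.1 z.2) z = 0 := by
  set U : ℝ × EuclideanSpace ℝ (Fin N) → ℝ := fun z => u z.1 z.2 with hUdef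
  have hW : ContDiffOn ℝ 2 (fun z => U z ^ m) O :=
    hC.rpow_const_of_ne fun z hz => (hpos z hz).ne'
  have hlap : ContinuousOn (spaceLaplacian fun z => U z ^ m) O := by
    refine continuousOn_finsetSum _ fun i _ => ?_
    exact ((hW.dirDeriv (m := 1) hO (by norm_num)).dirDeriv (m := 0) hO
      (by norm_num)).continuousOn
  have htime : ContinuousOn (dirDeriv (timeDir N) U) O :=
    (hC.dirDeriv (m := 0) hO (by norm_num)).continuousOn
  have hcO : ∀ K ⊆ O, IsCompact K → IntegrableOn (fun z => U z * G (pressure m (U z))) K :=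
    fun K hK hKc => integrableOn_reaction hm hG hKc (hC.continuousOn.mono hK)
      fun z hz => (hpos z (hK hz)).le
  refine hO.ae_eq_zero_of_integral_contDiff_smul_eq_zero ?_ ?_
  · refine ((hlap.locallyIntegrableOn hO.measurableSet).add ?_).sub
      (htime.locallyIntegrableOn hO.measurableSet)
    exact (locallyIntegrableOn_iff hO.isLocallyClosed).2 hcO
  intro φ hφ hφc hφs
  have hφ2 : ContDiff ℝ 2 φ := hφ.of_le two_le_infty
  have hφ1 : ContDiff ℝ 1 φ := hφ2.of_le (by norm_num)
  have hI := hu.weak φ hφ hφc (hφs.trans hOT)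
  have iA : Integrable fun z => U z * dirDeriv (timeDir N) φ z :=
    integrable_mul_of_tsupport hO hC.continuousOn (hφ.dirDeriv_infty).continuous
      (hφc.dirDeriv _) ((tsupport_dirDeriv_subset _ _).trans hφs)
  have iB : ∀ i : Fin N, Integrable fun z =>
      U z ^ m * dirDeriv (coordDir i) (dirDeriv (coordDir i) φ) z := fun i =>
    integrable_mul_of_tsupport hO hW.continuousOn (hφ.dirDeriv_infty.dirDeriv_infty).continuous
      ((hφc.dirDeriv _).dirDeriv _) (((tsupport_dirDeriv_subset _ _).trans
        (tsupport_dirDeriv_subset _ _)).trans hφs)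
  have iC : Integrable fun z => U z * G (pressure m (U z)) * φ z := by
    have h1 : IntegrableOn (fun z => U z * G (pressure m (U z)) * φ z) (tsupport φ) :=
      (hcO _ hφs hφc).mul_continuousOn hφ.continuous.continuousOn hφc
    refine (integrableOn_iff_integrable_of_support_subset ?_).1 h1
    refine fun z hz => subset_tsupport φ ?_
    exact fun h => hz (by simp [h])
  have e1 : ∀ z : ℝ × EuclideanSpace ℝ (Fin N),
      u z.1 z.2 * deriv (fun s => φ (s, z.2)) z.1
        + u z.1 z.2 ^ m * Laplacian.laplacian (fun y => φ (z.1, y)) z.2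
        + u z.1 z.2 * G (pressure m (u z.1 z.2)) * φ z
      = U z * dirDeriv (timeDir N) φ z
        + ∑ i, U z ^ m * dirDeriv (coordDir i) (dirDeriv (coordDir i) φ) z
        + U z * G (pressure m (U z)) * φ z := by
    intro z
    rw [deriv_time_eq_dirDeriv (hφ1.differentiable (by norm_num) z), laplacian_slice hφ2,
      spaceLaplacian, Finset.mul_sum]
  simp_rw [e1] at hI
  have iB' := integrable_finsetSum Finset.univ fun i (_ : i ∈ Finset.univ) => iB i
  have iA2 : Integrable fun z => dirDeriv (timeDir N) U z * φ z :=
    integrable_mul_of_tsupport hO htime hφ.continuous hφc hφs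
  have iB2 : Integrable fun z => spaceLaplacian (fun z => U z ^ m) z * φ z :=
    integrable_mul_of_tsupport hO hlap hφ.continuous hφc hφs
  have iAB : Integrable fun z => U z * dirDeriv (timeDir N) φ z
      + ∑ i, U z ^ m * dirDeriv (coordDir i) (dirDeriv (coordDir i) φ) z := iA.add iB'
  have iBC : Integrable fun z => spaceLaplacian (fun z => U z ^ m) z * φ z
      + U z * G (pressure m (U z)) * φ z := iB2.add iC
  rw [integral_add iAB iC, integral_add iA iB', integral_finsetSum _ fun i _ => iB i,
    integral_mul_dirDeriv hO (hC.of_le (by norm_num)) hφ1 hφc hφs] at hI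
  have e2 : ∑ i, ∫ z, U z ^ m * dirDeriv (coordDir i) (dirDeriv (coordDir i) φ) z
      = ∫ z, spaceLaplacian (fun z => U z ^ m) z * φ z := by
    simp_rw [spaceLaplacian, Finset.sum_mul]
    rw [integral_finsetSum]
    · exact Finset.sum_congr rfl fun i _ => integral_mul_dirDeriv_dirDeriv hO hW hφ2 hφc hφs _
    · intro i _
      exact integrable_mul_of_tsupport hO ((hW.dirDeriv (m := 1) hO (by norm_num)).dirDeriv (m := 0)
        hO (by norm_num)).continuousOn hφ.continuous hφc hφs
  rw [e2] at hI
  have e3 : ∀ z, φ z • (spaceLaplacian (fun z => U z ^ m) z + U z * G (pressure m (U z))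
      - dirDeriv (timeDir N) U z) = spaceLaplacian (fun z => U z ^ m) z * φ z
      + U z * G (pressure m (U z)) * φ z - dirDeriv (timeDir N) U z * φ z := by
    intro z; rw [smul_eq_mul]; ring
  refine (integral_congr_ae (Eventually.of_forall e3)).trans ?_
  rw [integral_sub iBC iA2, integral_add iB2 iC]
  linarith

theorem nonneg_of_ae_nonneg {V : Type*} [TopologicalSpace V] [MeasurableSpace V] {μ : Measure V}
    [μ.IsOpenPosMeasure] {O : Set V} (hO : IsOpen O) {f : V → ℝ} (hf : ContinuousOn f O)
    (h : ∀ᵐ z ∂μ, z ∈ O → 0 ≤ f z) {z : V} (hz : z ∈ O) : 0 ≤ f z := by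
  by_contra! hneg
  have h1 : IsOpen (O ∩ f ⁻¹' Iio 0) := hf.isOpen_inter_preimage hO isOpen_Iio
  have h2 : μ (O ∩ f ⁻¹' Iio 0) = 0 := by
    refine measure_mono_null (fun y hy => ?_) h
    simpa using ⟨hy.1, hy.2⟩
  exact (h1.measure_eq_zero_iff μ).1 h2 |>.le ⟨hz, hneg⟩

/-- The pressure equation, with the reaction term replaced by bounds for it. -/
theorem IsWeakSolution.pressure_equation_bounds (hu : IsWeakSolution m G T u) (hm : 1 < m)
    (hG : AntitoneOn G (Ici 0)) (hO : IsOpen O) (hOT : O ⊆ Ioo 0 T ×ˢ univ)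
    {P : ℝ × EuclideanSpace ℝ (Fin N) → ℝ} (hP : ∀ z ∈ O, P z = pressure m (u z.1 z.2))
    (hC : ContDiffOn ℝ 2 P O) (hpos : ∀ z ∈ O, 0 < P z) {lo hi : ℝ}
    (hlo : ∀ z ∈ O, lo ≤ G (P z)) (hhi : ∀ z ∈ O, G (P z) ≤ hi)
    {z : ℝ × EuclideanSpace ℝ (Fin N)} (hz : z ∈ O) :
    (m - 1) * P z * lo
        ≤ dirDeriv (timeDir N) P z - (m - 1) * P z * spaceLaplacian P z - gradSq P z ∧
      dirDeriv (timeDir N) P z - (m - 1) * P z * spaceLaplacian P z - gradSq P z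
        ≤ (m - 1) * P z * hi := by
  have ha : 0 < m - 1 := by linarith
  set U : ℝ × EuclideanSpace ℝ (Fin N) → ℝ := fun z => u z.1 z.2 with hUdef
  have hU0 : ∀ z ∈ O, 0 < U z := fun z hz => by
    have h1 := hu.nonneg z.1 ⟨(hOT hz).1.1.le, (hOT hz).1.2⟩ z.2
    exact (pressure_pos_iff hm h1).1 (by rw [← hP z hz]; exact hpos z hz)
  -- The density is a power of the pressure, hence as regular as the pressure where both are
  -- positive.
  have hUC : ContDiffOn ℝ 2 U O := by
    have h1 : ContDiffOn ℝ 2 (fun z => ((m - 1) / m * P z) ^ (m - 1)⁻¹) O :=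
      (contDiffOn_const.mul hC).rpow_const_of_ne fun z hz => by
        have := hpos z hz
        positivity
    refine h1.congr fun z hz => ?_
    have h3 : (m - 1) / m * (m / (m - 1) * U z ^ (m - 1)) = U z ^ (m - 1) := by
      field_simp
    rw [hP z hz, pressure, h3, ← Real.rpow_mul (hU0 z hz).le, mul_inv_cancel₀ ha.ne',
      Real.rpow_one]
  have hWC : ContDiffOn ℝ 2 (fun z => U z ^ m) O :=
    hUC.rpow_const_of_ne fun z hz => (hU0 z hz).ne'
  -- From `∇(U^m) = U ∇P` and `∇P = m U^(m-2) ∇U`: the factor `m U^(m-2)` turns the density equation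
  -- into the pressure equation, direction by direction.
  have jets : ∀ z ∈ O, ∀ v, dirDeriv v P z = m * U z ^ (m - 2) * dirDeriv v U z ∧
      m * U z ^ (m - 2) * dirDeriv v (dirDeriv v fun z => U z ^ m) z
        = (m - 1) * P z * dirDeriv v (dirDeriv v P) z + dirDeriv v P z ^ 2 := by
    intro z hz v
    have j := hasJet_line (v := v) hO hUC hz
    have jW := ((j.rpow (hU0 z hz) m).dirDeriv_eq (f := fun z => U z ^ m) hO hWC hz).2.2
    have jP := (((j.rpow (hU0 z hz) (m - 1)).const_mul (m / (m - 1))).congr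
      (g := fun s => P (z + s • v)) (by
        filter_upwards [(tendsto_line z v).eventually (hO.mem_nhds hz)] with s hs
        exact hP _ hs)).dirDeriv_eq hO hC hz
    obtain ⟨p0, p1, p2⟩ := jP
    have hz0 := hU0 z hz
    have e1 : U z ^ (m - 1) = U z ^ (m - 2) * U z := by
      rw [← Real.rpow_add_one hz0.ne']; congr 1; ring
    have e2 : U z ^ (m - 1 - 2) = U z ^ (m - 2) / U z := by
      rw [← Real.rpow_sub_one hz0.ne']; congr 1; ring
    have e3 : m - 1 - 1 = m - 2 := by ring
    rw [e3] at p1 p2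
    rw [e2] at p2
    rw [e1] at p0 jW
    rw [jW, p0, p1, p2]
    generalize U z ^ (m - 2) = X at *
    constructor <;> field_simp <;> ring
  -- This expression is continuous even if the reaction is not; so the almost-everywhere bounds
  -- below hold at every point.
  have hcont : ContinuousOn (fun z => dirDeriv (timeDir N) P z
      - (m - 1) * P z * spaceLaplacian P z - gradSq P z) O := by
    have h1 : ∀ v, ContinuousOn (dirDeriv v P) O := fun v =>
      (hC.dirDeriv (m := 1) hO (by norm_num)).continuousOn
    have h2 : ContinuousOn (spaceLaplacian P) O := continuousOn_finsetSum _ fun i _ =>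
      ((hC.dirDeriv (m := 1) hO (by norm_num)).dirDeriv (m := 0) hO (by norm_num)).continuousOn
    exact ((h1 _).sub ((continuousOn_const.mul hC.continuousOn).mul h2)).sub
      (continuousOn_finsetSum _ fun i _ => (h1 _).pow 2)
  have hae : ∀ᵐ z : ℝ × EuclideanSpace ℝ (Fin N), z ∈ O →
      dirDeriv (timeDir N) P z - (m - 1) * P z * spaceLaplacian P z - gradSq P z
        = (m - 1) * P z * G (P z) := by
    filter_upwards [hu.ae_eq hm hG hO hOT hUC hU0] with z hz hzO
    have h1 := hz hzO
    have h2 : m * U z ^ (m - 2) * spaceLaplacian (fun z => U z ^ m) z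
        = (m - 1) * P z * spaceLaplacian P z + gradSq P z := by
      simp only [spaceLaplacian, gradSq, Finset.mul_sum, ← Finset.sum_add_distrib]
      exact Finset.sum_congr rfl fun i _ => (jets z hzO _).2
    have h3 : (m - 1) * P z = m * U z ^ (m - 2) * U z := by
      rw [hP z hzO, pressure, mul_assoc m, ← Real.rpow_add_one (hU0 z hzO).ne',
        show m - 2 + 1 = m - 1 by ring]
      field_simp
      rfl
    have h4 : (m - 1) * P z * G (P z) = m * U z ^ (m - 2) * U z * G (pressure m (U z)) := by
      rw [h3, hP z hzO]
    rw [h4, (jets z hzO _).1]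
    linear_combination h2 - m * U z ^ (m - 2) * h1
  have hPc : ContinuousOn P O := hC.continuousOn
  constructor
  · refine sub_nonneg.1 (nonneg_of_ae_nonneg hO
      (f := fun z => (dirDeriv (timeDir N) P z - (m - 1) * P z * spaceLaplacian P z - gradSq P z)
        - (m - 1) * P z * lo) (hcont.sub (by fun_prop)) (μ := volume) ?_ hz)
    filter_upwards [hae] with z hz hzO
    rw [hz hzO, ← mul_sub]
    have := hpos z hzO
    have := hlo z hzO
    exact mul_nonneg (by positivity) (by linarith)
  · refine sub_nonneg.1 (nonneg_of_ae_nonneg hO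
      (f := fun z => (m - 1) * P z * hi - (dirDeriv (timeDir N) P z
        - (m - 1) * P z * spaceLaplacian P z - gradSq P z))
        (ContinuousOn.sub (by fun_prop) hcont) (μ := volume) ?_ hz)
    filter_upwards [hae] with z hz hzO
    rw [hz hzO, ← mul_sub]
    have := hpos z hzO
    have := hhi z hzO
    exact mul_nonneg (by positivity) (by linarith)

/-- The pressure equation, where the reaction term is continuous. -/
theorem IsWeakSolution.pressure_equation (hu : IsWeakSolution m G T u) (hm : 1 < m)
    (hG : AntitoneOn G (Ici 0)) (hO : IsOpen O) (hOT : O ⊆ Ioo 0 T ×ˢ univ)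
    {P : ℝ × EuclideanSpace ℝ (Fin N) → ℝ} (hP : ∀ z ∈ O, P z = pressure m (u z.1 z.2))
    (hC : ContDiffOn ℝ 2 P O) (hpos : ∀ z ∈ O, 0 < P z)
    (hGc : ContinuousOn (fun z => G (P z)) O)
    {z : ℝ × EuclideanSpace ℝ (Fin N)} (hz : z ∈ O) :
    dirDeriv (timeDir N) P z
      = (m - 1) * P z * spaceLaplacian P z + gradSq P z + (m - 1) * P z * G (P z) := by
  have ha : 0 < m - 1 := by linarith
  have hp := hpos z hz
  have key : ∀ ε > 0, |dirDeriv (timeDir N) P z - (m - 1) * P z * spaceLaplacian P z - gradSq P z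
      - (m - 1) * P z * G (P z)| ≤ ε := by
    intro ε hε
    -- Near `z` the reaction coefficient varies by less than `δ`, which costs exactly `ε` after
    -- multiplication by `(m - 1) P`.
    set δ := ε / ((m - 1) * P z) with hδ
    have hδ0 : 0 < δ := by positivity
    have h1 : IsOpen (O ∩ (fun z => G (P z)) ⁻¹' Ioo (G (P z) - δ) (G (P z) + δ)) :=
      hGc.isOpen_inter_preimage hO isOpen_Ioo
    have h2 := hu.pressure_equation_bounds hm hG h1 (inter_subset_left.trans hOT)
      (fun z hz => hP z hz.1) (hC.mono inter_subset_left) (fun z hz => hpos z hz.1)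
      (fun z hz => hz.2.1.le) (fun z hz => hz.2.2.le) (z := z) ⟨hz, by simp [hδ0]⟩
    have h3 : (m - 1) * P z * δ = ε := by rw [hδ]; field_simp
    rw [abs_le]
    constructor <;> linarith [h2.1, h2.2]
  have := abs_nonpos_iff.1 (le_of_forall_pos_le_add fun ε hε => (key ε hε).trans (zero_add ε).ge)
  linarith

end Classical

/-! ### Smooth pressures and the maximum principle -/

/-- The left difference quotients are nonnegative. Only the past is compared, as befits a maximum
over a parabolic cylinder, where the extremal time may be the final one. -/
theorem HasDerivAt.nonneg_of_eventually_le_left {f : ℝ → ℝ} {f' a : ℝ} (hf : HasDerivAt f f' a)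
    (h : ∀ᶠ s in 𝓝[<] a, f s ≤ f a) : 0 ≤ f' := by
  have h1 := (hasDerivAt_iff_tendsto_slope.1 hf).mono_left
    (nhdsWithin_mono a fun s (hs : s ∈ Iio a) => (ne_of_lt hs : s ≠ a))
  refine ge_of_tendsto h1 ?_
  filter_upwards [h, self_mem_nhdsWithin] with s hs hsa
  rw [slope_def_field]
  exact div_nonneg_of_nonpos (by linarith) (by linarith [mem_Iio.1 hsa])

/-- `P` is a pressure on `[0, T)` which agrees with the smooth function `Q` where it is positive,
and which satisfies the pressure equation there, the reaction term being replaced by bounds. -/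
structure SmoothPressure {N : ℕ} (a : ℝ) (G : ℝ → ℝ) (T : ℝ)
    (P Q : ℝ × EuclideanSpace ℝ (Fin N) → ℝ) : Prop where
  a_pos : 0 < a
  anti : AntitoneOn G (Ici 0)
  cont : ContinuousOn P (Ico 0 T ×ˢ univ)
  nonneg : ∀ z, z.1 ∈ Ico 0 T → 0 ≤ P z
  bounded : ∀ S < T, ∃ M, ∀ z, z.1 ∈ Icc 0 S → P z ≤ M
  smooth : ContDiffOn ℝ ∞ Q (Iio T ×ˢ univ)
  eq : ∀ z, z.1 ∈ Ico 0 T → 0 < P z → Q z = P z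
  equation_le : ∀ O : Set (ℝ × EuclideanSpace ℝ (Fin N)), IsOpen O → O ⊆ Ioo 0 T ×ˢ univ →
    (∀ z ∈ O, 0 < P z) → ∀ hi, (∀ z ∈ O, G (P z) ≤ hi) → ∀ z ∈ O,
      dirDeriv (timeDir N) Q z ≤ a * Q z * spaceLaplacian Q z + gradSq Q z + a * Q z * hi
  equation_ge : ∀ O : Set (ℝ × EuclideanSpace ℝ (Fin N)), IsOpen O → O ⊆ Ioo 0 T ×ˢ univ →
    (∀ z ∈ O, 0 < P z) → ∀ lo, (∀ z ∈ O, lo ≤ G (P z)) → ∀ z ∈ O,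
      a * Q z * spaceLaplacian Q z + gradSq Q z + a * Q z * lo ≤ dirDeriv (timeDir N) Q z

theorem IsWeakSolution.exists_smoothPressure {N : ℕ} {m T : ℝ} {G : ℝ → ℝ}
    {u : ℝ → EuclideanSpace ℝ (Fin N) → ℝ} (hu : IsWeakSolution m G T u) (hm : 1 < m)
    (hG : AntitoneOn G (Ici 0))
    (hs : SmoothUpToFreeBoundary T (fun t x => pressure m (u t x))) :
    ∃ Q, SmoothPressure (m - 1) G T (fun z => pressure m (u z.1 z.2)) Q := by
  obtain ⟨Q, hQ, hQP⟩ := hs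
  refine ⟨Q, by linarith, hG, (continuous_pressure hm).comp_continuousOn hu.continuousOn,
    fun z hz => pressure_nonneg hm (hu.nonneg _ hz _), fun S hS => ?_, hQ,
    fun z hz hp => hQP z ⟨hz, hp⟩, ?_, ?_⟩
  · obtain ⟨M, hM⟩ := hu.bounded S hS
    exact ⟨pressure m M, fun z hz => pressure_mono hm
      (hu.nonneg _ ⟨hz.1, hz.2.trans_lt hS⟩ _) (hM _ hz _)⟩
  · intro O hO hOT hpos hi hhi z hz
    have he : EqOn Q (fun z => pressure m (u z.1 z.2)) O := fun z hz =>
      hQP z ⟨⟨(hOT hz).1.1.le, (hOT hz).1.2⟩, hpos z hz⟩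
    have hC : ContDiffOn ℝ 2 Q O := (hQ.mono fun z hz => ⟨(hOT hz).1.2, mem_univ _⟩).of_le
      two_le_infty
    -- The two-sided bounds also ask for some lower bound of `G`; capping the pressure near `z`
    -- provides one by monotonicity.
    have hO' : IsOpen (O ∩ Q ⁻¹' Iio (Q z + 1)) := hC.continuousOn.isOpen_inter_preimage hO isOpen_Iio
    have := (hu.pressure_equation_bounds (lo := G (Q z + 1)) hm hG hO' (fun z hz => hOT hz.1)
      (fun z hz => he hz.1) (hC.mono inter_subset_left)
      (fun z hz => (he hz.1).symm ▸ hpos z hz.1)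
      (fun y hy => hG (mem_Ici.2 ((he hy.1).symm ▸ (hpos y hy.1).le))
        (mem_Ici.2 ((he hz).symm ▸ (add_pos (hpos z hz) one_pos).le)) hy.2.le)
      (fun y hy => by rw [he hy.1]; exact hhi y hy.1) (z := z) ⟨hz, by simp⟩).2
    linarith
  · intro O hO hOT hpos lo hlo z hz
    have he : EqOn Q (fun z => pressure m (u z.1 z.2)) O := fun z hz =>
      hQP z ⟨⟨(hOT hz).1.1.le, (hOT hz).1.2⟩, hpos z hz⟩
    have hC : ContDiffOn ℝ 2 Q O := (hQ.mono fun z hz => ⟨(hOT hz).1.2, mem_univ _⟩).of_le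
      two_le_infty
    have := (hu.pressure_equation_bounds (hi := G 0) hm hG hO hOT
      (fun z hz => he hz) hC (fun z hz => (he hz).symm ▸ hpos z hz)
      (fun y hy => by rw [he hy]; exact hlo y hy)
      (fun y hy => hG self_mem_Ici (mem_Ici.2 ((he hy).symm ▸ (hpos y hy).le))
        ((he hy).symm ▸ (hpos y hy).le)) hz).1
    linarith

namespace SmoothPressure

variable {N : ℕ} {a T : ℝ} {G : ℝ → ℝ} {P Q : ℝ × EuclideanSpace ℝ (Fin N) → ℝ}

theorem isOpen_pos (h : SmoothPressure a G T P Q) :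
    IsOpen {z : ℝ × EuclideanSpace ℝ (Fin N) | z.1 ∈ Ioo 0 T ∧ 0 < P z} := by
  have h1 : ContinuousOn P (Ioo 0 T ×ˢ univ) :=
    h.cont.mono (prod_mono Ioo_subset_Ico_self Subset.rfl)
  have := h1.isOpen_inter_preimage (isOpen_Ioo.prod isOpen_univ) (isOpen_Ioi (a := 0))
  convert this using 1
  ext z
  simp

theorem isOpen_slice (h : SmoothPressure a G T P Q) {t : ℝ} (ht : t ∈ Ico 0 T) :
    IsOpen {x | 0 < P (t, x)} := by
  have h1 : Continuous fun x => P (t, x) :=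
    h.cont.comp_continuous (by fun_prop) fun x => ⟨ht, mem_univ _⟩
  exact isOpen_lt continuous_const h1

theorem isOpen_domain : IsOpen (Iio T ×ˢ (univ : Set (EuclideanSpace ℝ (Fin N)))) :=
  isOpen_Iio.prod isOpen_univ

/-- If the pressure exceeds the comparison function `w` somewhere, but not at the parabolic
boundary of a cylinder, then `w` fails to be a supersolution at some point where it is exceeded. -/
theorem exists_not_supersolution (h : SmoothPressure a G T P Q) {S : ℝ} (hS : S < T)
    {K : Set (EuclideanSpace ℝ (Fin N))} (hK : IsCompact K)
    {w : ℝ × EuclideanSpace ℝ (Fin N) → ℝ} (hw : ContDiff ℝ 2 w)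
    (hw0 : ∀ z, 0 ≤ w z) (L hi : ℝ)
    (hhi : ∀ z, z.1 ∈ Ioo 0 T → w z < P z → G (P z) ≤ hi)
    (h0 : ∀ x ∈ K, P (0, x) ≤ w (0, x))
    (hbd : ∀ t ∈ Icc 0 S, ∀ x ∈ K, x ∉ interior K → P (t, x) ≤ w (t, x))
    (hex : ∃ t ∈ Icc 0 S, ∃ x ∈ K, w (t, x) < P (t, x)) :
    ∃ z : ℝ × EuclideanSpace ℝ (Fin N), z.1 ∈ Ioc 0 S ∧ z.2 ∈ K ∧ w z < P z ∧
      dirDeriv (timeDir N) w z + L * (P z - w z)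
        ≤ a * P z * spaceLaplacian w z + gradSq w z + a * P z * hi := by
  -- At a maximum of this weighted difference, `∂ₜ(P - w) ≥ L (P - w)`; the exponential supplies the
  -- extra term that makes weak supersolutions behave like strict ones.
  set f : ℝ × EuclideanSpace ℝ (Fin N) → ℝ := fun z => (P z - w z) * Real.exp (-L * z.1) with hf
  have hsub : Icc 0 S ×ˢ K ⊆ Ico 0 T ×ˢ univ :=
    prod_mono (fun t ht => ⟨ht.1, ht.2.trans_lt hS⟩) (subset_univ _)
  have hfc : ContinuousOn f (Icc 0 S ×ˢ K) := by
    have := hw.continuous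
    exact ((h.cont.mono hsub).sub (by fun_prop)).mul (by fun_prop)
  obtain ⟨t₀, ht₀, x₀, hx₀, hlt⟩ := hex
  obtain ⟨z, hz, hmax⟩ := (isCompact_Icc.prod hK).exists_isMaxOn ⟨(t₀, x₀), ht₀, hx₀⟩ hfc
  have hzpos : w z < P z := by
    have h1 : 0 < f (t₀, x₀) := mul_pos (by linarith) (Real.exp_pos _)
    have h2 : 0 < f z := h1.trans_le (hmax (show (t₀, x₀) ∈ Icc 0 S ×ˢ K from ⟨ht₀, hx₀⟩))
    have := (pos_iff_pos_of_mul_pos h2).2 (Real.exp_pos _)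
    linarith
  have hz1 : 0 < z.1 := by
    rcases hz.1.1.lt_or_eq with h1 | h1
    · exact h1
    · have := h0 z.2 hz.2
      rw [show ((0 : ℝ), z.2) = z from Prod.ext h1 rfl] at this
      linarith
  have hz2 : z.2 ∈ interior K := by
    by_contra h1
    have := hbd z.1 hz.1 z.2 hz.2 h1
    linarith
  -- Where `P > w ≥ 0` the pressure is positive, so it agrees with its smooth extension and the
  -- equation is available.
  set O : Set (ℝ × EuclideanSpace ℝ (Fin N)) := (Ioo 0 T ×ˢ interior K) ∩ (fun z => P z - w z) ⁻¹'
    Ioi 0 with hOdef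
  have hO : IsOpen O := by
    refine ContinuousOn.isOpen_inter_preimage (((h.cont.mono ?_).sub ?_))
      (isOpen_Ioo.prod isOpen_interior) isOpen_Ioi
    · exact prod_mono Ioo_subset_Ico_self (subset_univ _)
    · exact hw.continuous.continuousOn
  have hOT : O ⊆ Ioo 0 T ×ˢ univ := fun y hy => ⟨hy.1.1, mem_univ _⟩
  have hOw : ∀ y ∈ O, w y < P y := fun y hy => sub_pos.1 hy.2
  have hOpos : ∀ y ∈ O, 0 < P y := fun y hy => (hw0 y).trans_lt (hOw y hy)
  have hzO : z ∈ O := ⟨⟨⟨hz1, hz.1.2.trans_lt hS⟩, hz2⟩, sub_pos.2 hzpos⟩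
  have hQP : EqOn Q P O := fun y hy => h.eq y (Ioo_subset_Ico_self hy.1.1) (hOpos y hy)
  have hQC : ContDiffOn ℝ 2 Q O := (h.smooth.mono fun y hy => ⟨hy.1.1.2, mem_univ _⟩).of_le
    two_le_infty
  have hwC : ContDiffOn ℝ 2 w O := hw.contDiffOn
  have heq := h.equation_le O hO hOT hOpos hi (fun y hy => hhi y hy.1.1 (hOw y hy)) z hzO
  have hspace : ∀ i, dirDeriv (coordDir i) Q z = dirDeriv (coordDir i) w z ∧
      dirDeriv (coordDir i) (dirDeriv (coordDir i) Q) z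
        ≤ dirDeriv (coordDir i) (dirDeriv (coordDir i) w) z := by
    intro i
    have hj := (hasJet_line (v := coordDir i) hO hQC hzO).sub
      (hasJet_line (v := coordDir i) hO hwC hzO)
    have hmx : IsLocalMax (fun s : ℝ => Q (z + s • coordDir i) - w (z + s • coordDir i)) 0 := by
      filter_upwards [(tendsto_line z (coordDir i)).eventually (hO.mem_nhds hzO)] with s hs
      have h1 : (z + s • coordDir i).1 = z.1 := by simp [coordDir, spaceDir]
      have h2 := hmax (show z + s • coordDir i ∈ Icc 0 S ×ˢ K from
        ⟨by rw [h1]; exact hz.1, interior_subset hs.1.2⟩)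
      simp only [hf, mem_ofPred_eq, h1] at h2
      have h3 := le_of_mul_le_mul_right h2 (Real.exp_pos _)
      simpa [hQP hs, hQP hzO] using h3
    have := hj.of_isLocalMax hmx
    exact ⟨by linarith [this.1], by linarith [this.2]⟩
  have htime : dirDeriv (timeDir N) w z + L * (P z - w z) ≤ dirDeriv (timeDir N) Q z := by
    have hQd := (hasJet_line (v := timeDir N) hO hQC hzO).hasDerivAt
    have hwd := (hasJet_line (v := timeDir N) hO hwC hzO).hasDerivAt
    have hed : HasDerivAt (fun s : ℝ => Real.exp (-L * (z.1 + s)))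
        (Real.exp (-L * z.1) * -L) 0 := by
      have h1 : HasDerivAt (fun s : ℝ => -L * (z.1 + s)) (-L) 0 := by
        simpa using ((hasDerivAt_id (0 : ℝ)).const_add z.1).const_mul (-L)
      simpa using h1.exp
    have hd := (hQd.sub hwd).mul hed
    have h1 := hd.nonneg_of_eventually_le_left ?_
    · simp only [Pi.sub_apply, zero_smul, add_zero, hQP hzO] at h1
      have h2 : 0 ≤ Real.exp (-L * z.1) * (dirDeriv (timeDir N) Q z - dirDeriv (timeDir N) w z
          - L * (P z - w z)) := by linarith
      have := nonneg_of_mul_nonneg_right h2 (Real.exp_pos _)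
      linarith
    · have e1 : ∀ᶠ s : ℝ in 𝓝[<] 0, z + s • timeDir N ∈ O :=
        ((tendsto_line z (timeDir N)).eventually (hO.mem_nhds hzO)).filter_mono nhdsWithin_le_nhds
      filter_upwards [e1, self_mem_nhdsWithin] with s hs hs0
      have h1 : (z + s • timeDir N).1 = z.1 + s := by simp [timeDir]
      have h2 := hmax (show z + s • timeDir N ∈ Icc 0 S ×ˢ K from
        ⟨⟨hs.1.1.1.le, by rw [h1]; linarith [hz.1.2, mem_Iio.1 hs0]⟩, interior_subset hs.1.2⟩)
      simp only [hf, mem_ofPred_eq, h1] at h2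
      simpa [hQP hs, hQP hzO] using h2
  refine ⟨z, ⟨hz1, hz.1.2⟩, hz.2, hzpos, htime.trans (heq.trans ?_)⟩
  have h1 : spaceLaplacian Q z ≤ spaceLaplacian w z := Finset.sum_le_sum fun i _ => (hspace i).2
  have h2 : gradSq Q z = gradSq w z := Finset.sum_congr rfl fun i _ => by rw [(hspace i).1]
  have h3 : 0 ≤ a * P z := mul_nonneg h.a_pos.le (hOpos z hzO).le
  rw [hQP hzO, h2]
  nlinarith [mul_le_mul_of_nonneg_left h1 h3]

end SmoothPressure

/-! ### Comparison functions: functions of time alone, and a paraboloidal barrier. -/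

section Comparison

variable {N : ℕ}

theorem dirDeriv_coord_of_time (φ : ℝ → ℝ) (i : Fin N) (z : ℝ × EuclideanSpace ℝ (Fin N))
    (hφ : ContDiff ℝ 2 φ) : dirDeriv (coordDir i) (fun z => φ z.1) z = 0 ∧
      dirDeriv (coordDir i) (dirDeriv (coordDir i) fun z => φ z.1) z = 0 := by
  have h := ((HasJet.const (φ z.1)).congr (g := fun s : ℝ => φ (z + s • coordDir i).1)
    (Eventually.of_forall fun s => by simp [coordDir, spaceDir])).dirDeriv_eq
    (f := fun z => φ z.1) isOpen_univ (hφ.comp contDiff_fst).contDiffOn (mem_univ z)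
  exact h.2

theorem spaceLaplacian_of_time {φ : ℝ → ℝ} (hφ : ContDiff ℝ 2 φ)
    (z : ℝ × EuclideanSpace ℝ (Fin N)) : spaceLaplacian (fun z => φ z.1) z = 0 :=
  Finset.sum_eq_zero fun i _ => (dirDeriv_coord_of_time φ i z hφ).2

theorem gradSq_of_time {φ : ℝ → ℝ} (hφ : ContDiff ℝ 2 φ)
    (z : ℝ × EuclideanSpace ℝ (Fin N)) : gradSq (fun z => φ z.1) z = 0 :=
  Finset.sum_eq_zero fun i _ => by rw [(dirDeriv_coord_of_time φ i z hφ).1]; norm_num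

theorem dirDeriv_time_eq_of_hasDerivAt {f : ℝ × EuclideanSpace ℝ (Fin N) → ℝ}
    {z : ℝ × EuclideanSpace ℝ (Fin N)} {d : ℝ} (hf : DifferentiableAt ℝ f z)
    (h : HasDerivAt (fun s => f (s, z.2)) d z.1) : dirDeriv (timeDir N) f z = d := by
  rw [← deriv_time_eq_dirDeriv hf, h.deriv]

/-- The barrier used to control the support. -/
noncomputable def barrier (k S ε : ℝ) (x₁ : EuclideanSpace ℝ (Fin N))
    (z : ℝ × EuclideanSpace ℝ (Fin N)) : ℝ :=
  Real.exp (k * (z.1 - S)) * (‖z.2 - x₁‖ ^ 2 + ε)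

variable {k S ε : ℝ} {x₁ : EuclideanSpace ℝ (Fin N)}

theorem contDiff_barrier : ContDiff ℝ 2 (barrier k S ε x₁) := by
  unfold barrier
  exact (by fun_prop : ContDiff ℝ 2 fun z : ℝ × EuclideanSpace ℝ (Fin N) =>
    Real.exp (k * (z.1 - S))).mul (((contDiff_snd.sub contDiff_const).norm_sq ℝ).add contDiff_const)

theorem dirDeriv_time_barrier (z : ℝ × EuclideanSpace ℝ (Fin N)) :
    dirDeriv (timeDir N) (barrier k S ε x₁) z = k * barrier k S ε x₁ z := by
  refine dirDeriv_time_eq_of_hasDerivAt (contDiff_barrier.differentiable (by norm_num) z) ?_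
  have h1 : HasDerivAt (fun s : ℝ => k * (s - S)) k z.1 := by
    simpa using ((hasDerivAt_id z.1).sub_const S).const_mul k
  refine (h1.exp.mul_const (‖z.2 - x₁‖ ^ 2 + ε)).congr_deriv ?_
  simp only [barrier]; ring

theorem dirDeriv_coord_barrier (z : ℝ × EuclideanSpace ℝ (Fin N)) (i : Fin N) :
    dirDeriv (coordDir i) (barrier k S ε x₁) z
        = Real.exp (k * (z.1 - S)) * (2 * (z.2 - x₁) i) ∧
      dirDeriv (coordDir i) (dirDeriv (coordDir i) (barrier k S ε x₁)) z
        = Real.exp (k * (z.1 - S)) * 2 := by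
  have hj : HasJet (fun s : ℝ => Real.exp (k * (z.1 - S))
      * ((‖z.2 - x₁‖ ^ 2 + ε) + (2 * (z.2 - x₁) i * s + s ^ 2))) _ _ _ :=
    ((HasJet.const _).add ((HasJet.id.const_mul _).add HasJet.id.pow_two)).const_mul _
  have h := (hj.congr (g := fun s : ℝ => barrier k S ε x₁ (z + s • coordDir i))
    (Eventually.of_forall fun s => ?_)).dirDeriv_eq isOpen_univ contDiff_barrier.contDiffOn
      (mem_univ z)
  · refine ⟨h.2.1.trans (by ring), h.2.2.trans (by ring)⟩
  · have e1 : (z + s • coordDir i).2 - x₁ = (z.2 - x₁) + s • EuclideanSpace.single i 1 := by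
      simp [coordDir, spaceDir]; abel
    have e2 : (z + s • coordDir i).1 = z.1 := by simp [coordDir, spaceDir]
    simp only [barrier, e1, e2]
    rw [@norm_add_sq_real, inner_smul_right, EuclideanSpace.inner_single_right, norm_smul]
    simp
    ring

theorem spaceLaplacian_barrier (z : ℝ × EuclideanSpace ℝ (Fin N)) :
    spaceLaplacian (barrier k S ε x₁) z = 2 * N * Real.exp (k * (z.1 - S)) := by
  simp only [spaceLaplacian, (dirDeriv_coord_barrier z _).2]
  simp; ring

theorem gradSq_barrier (z : ℝ × EuclideanSpace ℝ (Fin N)) :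
    gradSq (barrier k S ε x₁) z = 4 * Real.exp (k * (z.1 - S)) ^ 2 * ‖z.2 - x₁‖ ^ 2 := by
  simp only [gradSq, (dirDeriv_coord_barrier z _).1]
  rw [EuclideanSpace.real_norm_sq_eq, Finset.mul_sum]
  exact Finset.sum_congr rfl fun i _ => by ring

end Comparison

namespace SmoothPressure

variable {N : ℕ} {a T : ℝ} {G : ℝ → ℝ} {P Q : ℝ × EuclideanSpace ℝ (Fin N) → ℝ}

/-- Finite speed of propagation. Around a point `x₁` far from the initial support, the barrier
dominates the pressure on the parabolic boundary of a ball, while at `x₁` it is at most `ε`; so the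
pressure vanishes at `x₁`. -/
theorem support_bounded (h : SmoothPressure a G T P Q) {S : ℝ} (hS : S < T) {R₀ : ℝ}
    (h0 : ∀ x, 0 < P (0, x) → ‖x‖ ≤ R₀) :
    ∃ R, ∀ t ∈ Icc 0 S, ∀ x, 0 < P (t, x) → ‖x‖ ≤ R := by
  obtain ⟨M, hM⟩ := h.bounded S hS
  set g := max (G 0) 0
  -- Diffusion and reaction contribute at most `a (2N + g) P`, the squared gradient at most `4w ≤
  -- 4P`; the remaining unit gives strictness. Using `k` also as the rate in the maximum principle
  -- gives `k w + k (P - w) = k P`.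
  set k := a * (2 * N + g) + 5 with hk
  -- On the lateral boundary the barrier is at least `e^(-kS) R²`, which is at least `M` because `R
  -- ≥ M e^(kS)` and `R ≥ 1`.
  set R := max (M * Real.exp (k * S)) 1 with hR
  have hR1 : 1 ≤ R := le_max_right _ _
  have ha := h.a_pos
  have hg0 : 0 ≤ g := le_max_right _ _
  refine ⟨R₀ + R, fun t ht x₁ hx₁ => ?_⟩
  by_contra! hfar
  have key : ∀ ε > 0, P (t, x₁) ≤ ε := by
    intro ε hε
    have hw0 : ∀ z, 0 ≤ barrier k S ε x₁ z := fun z => by unfold barrier; positivity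
    have hwt : barrier k S ε x₁ (t, x₁) ≤ ε := by
      have h1 : Real.exp (k * (t - S)) ≤ 1 := by
        rw [Real.exp_le_one_iff]
        exact mul_nonpos_of_nonneg_of_nonpos (by positivity) (by linarith [ht.2])
      simp only [barrier, sub_self, norm_zero]
      nlinarith
    refine le_trans ?_ hwt
    by_contra! hlt
    have hns := h.exists_not_supersolution hS
      (isCompact_closedBall x₁ R) (contDiff_barrier (k := k) (S := S) (ε := ε) (x₁ := x₁)) hw0 k g
      (fun z hz hlt => (h.anti self_mem_Ici (mem_Ici.2 ((hw0 z).trans hlt.le))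
        ((hw0 z).trans hlt.le)).trans (le_max_left _ _)) ?_ ?_
      ⟨t, ht, x₁, Metric.mem_closedBall_self (by linarith), hlt⟩
    · obtain ⟨z, hz1, hz2, hz3, hz4⟩ := hns
      rw [dirDeriv_time_barrier, spaceLaplacian_barrier, gradSq_barrier] at hz4
      set w := barrier k S ε x₁ z with hw
      set c := Real.exp (k * (z.1 - S)) with hc
      have hc0 : 0 < c := Real.exp_pos _
      have hc1 : c ≤ 1 := by
        rw [hc, Real.exp_le_one_iff]
        exact mul_nonpos_of_nonneg_of_nonpos (by positivity) (by linarith [hz1.2])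
      have hwc : w = c * (‖z.2 - x₁‖ ^ 2 + ε) := rfl
      have e1 : 4 * c ^ 2 * ‖z.2 - x₁‖ ^ 2 ≤ 4 * w := by
        have : 0 ≤ c * (‖z.2 - x₁‖ ^ 2) := by positivity
        rw [hwc]
        nlinarith
      have hP0 : 0 ≤ a * P z := mul_nonneg ha.le ((hw0 z).trans hz3.le)
      have e2 : a * P z * (2 * N * c) ≤ a * P z * (2 * N) :=
        mul_le_mul_of_nonneg_left (mul_le_of_le_one_right (by positivity) hc1) hP0
      rw [hk] at hz4
      nlinarith [hw0 z]
    · intro x hx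
      have h1 : P (0, x) ≤ 0 := by
        by_contra! h2
        have h3 := h0 x h2
        have h4 : ‖x₁‖ ≤ ‖x‖ + dist x x₁ := by
          rw [dist_eq_norm']
          simpa using norm_add_le x (x₁ - x)
        linarith [Metric.mem_closedBall.1 hx]
      exact h1.trans (hw0 _)
    · intro s hs x hx hxi
      rw [interior_closedBall _ (by linarith), Metric.mem_ball, not_lt] at hxi
      have hd : ‖x - x₁‖ = R := by
        rw [← dist_eq_norm]; exact le_antisymm (Metric.mem_closedBall.1 hx) hxi
      refine (hM (s, x) hs).trans ?_
      simp only [barrier, hd]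
      have e1 : Real.exp (k * (s - S)) ≥ Real.exp (-(k * S)) := by
        refine Real.exp_le_exp.2 ?_
        have : 0 ≤ k * s := mul_nonneg (by positivity) hs.1
        linarith
      have e2 : M = Real.exp (-(k * S)) * (M * Real.exp (k * S)) := by
        rw [mul_left_comm, ← Real.exp_add]; simp
      have e3 : M * Real.exp (k * S) ≤ R ^ 2 + ε := by
        have : M * Real.exp (k * S) ≤ R := le_max_left _ _
        nlinarith
      rw [e2]
      calc _ ≤ Real.exp (-(k * S)) * (R ^ 2 + ε) :=
            mul_le_mul_of_nonneg_left e3 (Real.exp_pos _).le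
        _ ≤ _ := mul_le_mul_of_nonneg_right e1 (by positivity)
  have := le_of_forall_pos_le_add fun ε hε => (key ε hε).trans (zero_add ε).ge
  linarith

/-- Since `G p ≤ 0`, the constant `p` is a supersolution. Boundedness of the support confines the
comparison to a ball outside which the pressure is zero. -/
theorem le_of_initial_le (h : SmoothPressure a G T P Q) {S R p : ℝ} (hS : S < T) (hp : 0 ≤ p)
    (hGp : G p ≤ 0) (hR : ∀ t ∈ Icc 0 S, ∀ x, 0 < P (t, x) → ‖x‖ ≤ R)
    (h0 : ∀ x, P (0, x) ≤ p) {t : ℝ} (ht : t ∈ Icc 0 S) (x : EuclideanSpace ℝ (Fin N)) :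
    P (t, x) ≤ p := by
  have key : ∀ ε > 0, P (t, x) ≤ p + ε := by
    intro ε hε
    by_contra! hlt
    -- The growing term makes the supersolution strict and equals `ε` at the time of interest.
    set φ : ℝ → ℝ := fun s => p + ε * Real.exp (s - t) with hφ
    have hφC : ContDiff ℝ 2 φ := by fun_prop
    have hφp : ∀ s, p ≤ φ s := fun s => le_add_of_nonneg_right (by positivity)
    have hns := h.exists_not_supersolution hS
      (isCompact_closedBall (0 : EuclideanSpace ℝ (Fin N)) (max R ‖x‖ + 1))
      (w := fun z => φ z.1) (hφC.comp contDiff_fst) (fun z => hp.trans (hφp _)) 0 0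
      (fun z hz hlt => (h.anti hp (hp.trans ((hφp _).trans hlt.le))
        ((hφp _).trans hlt.le)).trans hGp) (fun x _ => (h0 x).trans (hφp _)) ?_
      ⟨t, ht, x, by simpa using (le_max_right R ‖x‖).trans (by linarith), by simpa [hφ] using hlt⟩
    · obtain ⟨z, hz1, hz2, hz3, hz4⟩ := hns
      rw [spaceLaplacian_of_time hφC, gradSq_of_time hφC,
        dirDeriv_time_eq_of_hasDerivAt (f := fun z => φ z.1) (d := ε * Real.exp (z.1 - t))
          ((hφC.comp contDiff_fst).differentiable (by norm_num) z)] at hz4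
      · have : 0 < ε * Real.exp (z.1 - t) := by positivity
        linarith
      · have h1 : HasDerivAt (fun s : ℝ => s - t) 1 z.1 := (hasDerivAt_id z.1).sub_const t
        simpa [hφ] using (h1.exp.const_mul ε).const_add p
    · intro s hs y hy hyi
      rw [interior_closedBall _ (by positivity), Metric.mem_ball, not_lt, dist_zero_right] at hyi
      have h1 : P (s, y) ≤ 0 := by
        by_contra! h2
        linarith [hR s hs y h2, le_max_left R ‖x‖]
      exact h1.trans (hp.trans (hφp _))
  exact le_of_forall_pos_le_add key

theorem contDiffOn_nhds (h : SmoothPressure a G T P Q) {O : Set (ℝ × EuclideanSpace ℝ (Fin N))}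
    (hO : ∀ z ∈ O, z.1 < T) : ContDiffOn ℝ ∞ Q O :=
  h.smooth.mono fun z hz => ⟨hO z hz, mem_univ _⟩

/-- Near `z` the pressure stays below `P z + 1`, so monotonicity makes `G (P z + 1)` a lower bound
for the reaction coefficient; no continuity of `G` is needed. -/
theorem equation_ge_at (h : SmoothPressure a G T P Q) {z : ℝ × EuclideanSpace ℝ (Fin N)}
    (hz : z.1 ∈ Ioo 0 T) (hP : 0 < P z) :
    a * Q z * spaceLaplacian Q z + gradSq Q z + a * Q z * G (P z + 1)
      ≤ dirDeriv (timeDir N) Q z := by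
  have hO := h.isOpen_pos
  have hO' := (h.cont.mono fun y (hy : y ∈ {z : ℝ × EuclideanSpace ℝ (Fin N) |
    z.1 ∈ Ioo 0 T ∧ 0 < P z}) => ⟨Ioo_subset_Ico_self hy.1, mem_univ _⟩).isOpen_inter_preimage hO
    (isOpen_Iio (a := P z + 1))
  exact h.equation_ge _ hO' (fun y hy => ⟨hy.1.1, mem_univ _⟩) (fun y hy => hy.1.2) _
    (fun y hy => h.anti (mem_Ici.2 hy.1.2.le) (mem_Ici.2 (by linarith)) hy.2.le) z
    ⟨⟨hz, hP⟩, by simp⟩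

theorem hasDerivAt_time (h : SmoothPressure a G T P Q) {z : ℝ × EuclideanSpace ℝ (Fin N)}
    (hz : z.1 ∈ Ioo 0 T) (hP : 0 < P z) :
    HasDerivAt (fun s => P (s, z.2)) (dirDeriv (timeDir N) Q z) z.1 := by
  have hO := h.isOpen_pos.mem_nhds (show z ∈ {z : ℝ × EuclideanSpace ℝ (Fin N) |
    z.1 ∈ Ioo 0 T ∧ 0 < P z} from ⟨hz, hP⟩)
  have hd : DifferentiableAt ℝ Q z := (h.smooth.contDiffAt
    (isOpen_domain.mem_nhds ⟨hz.2, mem_univ _⟩)).differentiableAt (by simp)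
  have h1 : HasDerivAt (fun s : ℝ => (s, z.2)) (timeDir N) z.1 :=
    (hasDerivAt_id z.1).prodMk (hasDerivAt_const z.1 z.2)
  refine (hd.hasFDerivAt.comp_hasDerivAt z.1 h1).congr_of_eventuallyEq ?_
  have hc : Tendsto (fun s : ℝ => (s, z.2)) (𝓝 z.1) (𝓝 z) := h1.continuousAt
  filter_upwards [hc.eventually hO] with s hs
  exact (h.eq _ (Ioo_subset_Ico_self hs.1) hs.2).symm

theorem continuousOn_spaceLaplacian (h : SmoothPressure a G T P Q) :
    ContinuousOn (spaceLaplacian Q) (Iio T ×ˢ univ) :=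
  continuousOn_finsetSum _ fun _ _ =>
    ((h.smooth.dirDeriv_infty isOpen_domain).dirDeriv_infty isOpen_domain).continuousOn

/-- The support does not shrink. -/
theorem pos_of_pos (h : SmoothPressure a G T P Q) {x : EuclideanSpace ℝ (Fin N)} {s t : ℝ}
    (hs : 0 ≤ s) (hst : s ≤ t) (ht : t < T) (hP : 0 < P (s, x)) : 0 < P (t, x) := by
  have ha := h.a_pos
  have hp0 : ∀ r ∈ Icc s t, 0 ≤ P (r, x) := fun r hr =>
    h.nonneg (r, x) ⟨hs.trans hr.1, hr.2.trans_lt ht⟩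
  have hc : ContinuousOn (fun r => P (r, x)) (Icc s t) :=
    h.cont.comp (by fun_prop) fun r hr => ⟨⟨hs.trans hr.1, hr.2.trans_lt ht⟩, mem_univ _⟩
  by_contra! hneg
  have hcl : IsCompact (Icc s t ∩ (fun r => P (r, x)) ⁻¹' Iic 0) :=
    isCompact_Icc.of_isClosed_subset (hc.preimage_isClosed_of_isClosed isClosed_Icc isClosed_Iic)
      inter_subset_left
  -- `r` is the first time at which the pressure vanishes at `x`.
  obtain ⟨r, ⟨hr, hr0⟩, hmin⟩ := hcl.exists_isLeast ⟨t, ⟨⟨hst, le_rfl⟩, hneg⟩⟩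
  have hpos : ∀ q ∈ Ico s r, 0 < P (q, x) := by
    intro q hq
    by_contra! hq0
    exact absurd (hmin ⟨⟨hq.1, hq.2.le.trans hr.2⟩, hq0⟩) (not_le.2 hq.2)
  have hsr : s < r := hr.1.lt_of_ne fun h1 => by
    rw [← h1] at hr0
    exact absurd hP (not_lt.2 hr0)
  obtain ⟨M, hM⟩ := h.bounded t ht
  have hlc : ContinuousOn (fun r => spaceLaplacian Q (r, x)) (Icc s t) :=
    h.continuousOn_spaceLaplacian.comp (by fun_prop) fun r hr => ⟨hr.2.trans_lt ht, mem_univ _⟩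
  obtain ⟨B, hB⟩ := isCompact_Icc.exists_bound_of_continuousOn hlc
  -- With `ΔQ ≥ -B` and the squared gradient discarded, the equation gives `P_t ≥ -C P`; so `P
  -- e^(Cq)` is nondecreasing up to `r` and cannot reach zero.
  set C := a * (B + |G (|M| + 1)|) with hC
  have hmono : MonotoneOn (fun q => P (q, x) * Real.exp (C * q)) (Icc s r) := by
    have hder : ∀ q ∈ Ioo s r, HasDerivAt (fun q => P (q, x) * Real.exp (C * q))
        (dirDeriv (timeDir N) Q (q, x) * Real.exp (C * q)
          + P (q, x) * (Real.exp (C * q) * C)) q := by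
      intro q hq
      have h1 := h.hasDerivAt_time (z := (q, x)) ⟨hs.trans_lt hq.1, hq.2.trans_le hr.2 |>.trans ht⟩
        (hpos q ⟨hq.1.le, hq.2⟩)
      have h2 : HasDerivAt (fun q => C * q) C q := by simpa using (hasDerivAt_id q).const_mul C
      exact h1.mul h2.exp
    refine monotoneOn_of_deriv_nonneg (convex_Icc s r) ?_ ?_ ?_
    · exact (hc.mono (Icc_subset_Icc_right hr.2)).mul (by fun_prop)
    · rw [interior_Icc]
      exact fun q hq => (hder q hq).differentiableAt.differentiableWithinAt
    · rw [interior_Icc]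
      intro q hq
      rw [(hder q hq).deriv]
      have hq1 : q ∈ Icc s t := ⟨hq.1.le, hq.2.le.trans hr.2⟩
      have hqT : (q, x).1 ∈ Ioo 0 T := ⟨hs.trans_lt hq.1, hq1.2.trans_lt ht⟩
      have hqp := hpos q ⟨hq.1.le, hq.2⟩
      have h1 := h.equation_ge_at (z := (q, x)) hqT hqp
      rw [h.eq (q, x) (Ioo_subset_Ico_self hqT) hqp] at h1
      have h2 : 0 ≤ gradSq Q (q, x) := Finset.sum_nonneg fun i _ => sq_nonneg _
      have h3 : -B ≤ spaceLaplacian Q (q, x) := (abs_le.1 (hB q hq1)).1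
      have h4 : -|G (|M| + 1)| ≤ G (P (q, x) + 1) := by
        refine (neg_abs_le _).trans (h.anti (mem_Ici.2 (by linarith)) (mem_Ici.2 (by positivity)) ?_)
        linarith [hM (q, x) ⟨hs.trans hq1.1, hq1.2⟩, le_abs_self M]
      have h5 : 0 ≤ a * P (q, x) := by positivity
      have h6 : 0 ≤ dirDeriv (timeDir N) Q (q, x) + P (q, x) * C := by
        rw [hC]
        nlinarith [mul_le_mul_of_nonneg_left h3 h5, mul_le_mul_of_nonneg_left h4 h5]
      nlinarith [Real.exp_pos (C * q)]
  have h1 := hmono (left_mem_Icc.2 hsr.le) (right_mem_Icc.2 hsr.le) hsr.le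
  have h2 : 0 < P (s, x) * Real.exp (C * s) := by positivity
  have h3 : P (r, x) * Real.exp (C * r) ≤ 0 :=
    mul_nonpos_of_nonpos_of_nonneg hr0 (Real.exp_pos _).le
  simp only at h1
  linarith

/-- No new components of the support appear. -/
theorem isPreconnected_slice (h : SmoothPressure a G T P Q) {t R : ℝ} (ht : t ∈ Ico 0 T)
    (hR : ∀ s ∈ Icc 0 t, ∀ x, 0 < P (s, x) → ‖x‖ ≤ R)
    (h0 : IsPreconnected {x | 0 < P (0, x)}) : IsPreconnected {x | 0 < P (t, x)} := by
  have hsub : {x | 0 < P (0, x)} ⊆ {x | 0 < P (t, x)} := fun x hx =>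
    h.pos_of_pos le_rfl ht.1 ht.2 hx
  -- Each component of the support at time `t` meets the initial support; as the latter is connected
  -- and contained in the former, a single component results.
  have key : ∀ x ∈ {x | 0 < P (t, x)},
      (connectedComponentIn {x | 0 < P (t, x)} x ∩ {x | 0 < P (0, x)}).Nonempty := by
    intro x hx
    by_contra hne
    rw [not_nonempty_iff_eq_empty] at hne
    set U := connectedComponentIn {x | 0 < P (t, x)} x with hU
    have hUo : IsOpen U := (h.isOpen_slice ht).connectedComponentIn
    have hxU : x ∈ U := mem_connectedComponentIn hx
    -- Adjoining a limit point to a connected set keeps it connected, so a positive limit point lies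
    -- in the same component. Hence `P (t, ·)` vanishes on the boundary of `U`.
    have hcl : ∀ y ∈ closure U, 0 < P (t, y) → y ∈ U := by
      intro y hy hpy
      have h1 : IsPreconnected (insert y U) := by
        refine isPreconnected_connectedComponentIn.subset_closure (subset_insert _ _) ?_
        exact insert_subset hy subset_closure
      exact h1.subset_connectedComponentIn (mem_insert_of_mem y hxU)
        (insert_subset hpy (connectedComponentIn_subset _ _)) (mem_insert y U)
    have hK : IsCompact (closure U) := by
      refine (isCompact_closedBall (0 : EuclideanSpace ℝ (Fin N)) R).closure_of_subset fun y hy => ?_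
      have hy' : y ∈ {x | 0 < P (t, x)} := connectedComponentIn_subset _ _ hy
      simpa using hR t ⟨ht.1, le_rfl⟩ y hy'
    -- Comparison with zero on the closure of the component: the initial pressure vanishes there,
    -- and so does the pressure on its boundary at earlier times, since positivity persists. The
    -- rate `a G(0) + 1` exceeds the largest reaction rate.
    have hns := h.exists_not_supersolution ht.2 hK
      (w := fun z => (fun _ => (0 : ℝ)) z.1) contDiff_const (fun _ => le_rfl) (a * G 0 + 1) (G 0)
      (fun z _ hz => h.anti self_mem_Ici (mem_Ici.2 hz.le) hz.le) ?_ ?_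
      ⟨t, ⟨ht.1, le_rfl⟩, x, subset_closure hxU, hx⟩
    · obtain ⟨z, hz1, hz2, hz3, hz4⟩ := hns
      rw [spaceLaplacian_of_time contDiff_const, gradSq_of_time contDiff_const,
        dirDeriv_time_eq_of_hasDerivAt (f := fun z => (fun _ => (0 : ℝ)) z.1) (d := 0)
          (differentiableAt_const _) (hasDerivAt_const _ _)] at hz4
      nlinarith
    · intro y hy
      by_contra! hpy
      have : y ∈ U ∩ {x | 0 < P (0, x)} := ⟨hcl y hy (hsub hpy), hpy⟩
      rw [hne] at this
      exact this
    · intro s hs y hy hyi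
      by_contra! hpy
      exact hyi (interior_maximal subset_closure hUo
        (hcl y hy (h.pos_of_pos hs.1 hs.2 ht.2 hpy)))
  refine isPreconnected_of_forall_pair fun x hx y hy => ?_
  obtain ⟨p, hp, hp0⟩ := key x hx
  obtain ⟨q, hq, hq0⟩ := key y hy
  refine ⟨connectedComponentIn {x | 0 < P (t, x)} x ∪ {x | 0 < P (0, x)}
    ∪ connectedComponentIn {x | 0 < P (t, x)} y, ?_, Or.inl (Or.inl (mem_connectedComponentIn hx)),
    Or.inr (mem_connectedComponentIn hy), ?_⟩
  · exact union_subset (union_subset (connectedComponentIn_subset _ _) hsub)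
      (connectedComponentIn_subset _ _)
  · exact (isPreconnected_connectedComponentIn.union p hp hp0 h0).union q (Or.inr hq0) hq
      isPreconnected_connectedComponentIn

end SmoothPressure

/-! ### From local to global concavity -/

section LocalConcavity

variable {V : Type*} [NormedAddCommGroup V] [NormedSpace ℝ V] {f : V → ℝ} {O : Set V}

theorem concaveOn_line (hO : IsOpen O) (hf : ContDiffOn ℝ 2 f O)
    (hneg : ∀ z ∈ O, ∀ v, dirDeriv v (dirDeriv v f) z ≤ 0) {x y : V}
    (hxy : ∀ s ∈ Icc (0 : ℝ) 1, x + s • (y - x) ∈ O) :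
    ConcaveOn ℝ (Icc 0 1) fun s : ℝ => f (x + s • (y - x)) := by
  have h1 : ∀ z ∈ O, DifferentiableAt ℝ f z := fun z hz =>
    (hf.contDiffAt (hO.mem_nhds hz)).differentiableAt (by norm_num)
  have h2 : ∀ z ∈ O, DifferentiableAt ℝ (dirDeriv (y - x) f) z := fun z hz =>
    ((hf.dirDeriv (m := 1) hO (by norm_num)).contDiffAt (hO.mem_nhds hz)).differentiableAt
      (by norm_num)
  refine concaveOn_of_hasDerivWithinAt2_nonpos (convex_Icc 0 1)
    (f' := fun s => dirDeriv (y - x) f (x + s • (y - x)))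
    (f'' := fun s => dirDeriv (y - x) (dirDeriv (y - x) f) (x + s • (y - x))) ?_ ?_ ?_ ?_
  · exact fun s hs => (hasDerivAt_comp_line (h1 _ (hxy s hs))).continuousAt.continuousWithinAt
  · exact fun s hs => (hasDerivAt_comp_line (h1 _ (hxy s (interior_subset hs)))).hasDerivWithinAt
  · exact fun s hs => (hasDerivAt_comp_line (h2 _ (hxy s (interior_subset hs)))).hasDerivWithinAt
  · exact fun s hs => hneg _ (hxy s (interior_subset hs)) _

/-- A nonnegative continuous function whose support is connected, and which is locally concave
there, is concave on its support, which is convex. -/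
theorem concaveOn_of_locally_concave (hc : Continuous f) (hO : O = {x | 0 < f x})
    (hconn : IsPreconnected O) (hf : ContDiffOn ℝ 2 f O)
    (hneg : ∀ z ∈ O, ∀ v, dirDeriv v (dirDeriv v f) z ≤ 0) : ConcaveOn ℝ O f := by
  have hOo : IsOpen O := hO ▸ isOpen_lt continuous_const hc
  have hmem : ∀ x, x ∈ O ↔ 0 < f x := fun x => by rw [hO]; rfl
  have hseg : ∀ x ∈ O, ∀ y ∈ O, ∀ s ∈ Icc (0 : ℝ) 1, x + s • (y - x) ∈ O := by
    intro x hx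
    -- The points joined to `x` by a segment in `O`. This set is open by compactness of the segment
    -- and, by the next argument, closed in `O`; connectedness then makes it all of `O`.
    set A : Set V := {y | ∀ s ∈ Icc (0 : ℝ) 1, x + s • (y - x) ∈ O} with hA
    have hAo : IsOpen A := by
      refine isOpen_iff_mem_nhds.2 fun y hy => ?_
      have h1 : IsOpen ((fun p : ℝ × V => x + p.1 • (p.2 - x)) ⁻¹' O) :=
        hOo.preimage (by fun_prop)
      obtain ⟨U, W, -, hW, hU, hyW, hUW⟩ := generalized_tube_lemma
        (isCompact_Icc (a := (0 : ℝ)) (b := 1)) (isCompact_singleton (x := y)) h1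
        (fun p hp => by
          obtain ⟨hp1, hp2⟩ := hp
          rw [mem_singleton_iff] at hp2
          rw [mem_preimage, hp2]
          exact hy _ hp1)
      refine mem_of_superset (hW.mem_nhds (hyW rfl)) fun w hw s hs => ?_
      exact hUW (show (s, w) ∈ U ×ˢ W from ⟨hU hs, hw⟩)
    have hAcl : closure A ∩ O ⊆ A := by
      rintro y ⟨hyA, hyO⟩ s hs
      have hlim : ∃ᶠ w in 𝓝 y, w ∈ A := mem_closure_iff_frequently.1 hyA
      -- Concavity along admissible segments bounds `f` below by its smaller endpoint value. This
      -- bound survives the limit, so the limiting segment stays in the positivity set.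
      have h1 : ∃ᶠ w in 𝓝 y, min (f x) (f w) ≤ f (x + s • (w - x)) := by
        refine hlim.mono fun w hw => ?_
        have := (concaveOn_line hOo hf hneg hw).2 (left_mem_Icc.2 zero_le_one)
          (right_mem_Icc.2 zero_le_one) (sub_nonneg.2 hs.2) hs.1 (by ring)
        simp only [smul_eq_mul, mul_zero, zero_smul, add_zero, mul_one, one_smul, zero_add,
          add_sub_cancel] at this
        refine le_trans ?_ this
        nlinarith [min_le_left (f x) (f w), min_le_right (f x) (f w), hs.1, hs.2,
          mul_le_mul_of_nonneg_left (min_le_left (f x) (f w)) (sub_nonneg.2 hs.2),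
          mul_le_mul_of_nonneg_left (min_le_right (f x) (f w)) hs.1]
      have h2 : min (f x) (f y) ≤ f (x + s • (y - x)) := by
        by_contra! h3
        have h4 : ∀ᶠ w in 𝓝 y, f (x + s • (w - x)) < min (f x) (f w) := by
          have c1 : Continuous fun w => f (x + s • (w - x)) := by fun_prop
          have c2 : Continuous fun w => min (f x) (f w) := by fun_prop
          exact (isOpen_lt c1 c2).mem_nhds h3
        obtain ⟨w, hw1, hw2⟩ := (h1.and_eventually h4).exists
        exact absurd hw1 (not_le.2 hw2)
      rw [hmem]
      exact (lt_min ((hmem x).1 hx) ((hmem y).1 hyO)).trans_le h2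
    have := hconn.subset_of_closure_inter_subset hAo
      ⟨x, hx, fun s _ => by simpa using hx⟩ hAcl
    exact fun y hy => this hy
  refine ⟨fun x hx y hy a b ha hb hab => ?_, fun x hx y hy a b ha hb hab => ?_⟩
  · have := hseg x hx y hy b ⟨hb, by linarith⟩
    convert this using 1
    rw [← eq_sub_iff_add_eq] at hab
    rw [hab, smul_sub, sub_smul, one_smul]; abel
  · have := (concaveOn_line hOo hf hneg (hseg x hx y hy)).2 (left_mem_Icc.2 zero_le_one)
      (right_mem_Icc.2 zero_le_one) ha hb hab
    simp only [smul_eq_mul, mul_zero, zero_smul, add_zero, mul_one, one_smul, zero_add,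
      add_sub_cancel] at this
    refine this.trans (le_of_eq ?_)
    congr 1
    rw [← eq_sub_iff_add_eq] at hab
    rw [hab, smul_sub, sub_smul, one_smul]; abel

end LocalConcavity

/-! ### The evolution of the concavity quantity -/

section Evolution

variable {V : Type*} [NormedAddCommGroup V] [NormedSpace ℝ V] {f : V → ℝ} {O : Set V} {z : V}

theorem dirDeriv_dirDeriv_add_smul (hO : IsOpen O) (hf : ContDiffOn ℝ ∞ f O) (hz : z ∈ O)
    (v w : V) (c : ℝ) : dirDeriv (v + c • w) (dirDeriv (v + c • w) f) z
      = dirDeriv v (dirDeriv v f) z + 2 * c * dirDeriv w (dirDeriv v f) z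
        + c ^ 2 * dirDeriv w (dirDeriv w f) z := by
  have e : dirDeriv (v + c • w) f = fun y => dirDeriv v f y + c * dirDeriv w f y := by
    funext y
    rw [dirDeriv_add_vec, dirDeriv_smul_vec]
  have d1 : ∀ u : V, DifferentiableAt ℝ (dirDeriv u f) z := fun u =>
    ((hf.dirDeriv_infty hO).contDiffAt (hO.mem_nhds hz)).differentiableAt (by simp)
  have e2 : ∀ u, dirDeriv u (fun y => dirDeriv v f y + c * dirDeriv w f y) z
      = dirDeriv u (dirDeriv v f) z + c * dirDeriv u (dirDeriv w f) z := by
    intro u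
    have : fderiv ℝ (fun y => dirDeriv v f y + c * dirDeriv w f y) z = _ :=
      ((d1 v).hasFDerivAt.add ((d1 w).hasFDerivAt.const_mul c)).fderiv
    change fderiv ℝ (fun y => dirDeriv v f y + c * dirDeriv w f y) z u = _
    rw [this]
    simp [dirDeriv]
  rw [dirDeriv_add_vec, dirDeriv_smul_vec, e, e2, e2,
    dirDeriv_comm_infty (v := v) (w := w) hO hf hz]
  ring

variable {N : ℕ}

theorem dirDeriv_spaceDir_eq_sum (ξ : EuclideanSpace ℝ (Fin N))
    (f : ℝ × EuclideanSpace ℝ (Fin N) → ℝ) (z : ℝ × EuclideanSpace ℝ (Fin N)) :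
    dirDeriv (spaceDir ξ) f z = ∑ i, ξ i * dirDeriv (coordDir i) f z := by
  have h : spaceDir ξ = ∑ i, ξ i • coordDir i := by
    refine Prod.ext (by simp [spaceDir, coordDir, Prod.fst_sum]) ?_
    ext j
    simp [spaceDir, coordDir, Prod.snd_sum, Finset.sum_apply, Pi.single_apply]
  simp only [dirDeriv, h, map_sum, map_smul, smul_eq_mul]

/-- At a point where the concavity quantity `2 P D²P(ξ, ξ) - (DP ξ) ^ 2` touches
`4 P Θ ‖ξ‖ ^ 2` from below, `Θ` is a subsolution of a linear equation. -/
theorem evolution_at_touching {O : Set (ℝ × EuclideanSpace ℝ (Fin N))}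
    {P g Θ : ℝ × EuclideanSpace ℝ (Fin N) → ℝ} {z : ℝ × EuclideanSpace ℝ (Fin N)}
    {e : EuclideanSpace ℝ (Fin N)} {a κ c g₀ B : ℝ} (ha : 0 < a) (hO : IsOpen O) (hz : z ∈ O)
    (hP : ContDiffOn ℝ ∞ P O) (hPpos : ∀ y ∈ O, 0 < P y) (hg : ContDiffOn ℝ ∞ g O)
    (heq : ∀ y ∈ O, dirDeriv (timeDir N) P y
      = a * P y * spaceLaplacian P y + gradSq P y + a * g y)
    (hgle : ∀ y ∈ O, g y ≤ κ * √(P y) + c * P y) (hgz : g z = κ * √(P z) + c * P z)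
    (hc : c ≤ g₀) (hgz₀ : g z ≤ g₀ * P z) (hΘ : ContDiffOn ℝ 2 Θ O) (hΘz : 0 ≤ Θ z)
    (hle : ∀ y ∈ O, y.1 ≤ z.1 → ∀ ξ, 2 * P y * dirDeriv (spaceDir ξ) (dirDeriv (spaceDir ξ) P) y
      - dirDeriv (spaceDir ξ) P y ^ 2 ≤ 4 * P y * Θ y * ‖ξ‖ ^ 2)
    (he : ‖e‖ = 1)
    (htouch : 2 * P z * dirDeriv (spaceDir e) (dirDeriv (spaceDir e) P) z
      - dirDeriv (spaceDir e) P z ^ 2 = 4 * P z * Θ z)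
    (hB : |spaceLaplacian P z| ≤ B)
    (hB' : dirDeriv (spaceDir e) (dirDeriv (spaceDir e) P) z ≤ B) :
    dirDeriv (timeDir N) Θ z ≤ a * P z * spaceLaplacian Θ z
      + 2 * ∑ i, dirDeriv (coordDir i) P z * dirDeriv (coordDir i) Θ z
      + 2 * a * dirDeriv (spaceDir e) P z * dirDeriv (spaceDir e) Θ z
      + (2 * a * B + a * N * B + 6 * B + a * g₀) * Θ z := by
  have hp := hPpos z hz
  set ε := spaceDir e with hε
  set τ := timeDir N with hτ
  set p := P z with hpdef
  -- `r` is the logarithmic derivative of `√P` along `e`; in terms of it touching reads `D²P(e,e) =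
  -- 2 p r² + 2 Θ`.
  set r := dirDeriv ε P z / (2 * p) with hr
  have hpe : dirDeriv ε P z = 2 * p * r := by rw [hr]; field_simp
  have hk : dirDeriv ε (dirDeriv ε P) z = 2 * p * r ^ 2 + 2 * Θ z := by
    rw [hpe] at htouch
    have h1 : 2 * p * dirDeriv ε (dirDeriv ε P) z = 2 * p * (2 * p * r ^ 2 + 2 * Θ z) := by
      linarith
    exact mul_left_cancel₀ (by positivity) h1
  have smooth1 : ∀ v, ContDiffOn ℝ ∞ (dirDeriv v P) O := fun v => hP.dirDeriv_infty hO
  have smooth2 : ∀ v w, ContDiffOn ℝ ∞ (dirDeriv v (dirDeriv w P)) O := fun v w =>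
    (smooth1 w).dirDeriv_infty hO
  have line : ∀ v, ∀ᶠ s : ℝ in 𝓝 0, z + s • v ∈ O := fun v =>
    (tendsto_line z v).eventually (hO.mem_nhds hz)
  have normsq : ∀ (i : Fin N) (s : ℝ), ‖e + s • EuclideanSpace.single i 1‖ ^ 2
      = 1 + 2 * s * e i + s ^ 2 := by
    intro i s
    rw [@norm_add_sq_real, inner_smul_right, EuclideanSpace.inner_single_right, norm_smul, he]
    simp
    ring
  have dirs : ∀ (i : Fin N) (s : ℝ), spaceDir (e + s • EuclideanSpace.single i 1)
      = ε + s • coordDir i := by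
    intro i s
    simp [hε, spaceDir, coordDir]
  -- the quadratic form in the directions `e + σ eᵢ`
  have form : ∀ (i : Fin N) (σ : ℝ), ∀ y ∈ O, y.1 ≤ z.1 →
      0 ≤ 4 * (P y * (Θ y * (1 + 2 * σ * e i + σ ^ 2)))
        - (2 * (P y * (dirDeriv ε (dirDeriv ε P) y + 2 * (σ * dirDeriv (coordDir i) (dirDeriv ε P) y)
            + σ ^ 2 * dirDeriv (coordDir i) (dirDeriv (coordDir i) P) y))
          - (dirDeriv ε P y + σ * dirDeriv (coordDir i) P y) ^ 2) := by
    intro i σ y hy hyt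
    have := hle y hy hyt (e + σ • EuclideanSpace.single i 1)
    rw [normsq, dirs, dirDeriv_dirDeriv_add_smul hO hP hy, dirDeriv_add_vec,
      dirDeriv_smul_vec] at this
    linarith
  -- stationarity in the direction variable
  have stat : ∀ i, dirDeriv (coordDir i) (dirDeriv ε P) z
      = r * dirDeriv (coordDir i) P z + 2 * Θ z * e i := by
    intro i
    have j : HasJet (fun s : ℝ => -(4 * (p * (Θ z * (1 + 2 * e i * s + s ^ 2)))
        - (2 * (p * (dirDeriv ε (dirDeriv ε P) z
            + 2 * (s * dirDeriv (coordDir i) (dirDeriv ε P) z)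
            + s ^ 2 * dirDeriv (coordDir i) (dirDeriv (coordDir i) P) z))
          - (dirDeriv ε P z + s * dirDeriv (coordDir i) P z) ^ 2))) _ _ _ :=
      (((((HasJet.const 1).add (HasJet.id.const_mul (2 * e i))).add
        HasJet.id.pow_two).const_mul (Θ z)).const_mul p |>.const_mul 4 |>.sub
        ((((HasJet.const _).add ((HasJet.id.mul (HasJet.const _)).const_mul 2)).add
          (HasJet.id.pow_two.mul (HasJet.const _))).const_mul p |>.const_mul 2 |>.sub
          ((HasJet.const _).add (HasJet.id.mul (HasJet.const _))).pow_two)).neg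
    have hmax := (j.of_isLocalMax (Eventually.of_forall fun s => ?_)).1
    · rw [hpe] at hmax
      have h1 : 4 * p * dirDeriv (coordDir i) (dirDeriv ε P) z
        = 4 * p * (r * dirDeriv (coordDir i) P z + 2 * Θ z * e i) := by linarith
      exact mul_left_cancel₀ (by positivity) h1
    · have h1 := form i s z hz le_rfl
      simp only [ne_eq, OfNat.ofNat_ne_zero, not_false_eq_true, zero_pow, mul_zero, zero_mul,
        add_zero, mul_one]
      have h2 : 2 * (p * dirDeriv ε (dirDeriv ε P) z) - dirDeriv ε P z ^ 2 = 4 * (p * Θ z) := by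
        linarith
      rw [h2]
      linarith
  -- first and second order conditions in space
  have space : ∀ i, dirDeriv (coordDir i) (dirDeriv ε (dirDeriv ε P)) z
        = 2 * dirDeriv (coordDir i) Θ z + 4 * r * Θ z * e i ∧
      p * dirDeriv (coordDir i) (dirDeriv (coordDir i) (dirDeriv ε (dirDeriv ε P))) z
          + 2 * p * r * dirDeriv (coordDir i) (dirDeriv (coordDir i) (dirDeriv ε P)) z
        ≤ 2 * p * dirDeriv (coordDir i) (dirDeriv (coordDir i) Θ) z
          + 8 * p * r * (e i * dirDeriv (coordDir i) Θ z) + 4 * p * r ^ 2 * Θ z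
          + 4 * Θ z ^ 2 * e i ^ 2 := by
    intro i
    have jP := hasJet_line_infty (v := coordDir i) hO hP hz
    have jΘ := hasJet_line (v := coordDir i) hO hΘ hz
    have jee := hasJet_line_infty (v := coordDir i) hO (smooth2 ε ε) hz
    have jie := hasJet_line_infty (v := coordDir i) hO (smooth2 (coordDir i) ε) hz
    have jii := hasJet_line_infty (v := coordDir i) hO (smooth2 (coordDir i) (coordDir i)) hz
    have je := hasJet_line_infty (v := coordDir i) hO (smooth1 ε) hz
    have ji := hasJet_line_infty (v := coordDir i) hO (smooth1 (coordDir i)) hz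
    -- The test direction at `z + s eᵢ` is `e + r s eᵢ`. Turning it at the rate `r` makes the
    -- derivatives of orders three and four enter in the same combination as in the twice
    -- differentiated equation, so they can be eliminated.
    have js := HasJet.id.const_mul r
    have j := ((jP.mul (jΘ.mul (((HasJet.const 1).add (js.const_mul 2 |>.mul
      (HasJet.const (e i)))).add js.pow_two))).const_mul 4 |>.sub
        ((jP.mul ((jee.add ((js.mul jie).const_mul 2)).add (js.pow_two.mul jii))).const_mul 2 |>.sub
          (je.add (js.mul ji)).pow_two)).neg
    have hmax := j.of_isLocalMax ?_
    · obtain ⟨h1, h2⟩ := hmax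
      rw [stat, hpe, hk] at h1
      rw [stat, hpe, hk] at h2
      have hki : dirDeriv (coordDir i) (dirDeriv ε (dirDeriv ε P)) z
          = 2 * dirDeriv (coordDir i) Θ z + 4 * r * Θ z * e i := by
        have h3 : 2 * p * dirDeriv (coordDir i) (dirDeriv ε (dirDeriv ε P)) z
          = 2 * p * (2 * dirDeriv (coordDir i) Θ z + 4 * r * Θ z * e i) := by
          linarith
        exact mul_left_cancel₀ (by positivity) h3
      refine ⟨hki, ?_⟩
      rw [hki] at h2
      linarith
    · filter_upwards [line (coordDir i)] with s hs
      have h0 : (z + s • coordDir i).1 = z.1 := by simp [coordDir, spaceDir]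
      have h1 := form i (r * s) _ hs h0.le
      simp only [zero_smul, add_zero, ne_eq, OfNat.ofNat_ne_zero, not_false_eq_true, zero_pow,
        mul_zero, zero_mul, mul_one]
      have h2 : 2 * (p * dirDeriv ε (dirDeriv ε P) z) - dirDeriv ε P z ^ 2 = 4 * (p * Θ z) := by
        linarith
      rw [h2]
      linarith
  -- the reaction term
  have hsq : 0 < √p := Real.sqrt_pos.2 hp
  have hsq2 : √p ^ 2 = p := Real.sq_sqrt hp.le
  have reaction : 2 * r ^ 2 * g z + dirDeriv ε (dirDeriv ε g) z - 2 * r * dirDeriv ε g z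
      ≤ 2 * g₀ * Θ z := by
    have jP := hasJet_line_infty (v := ε) hO hP hz
    have jg := hasJet_line_infty (v := ε) hO hg hz
    -- The function `g - κ√P - cP` has a local maximum at `z`, so `g` may be replaced by its
    -- support. The part `κ√P` contributes `κΘ/√p` and the part `cP` contributes `2cΘ`, in total
    -- `(g/p + c) Θ ≤ 2 g₀ Θ`.
    have jP' : HasJet (fun s : ℝ => √(P (z + s • ε))) _ _ _ := jP.sqrt hp
    have j := jg.sub ((jP'.const_mul κ).add (jP.const_mul c))
    have hmax := j.of_isLocalMax ?_
    · obtain ⟨h1, h2⟩ := hmax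
      rw [hpe] at h1 h2
      rw [hk] at h2
      have e1 : 2 * p * r / (2 * √p) = √p * r := by
        rw [div_eq_iff (by positivity)]
        linear_combination -2 * r * hsq2
      have e2 : (2 * p * (2 * p * r ^ 2 + 2 * Θ z) - (2 * p * r) ^ 2) / (4 * √p ^ 3)
          = Θ z / √p := by
        rw [show √p ^ 3 = p * √p by rw [pow_succ, hsq2], div_eq_div_iff (by positivity) hsq.ne']
        ring
      rw [e1] at h1
      rw [e2] at h2
      have e3 : κ * (Θ z / √p) = Θ z * ((g z - c * p) / p) := by
        have : κ * √p / p = κ / √p := by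
          rw [div_eq_div_iff hp.ne' hsq.ne']
          linear_combination κ * hsq2
        rw [hgz, add_sub_cancel_right, this]
        ring
      have e4 : Θ z * ((g z - c * p) / p) ≤ Θ z * (g₀ - c) := by
        refine mul_le_mul_of_nonneg_left ?_ hΘz
        rw [div_le_iff₀ hp]
        linarith
      rw [e3] at h2
      have h3 : dirDeriv ε g z = κ * (√p * r) + c * (2 * p * r) := by linarith
      rw [h3, hgz]
      nlinarith [mul_le_mul_of_nonneg_right hc hΘz]
    · filter_upwards [line ε] with s hs
      simp only [zero_smul, add_zero]
      rw [hgz, ← hpdef]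
      linarith [hgle _ hs]
  -- the equation differentiated twice
  have cm := fun (v w : ℝ × EuclideanSpace ℝ (Fin N)) => dirDeriv_comm_infty (v := v) (w := w) hO hP
  have cm1 := fun (u v w : ℝ × EuclideanSpace ℝ (Fin N)) =>
    dirDeriv_comm_infty (v := v) (w := w) hO (smooth1 u)
  have ci : ∀ i, EqOn (dirDeriv ε (dirDeriv (coordDir i) (dirDeriv (coordDir i) P)))
      (dirDeriv (coordDir i) (dirDeriv (coordDir i) (dirDeriv ε P))) O := fun i y hy => by
    rw [cm1 _ _ _ hy]
    exact dirDeriv_eqOn hO (cm _ _) hy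
  have di : ∀ i, dirDeriv ε (dirDeriv ε (dirDeriv (coordDir i) (dirDeriv (coordDir i) P))) z
      = dirDeriv (coordDir i) (dirDeriv (coordDir i) (dirDeriv ε (dirDeriv ε P))) z := fun i => by
    rw [dirDeriv_eqOn hO (ci i) hz, dirDeriv_comm_infty hO (smooth2 _ _) hz]
    exact dirDeriv_eqOn hO (cm1 _ _ _) hz
  have ki : ∀ i, dirDeriv ε (dirDeriv ε (dirDeriv (coordDir i) P)) z
      = dirDeriv (coordDir i) (dirDeriv ε (dirDeriv ε P)) z := fun i => by
    rw [dirDeriv_eqOn hO (cm _ _) hz]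
    exact cm1 _ _ _ hz
  have tt : dirDeriv τ (dirDeriv ε (dirDeriv ε P)) z = dirDeriv ε (dirDeriv ε (dirDeriv τ P)) z := by
    rw [cm1 _ _ _ hz]
    exact dirDeriv_eqOn hO (cm _ _) hz
  have jt := hasJet_line_infty (v := ε) hO (smooth1 τ) hz
  have jrhs : HasJet (fun s : ℝ => dirDeriv τ P (z + s • ε)) _ _ _ :=
    ((((hasJet_line_infty (v := ε) hO hP hz).const_mul a).mul
      (HasJet.sum Finset.univ fun i _ =>
        hasJet_line_infty (v := ε) hO (smooth2 (coordDir i) (coordDir i)) hz)).add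
      (HasJet.sum Finset.univ fun i _ =>
        (hasJet_line_infty (v := ε) hO (smooth1 (coordDir i)) hz).pow_two) |>.add
      ((hasJet_line_infty (v := ε) hO hg hz).const_mul a)).congr (by
        filter_upwards [line ε] with s hs
        exact heq _ hs)
  obtain ⟨-, E1, E2⟩ := jt.unique jrhs
  simp only [ci _ hz, di, ki, cm ε _ hz, hpe, hk, stat, fun i => (space i).1] at E1 E2
  have E0 := heq z hz
  -- the time derivative
  have time : 4 * (dirDeriv τ P z * Θ z + p * dirDeriv τ Θ z)
      ≤ 2 * (dirDeriv τ P z * dirDeriv ε (dirDeriv ε P) z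
        + p * dirDeriv τ (dirDeriv ε (dirDeriv ε P)) z)
        - 2 * (dirDeriv ε P z * dirDeriv τ (dirDeriv ε P) z) := by
    have dP := (hasJet_line_infty (v := τ) hO hP hz).hasDerivAt
    have dΘ := (hasJet_line (v := τ) hO hΘ hz).hasDerivAt
    have dee := (hasJet_line_infty (v := τ) hO (smooth2 ε ε) hz).hasDerivAt
    have de := (hasJet_line_infty (v := τ) hO (smooth1 ε) hz).hasDerivAt
    have d := ((dP.mul dee).const_mul 2).sub (de.mul de) |>.sub ((dP.mul dΘ).const_mul 4)
    have h1 := d.nonneg_of_eventually_le_left ?_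
    · simp only [zero_smul, add_zero] at h1
      linarith
    · filter_upwards [(line τ).filter_mono nhdsWithin_le_nhds, self_mem_nhdsWithin] with s hs hs0
      have h0 : (z + s • τ).1 ≤ z.1 := by
        simp [hτ, timeDir, (mem_Iio.1 hs0).le]
      have h2 := hle _ hs h0 e
      rw [he] at h2
      simp only [zero_smul, add_zero, Pi.sub_apply, Pi.mul_apply]
      linarith
  have tt1 : dirDeriv τ (dirDeriv ε P) z = dirDeriv ε (dirDeriv τ P) z := cm _ _ hz
  rw [tt, tt1, hpe, hk] at time
  -- By the touching relation the terms `P_t Θ` cancel, and division by `2p` is possible.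
  have time' : 2 * dirDeriv τ Θ z ≤ 2 * r ^ 2 * dirDeriv τ P z + dirDeriv ε (dirDeriv ε (dirDeriv τ P)) z
      - 2 * r * dirDeriv ε (dirDeriv τ P) z := by
    have h1 : 2 * p * (2 * dirDeriv τ Θ z) ≤ 2 * p * (2 * r ^ 2 * dirDeriv τ P z
      + dirDeriv ε (dirDeriv ε (dirDeriv τ P)) z - 2 * r * dirDeriv ε (dirDeriv τ P) z) := by
      linarith
    exact le_of_mul_le_mul_left h1 (by positivity)
  -- sums over the coordinates
  have hesq : ∑ i, e i ^ 2 = 1 := by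
    rw [← EuclideanSpace.real_norm_sq_eq, he]; norm_num
  have hqe : ∑ i, e i * dirDeriv (coordDir i) P z = 2 * p * r := by
    rw [← dirDeriv_spaceDir_eq_sum, ← hε, hpe]
  have hΘe : ∑ i, e i * dirDeriv (coordDir i) Θ z = dirDeriv ε Θ z := by
    rw [← dirDeriv_spaceDir_eq_sum]
  have hspace := Finset.sum_le_sum fun i (_ : i ∈ Finset.univ) => (space i).2
  simp only [Finset.sum_add_distrib, ← Finset.mul_sum, hesq, hΘe, Finset.sum_const,
    Finset.card_univ, Fintype.card_fin, nsmul_eq_mul] at hspace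
  have s1 : ∑ i, 2 * (dirDeriv (coordDir i) P z * (r * dirDeriv (coordDir i) P z + 2 * Θ z * e i))
      = 2 * r * gradSq P z + 8 * p * r * Θ z := by
    have : ∀ i, 2 * (dirDeriv (coordDir i) P z * (r * dirDeriv (coordDir i) P z + 2 * Θ z * e i))
      = 2 * r * dirDeriv (coordDir i) P z ^ 2 + 4 * Θ z * (e i * dirDeriv (coordDir i) P z) :=
      fun i => by ring
    simp only [this, Finset.sum_add_distrib, ← Finset.mul_sum, hqe, gradSq]
    ring
  have s2 : ∑ i, (2 * (r * dirDeriv (coordDir i) P z + 2 * Θ z * e i) ^ 2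
        + 2 * (dirDeriv (coordDir i) P z * (2 * dirDeriv (coordDir i) Θ z + 4 * r * Θ z * e i)))
      = 2 * r ^ 2 * gradSq P z + 32 * p * r ^ 2 * Θ z + 8 * Θ z ^ 2
        + 4 * ∑ i, dirDeriv (coordDir i) P z * dirDeriv (coordDir i) Θ z := by
    have : ∀ i, 2 * (r * dirDeriv (coordDir i) P z + 2 * Θ z * e i) ^ 2
        + 2 * (dirDeriv (coordDir i) P z * (2 * dirDeriv (coordDir i) Θ z + 4 * r * Θ z * e i))
      = 2 * r ^ 2 * dirDeriv (coordDir i) P z ^ 2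
        + 16 * r * Θ z * (e i * dirDeriv (coordDir i) P z) + 8 * Θ z ^ 2 * e i ^ 2
        + 4 * (dirDeriv (coordDir i) P z * dirDeriv (coordDir i) Θ z) :=
      fun i => by ring
    simp only [this, Finset.sum_add_distrib, ← Finset.mul_sum, hqe, hesq, gradSq]
    ring
  rw [s1] at E1
  rw [s2] at E2
  rw [← tt1, E1, E2, E0] at time'
  change _ ≤ B at hB'
  rw [hk] at hB'
  have hΔ : ∑ i, dirDeriv (coordDir i) (dirDeriv (coordDir i) P) z = spaceLaplacian P z := rfl
  have hΘΔ : ∑ i, dirDeriv (coordDir i) (dirDeriv (coordDir i) Θ) z = spaceLaplacian Θ z := rfl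
  simp only [hΔ] at time'
  simp only [hΘΔ] at hspace
  have b1 : 2 * p * r ^ 2 ≤ B := by linarith
  have b2 : 2 * Θ z ≤ B := by
    have : 0 ≤ 2 * p * r ^ 2 := by positivity
    linarith
  have c1 := mul_le_mul_of_nonneg_left hspace ha.le
  have c2 := mul_le_mul_of_nonneg_left reaction ha.le
  have c3 : a * (spaceLaplacian P z * Θ z) ≤ a * (B * Θ z) :=
    mul_le_mul_of_nonneg_left (mul_le_mul_of_nonneg_right ((le_abs_self _).trans hB) hΘz) ha.le
  have c4 := mul_le_mul_of_nonneg_right b1 hΘz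
  have c5 := mul_le_mul_of_nonneg_right b2 hΘz
  have c6 := mul_le_mul_of_nonneg_left c4 (show 0 ≤ a * N by positivity)
  have c7 := mul_le_mul_of_nonneg_left c5 ha.le
  rw [hpe]
  linarith

end Evolution

/-! ### The weight -/

section Weight

variable {N : ℕ} {O : Set (ℝ × EuclideanSpace ℝ (Fin N))}
  {P f A F : ℝ × EuclideanSpace ℝ (Fin N) → ℝ} {z : ℝ × EuclideanSpace ℝ (Fin N)}
  {e : EuclideanSpace ℝ (Fin N)} {a : ℝ}

/-- The linear operator which appears in the evolution of the concavity quantity. -/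
noncomputable def driftOp (a : ℝ) (P : ℝ × EuclideanSpace ℝ (Fin N) → ℝ)
    (e : EuclideanSpace ℝ (Fin N)) (f : ℝ × EuclideanSpace ℝ (Fin N) → ℝ)
    (z : ℝ × EuclideanSpace ℝ (Fin N)) : ℝ :=
  a * P z * spaceLaplacian f z + 2 * ∑ i, dirDeriv (coordDir i) P z * dirDeriv (coordDir i) f z
    + 2 * a * dirDeriv (spaceDir e) P z * dirDeriv (spaceDir e) f z - dirDeriv (timeDir N) f z

/-- Chain rule: the operator is first order apart from `a P Δ`, which alone produces the term with
the second derivative of `φ`. -/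
theorem driftOp_comp (hO : IsOpen O) (hz : z ∈ O) (hf : ContDiffOn ℝ 2 f O) {φ φ' : ℝ → ℝ}
    {φ₂ : ℝ} (h1 : ∀ᶠ y in 𝓝 (f z), HasDerivAt φ (φ' y) y) (h2 : HasDerivAt φ' φ₂ (f z))
    (hφ : ContDiffOn ℝ 2 (fun y => φ (f y)) O) :
    driftOp a P e (fun y => φ (f y)) z
      = φ' (f z) * driftOp a P e f z + a * P z * (φ₂ * gradSq f z) := by
  have j := fun v => (((hasJet_line (v := v) hO hf hz).comp h1 h2).dirDeriv_eq
    (f := fun y => φ (f y)) hO hφ hz).2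
  simp only [driftOp, spaceLaplacian, gradSq, (j _).1, (j _).2, Finset.sum_add_distrib,
    ← Finset.mul_sum, mul_left_comm _ (φ' (f z))]
  ring

theorem driftOp_linear (hO : IsOpen O) (hz : z ∈ O) (hA : ContDiffOn ℝ 2 A O)
    (hF : ContDiffOn ℝ 2 F O) (c₀ c₁ c₂ : ℝ) :
    driftOp a P e (fun y => c₀ + c₁ * A y + c₂ * F y) z
      = c₁ * driftOp a P e A z + c₂ * driftOp a P e F z := by
  have j := fun v => ((((HasJet.const c₀).add
    ((hasJet_line (v := v) hO hA hz).const_mul c₁)).add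
    ((hasJet_line (v := v) hO hF hz).const_mul c₂)).dirDeriv_eq
    (f := fun y => c₀ + c₁ * A y + c₂ * F y) hO
    ((contDiffOn_const.add (contDiffOn_const.mul hA)).add (contDiffOn_const.mul hF)) hz).2
  simp only [driftOp, spaceLaplacian, (j _).1, (j _).2, mul_add, Finset.sum_add_distrib,
    ← Finset.mul_sum, mul_left_comm _ c₁, mul_left_comm _ c₂, zero_add]
  ring

theorem driftOp_exp_mul (hO : IsOpen O) (hz : z ∈ O) (hf : ContDiffOn ℝ 2 f O) (K : ℝ) :
    driftOp a P e (fun y => Real.exp (K * y.1) * f y) z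
      = Real.exp (K * z.1) * (driftOp a P e f z - K * f z) := by
  have hC : ContDiffOn ℝ 2 (fun y : ℝ × EuclideanSpace ℝ (Fin N) => Real.exp (K * y.1) * f y) O :=
    (by fun_prop : ContDiff ℝ 2 fun y : ℝ × EuclideanSpace ℝ (Fin N) =>
      Real.exp (K * y.1)).contDiffOn.mul hf
  have j := fun v => ((((((HasJet.const z.1).add (HasJet.id.mul (HasJet.const v.1))).const_mul
    K).exp).mul (hasJet_line (v := v) hO hf hz)).congr
    (g := fun s : ℝ => (fun y : ℝ × EuclideanSpace ℝ (Fin N) => Real.exp (K * y.1) * f y)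
      (z + s • v)) (Eventually.of_forall fun s => by simp)).dirDeriv_eq hO hC hz |>.2
  have hs : ∀ ξ : EuclideanSpace ℝ (Fin N), (spaceDir ξ).1 = 0 := fun _ => rfl
  have hc : ∀ i : Fin N, (coordDir i).1 = 0 := fun _ => rfl
  have ht : (timeDir N).1 = 1 := rfl
  simp only [driftOp, spaceLaplacian, (j _).1, (j _).2, hs, hc, ht, mul_zero, zero_mul, add_zero,
    mul_one, zero_add, ne_eq, OfNat.ofNat_ne_zero, not_false_eq_true, zero_pow,
    ← Finset.mul_sum, mul_left_comm _ (Real.exp (K * z.1))]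
  ring

/-- The function `P + |∇P|²`, whose zeros are the degenerate boundary points. -/
noncomputable def degeneracy (P : ℝ × EuclideanSpace ℝ (Fin N) → ℝ)
    (z : ℝ × EuclideanSpace ℝ (Fin N)) : ℝ := P z + gradSq P z

theorem gradSq_nonneg : 0 ≤ gradSq P z := Finset.sum_nonneg fun _ _ => sq_nonneg _

theorem abs_sum_le_card_mul {x : Fin N → ℝ} {b : ℝ} (h : ∀ i, |x i| ≤ b) :
    |∑ i, x i| ≤ N * b := by
  refine (Finset.abs_sum_le_sum_abs _ _).trans ?_
  refine (Finset.sum_le_sum fun i _ => h i).trans (by simp)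

/-- The constant in the differential inequality for the degeneracy. -/
noncomputable def degeneracyConst (a B g₀ : ℝ) (N : ℕ) : ℝ :=
  a * N * (B + 4 * N * B ^ 2) + 2 * N * (1 + 2 * N * B) + 2 * a * N ^ 2 * (1 + 2 * N * B)
    + (a * N * B + 1 + a * g₀ + 2 * (a * N * B + a * N ^ 2 * B ^ 2 + 2 * N ^ 2 * B + a * g₀))

/-- Each term of the operator applied to `θ = P + |∇P|²` carries a factor `P` or is quadratic in
first derivatives, hence is bounded by a multiple of `θ`. Likewise every derivative of `θ` in space
is bounded by a multiple of `|∇P|`, so `P |∇θ|²` is at most a multiple of `P |∇P|² ≤ θ²`. These two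
facts make `1/θ` a supersolution up to a multiple of itself. -/
theorem degeneracy_estimates {g : ℝ × EuclideanSpace ℝ (Fin N) → ℝ} {B g₀ : ℝ} (ha : 0 < a)
    (hO : IsOpen O) (hz : z ∈ O) (hP : ContDiffOn ℝ ∞ P O) (hPz : 0 < P z)
    (hg : ContDiffOn ℝ ∞ g O)
    (heq : ∀ y ∈ O, dirDeriv (timeDir N) P y
      = a * P y * spaceLaplacian P y + gradSq P y + a * g y)
    (hg₀ : 0 ≤ g₀) (hgz : g z ≤ g₀ * P z)
    (hgrad : ∑ j, dirDeriv (coordDir j) P z * dirDeriv (coordDir j) g z ≤ g₀ * gradSq P z)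
    (he : ‖e‖ = 1) (hB0 : 0 ≤ B) (hB1 : ∀ i, |dirDeriv (coordDir i) P z| ≤ B)
    (hB2 : ∀ i j, |dirDeriv (coordDir i) (dirDeriv (coordDir j) P) z| ≤ B)
    (hB3 : ∀ i j k, |dirDeriv (coordDir i) (dirDeriv (coordDir j) (dirDeriv (coordDir k) P)) z|
      ≤ B) :
    -(degeneracyConst a B g₀ N * degeneracy P z) ≤ driftOp a P e (degeneracy P) z ∧
      P z * gradSq (degeneracy P) z ≤ N * (1 + 2 * N * B) ^ 2 * degeneracy P z ^ 2 := by
  set θ := degeneracy P z with hθ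
  set W := 1 + 2 * N * B with hW
  have hgs : 0 ≤ gradSq P z := gradSq_nonneg
  have hθP : P z ≤ θ := le_add_of_nonneg_right hgs
  have hθs : gradSq P z ≤ θ := le_add_of_nonneg_left hPz.le
  have hW0 : 0 ≤ W := by positivity
  set s := √(gradSq P z) with hs
  have hs0 : 0 ≤ s := Real.sqrt_nonneg _
  have hs2 : s ^ 2 = gradSq P z := Real.sq_sqrt hgs
  have hq : ∀ i, |dirDeriv (coordDir i) P z| ≤ s := fun i => by
    rw [hs, ← Real.sqrt_sq_eq_abs]
    exact Real.sqrt_le_sqrt (Finset.single_le_sum (f := fun i => dirDeriv (coordDir i) P z ^ 2)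
      (fun i _ => sq_nonneg _) (Finset.mem_univ i))
  have smooth1 : ∀ v, ContDiffOn ℝ ∞ (dirDeriv v P) O := fun v => hP.dirDeriv_infty hO
  have hθC : ContDiffOn ℝ 2 (degeneracy P) O :=
    (hP.add (ContDiffOn.sum fun i _ => (smooth1 _).pow 2)).of_le two_le_infty
  have j := fun v => ((hasJet_line_infty (v := v) hO hP hz).add
    (HasJet.sum Finset.univ fun i _ => (hasJet_line_infty (v := v) hO
      (smooth1 (coordDir i)) hz).pow_two)).dirDeriv_eq (f := degeneracy P) hO hθC hz |>.2
  have cm := fun (v w : ℝ × EuclideanSpace ℝ (Fin N)) => dirDeriv_comm_infty (v := v) (w := w) hO hP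
  have hθi : ∀ i, |dirDeriv (coordDir i) (degeneracy P) z| ≤ s * W := by
    intro i
    rw [(j _).1]
    have h1 : |∑ k, 2 * (dirDeriv (coordDir k) P z
        * dirDeriv (coordDir i) (dirDeriv (coordDir k) P) z)| ≤ N * (2 * (s * B)) := by
      refine abs_sum_le_card_mul fun k => ?_
      rw [abs_mul, abs_mul, abs_two]
      have := mul_le_mul (hq k) (hB2 i k) (abs_nonneg _) hs0
      linarith
    calc _ ≤ _ := abs_add_le _ _
      _ ≤ s + N * (2 * (s * B)) := add_le_add (hq i) h1
      _ = s * W := by rw [hW]; ring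
  have hθii : ∀ i, |dirDeriv (coordDir i) (dirDeriv (coordDir i) (degeneracy P)) z|
      ≤ B + 4 * N * B ^ 2 := by
    intro i
    rw [(j _).2]
    have h1 : |∑ k, (2 * dirDeriv (coordDir i) (dirDeriv (coordDir k) P) z ^ 2
        + 2 * (dirDeriv (coordDir k) P z
          * dirDeriv (coordDir i) (dirDeriv (coordDir i) (dirDeriv (coordDir k) P)) z))|
        ≤ N * (4 * B ^ 2) := by
      refine abs_sum_le_card_mul fun k => (abs_add_le _ _).trans ?_
      rw [abs_mul, abs_mul, abs_mul, abs_two, abs_pow]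
      have e1 := mul_le_mul (hB1 k) (hB3 i i k) (abs_nonneg _) hB0
      have e2 := pow_le_pow_left₀ (abs_nonneg _) (hB2 i k) 2
      linarith
    calc _ ≤ _ := abs_add_le _ _
      _ ≤ B + N * (4 * B ^ 2) := add_le_add (hB2 i i) h1
      _ = _ := by ring
  have hei : ∀ i, |e i| ≤ 1 := fun i => by
    rw [← he]
    exact PiLp.norm_apply_le e i
  constructor
  · -- the four terms
    have t1 : -(a * N * (B + 4 * N * B ^ 2) * θ) ≤ a * P z * spaceLaplacian (degeneracy P) z := by
      have h1 := (abs_le.1 (abs_sum_le_card_mul hθii)).1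
      have h2 := mul_le_mul_of_nonneg_left h1 (show 0 ≤ a * P z by positivity)
      have h3 : a * P z * (N * (B + 4 * N * B ^ 2)) ≤ a * θ * (N * (B + 4 * N * B ^ 2)) := by
        gcongr
      simp only [spaceLaplacian]
      linarith
    have t2 : -(2 * N * W * θ)
        ≤ 2 * ∑ i, dirDeriv (coordDir i) P z * dirDeriv (coordDir i) (degeneracy P) z := by
      have h1 : |∑ i, dirDeriv (coordDir i) P z * dirDeriv (coordDir i) (degeneracy P) z|
          ≤ N * (s * (s * W)) := by
        refine abs_sum_le_card_mul fun i => ?_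
        rw [abs_mul]
        exact mul_le_mul (hq i) (hθi i) (abs_nonneg _) hs0
      have h2 := (abs_le.1 h1).1
      have h3 : N * (s * (s * W)) = N * W * gradSq P z := by rw [← hs2]; ring
      have h4 : N * W * gradSq P z ≤ N * W * θ := by gcongr
      linarith
    have t3 : -(2 * a * N ^ 2 * W * θ)
        ≤ 2 * a * dirDeriv (spaceDir e) P z * dirDeriv (spaceDir e) (degeneracy P) z := by
      have h1 : |dirDeriv (spaceDir e) P z| ≤ N * s := by
        rw [dirDeriv_spaceDir_eq_sum]
        refine abs_sum_le_card_mul fun i => ?_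
        rw [abs_mul]
        exact (mul_le_mul (hei i) (hq i) (abs_nonneg _) zero_le_one).trans (one_mul s).le
      have h2 : |dirDeriv (spaceDir e) (degeneracy P) z| ≤ N * (s * W) := by
        rw [dirDeriv_spaceDir_eq_sum]
        refine abs_sum_le_card_mul fun i => ?_
        rw [abs_mul]
        exact (mul_le_mul (hei i) (hθi i) (abs_nonneg _) zero_le_one).trans (one_mul _).le
      have h3 : |dirDeriv (spaceDir e) P z * dirDeriv (spaceDir e) (degeneracy P) z|
          ≤ N ^ 2 * W * gradSq P z := by
        rw [abs_mul, ← hs2]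
        refine (mul_le_mul h1 h2 (abs_nonneg _) (by positivity)).trans (le_of_eq (by ring))
      have h4 : N ^ 2 * W * gradSq P z ≤ N ^ 2 * W * θ := by gcongr
      have h5 := (abs_le.1 (h3.trans h4)).1
      have h6 := mul_le_mul_of_nonneg_left h5 (show 0 ≤ 2 * a by positivity)
      linarith
    have hΔ : spaceLaplacian P z ≤ N * B := (abs_le.1 (abs_sum_le_card_mul fun i => hB2 i i)).2
    have t4 : dirDeriv (timeDir N) (degeneracy P) z
        ≤ (a * N * B + 1 + a * g₀
          + 2 * (a * N * B + a * N ^ 2 * B ^ 2 + 2 * N ^ 2 * B + a * g₀)) * θ := by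
      rw [(j _).1, heq z hz]
      have h1 : a * P z * spaceLaplacian P z ≤ a * N * B * θ := by
        calc _ ≤ a * P z * (N * B) := mul_le_mul_of_nonneg_left hΔ (by positivity)
          _ ≤ a * θ * (N * B) := by gcongr
          _ = _ := by ring
      have h2 : a * g z ≤ a * g₀ * θ := by
        calc _ ≤ a * (g₀ * P z) := mul_le_mul_of_nonneg_left hgz ha.le
          _ ≤ a * (g₀ * θ) := by gcongr
          _ = _ := by ring
      have hj : ∀ k, dirDeriv (timeDir N) (dirDeriv (coordDir k) P) z
          = a * dirDeriv (coordDir k) P z * spaceLaplacian P z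
            + a * P z * ∑ i, dirDeriv (coordDir k) (dirDeriv (coordDir i) (dirDeriv (coordDir i) P)) z
            + ∑ i, 2 * (dirDeriv (coordDir i) P z
              * dirDeriv (coordDir k) (dirDeriv (coordDir i) P) z)
            + a * dirDeriv (coordDir k) g z := by
        intro k
        have jt := hasJet_line_infty (v := coordDir k) hO (smooth1 (timeDir N)) hz
        have jrhs : HasJet (fun s : ℝ => dirDeriv (timeDir N) P (z + s • coordDir k)) _ _ _ :=
          ((((hasJet_line_infty (v := coordDir k) hO hP hz).const_mul a).mul
            (HasJet.sum Finset.univ fun i _ =>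
              hasJet_line_infty (v := coordDir k) hO ((smooth1 (coordDir i)).dirDeriv_infty
                (v := coordDir i) hO) hz)).add
            (HasJet.sum Finset.univ fun i _ =>
              (hasJet_line_infty (v := coordDir k) hO (smooth1 (coordDir i)) hz).pow_two) |>.add
            ((hasJet_line_infty (v := coordDir k) hO hg hz).const_mul a)).congr (by
              filter_upwards [(tendsto_line z (coordDir k)).eventually (hO.mem_nhds hz)] with s hs
              exact heq _ hs)
        rw [cm _ _ hz]
        exact (jt.unique jrhs).2.1
      have h3 : ∀ k, dirDeriv (coordDir k) P z * dirDeriv (timeDir N) (dirDeriv (coordDir k) P) z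
          ≤ a * N * B * dirDeriv (coordDir k) P z ^ 2 + a * N * B ^ 2 * P z
            + 2 * N * B * gradSq P z
            + a * (dirDeriv (coordDir k) P z * dirDeriv (coordDir k) g z) := by
        intro k
        rw [hj]
        have e1 : |∑ i, dirDeriv (coordDir k) (dirDeriv (coordDir i) (dirDeriv (coordDir i) P)) z|
            ≤ N * B := abs_sum_le_card_mul fun i => hB3 k i i
        have e2 : dirDeriv (coordDir k) P z
            * ∑ i, dirDeriv (coordDir k) (dirDeriv (coordDir i) (dirDeriv (coordDir i) P)) z
            ≤ B * (N * B) := (le_abs_self _).trans (by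
              rw [abs_mul]; exact mul_le_mul (hB1 k) e1 (abs_nonneg _) hB0)
        have e3 : dirDeriv (coordDir k) P z * ∑ i, 2 * (dirDeriv (coordDir i) P z
              * dirDeriv (coordDir k) (dirDeriv (coordDir i) P) z) ≤ s * (N * (2 * (s * B))) := by
          refine (le_abs_self _).trans ?_
          rw [abs_mul]
          refine mul_le_mul (hq k) (abs_sum_le_card_mul fun i => ?_) (abs_nonneg _) hs0
          rw [abs_mul, abs_mul, abs_two]
          have := mul_le_mul (hq i) (hB2 k i) (abs_nonneg _) hs0
          linarith
        have e4 : s * (N * (2 * (s * B))) = 2 * N * B * gradSq P z := by rw [← hs2]; ring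
        have e5 := mul_le_mul_of_nonneg_left hΔ
          (show 0 ≤ a * dirDeriv (coordDir k) P z ^ 2 by positivity)
        have e6 := mul_le_mul_of_nonneg_left e2 (show 0 ≤ a * P z by positivity)
        linarith
      have h4 := Finset.sum_le_sum fun k (_ : k ∈ Finset.univ) => h3 k
      simp only [Finset.sum_add_distrib, ← Finset.mul_sum, Finset.sum_const, Finset.card_univ,
        Fintype.card_fin, nsmul_eq_mul] at h4
      rw [← Finset.mul_sum]
      have h5 : ∑ k, dirDeriv (coordDir k) P z ^ 2 = gradSq P z := rfl
      rw [h5] at h4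
      have h6 := mul_le_mul_of_nonneg_left hgrad ha.le
      have h7 : a * N * B * gradSq P z ≤ a * N * B * θ := by gcongr
      have h8 : a * N ^ 2 * B ^ 2 * P z ≤ a * N ^ 2 * B ^ 2 * θ := by gcongr
      have h9 : 2 * N ^ 2 * B * gradSq P z ≤ 2 * N ^ 2 * B * θ := by gcongr
      have h10 : a * g₀ * gradSq P z ≤ a * g₀ * θ := by gcongr
      linarith
    simp only [driftOp, degeneracyConst]
    rw [← hW]
    linarith
  · have h1 : gradSq (degeneracy P) z ≤ N * (s * W) ^ 2 := by
      refine (le_abs_self _).trans (abs_sum_le_card_mul fun i => ?_)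
      rw [abs_pow]
      exact pow_le_pow_left₀ (abs_nonneg _) (hθi i) 2
    have hθ0 : 0 ≤ θ := hPz.le.trans hθP
    calc P z * gradSq (degeneracy P) z ≤ P z * (N * (s * W) ^ 2) :=
          mul_le_mul_of_nonneg_left h1 hPz.le
      _ = N * W ^ 2 * (P z * gradSq P z) := by rw [← hs2]; ring
      _ ≤ N * W ^ 2 * (θ * θ) := by gcongr
      _ = _ := by ring

/-- The weight against which the concavity quantity is compared. -/
noncomputable def concavityWeight (P : ℝ × EuclideanSpace ℝ (Fin N) → ℝ) (ε η σ M : ℝ)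
    (y : ℝ × EuclideanSpace ℝ (Fin N)) : ℝ :=
  (M + ε) + -(ε * η) * P y ^ σ + ε * (degeneracy P y)⁻¹

/-- The exponential growth rate allowed in the comparison. -/
noncomputable def concavityRate (a B g₀ : ℝ) (N : ℕ) : ℝ :=
  2 * a * B + a * N * B + 6 * B + a * g₀
    + (a * g₀ + (degeneracyConst a B g₀ N + 2 * a * (N * (1 + 2 * N * B) ^ 2)))

theorem degeneracyConst_nonneg {B g₀ : ℝ} (ha : 0 < a) (hB : 0 ≤ B) (hg₀ : 0 ≤ g₀) :
    0 ≤ degeneracyConst a B g₀ N := by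
  unfold degeneracyConst; positivity

theorem contDiffOn_degeneracy (hO : IsOpen O) (hP : ContDiffOn ℝ ∞ P O) :
    ContDiffOn ℝ ∞ (degeneracy P) O :=
  hP.add (ContDiffOn.sum fun _ _ => (hP.dirDeriv_infty hO).pow 2)

theorem degeneracy_pos {y : ℝ × EuclideanSpace ℝ (Fin N)} (h : 0 < P y) : 0 < degeneracy P y :=
  add_pos_of_pos_of_nonneg h gradSq_nonneg

theorem contDiffOn_concavityWeight (hO : IsOpen O) (hP : ContDiffOn ℝ ∞ P O)
    (hpos : ∀ y ∈ O, 0 < P y) (ε η σ M : ℝ) :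
    ContDiffOn ℝ ∞ (concavityWeight P ε η σ M) O :=
  (contDiffOn_const.add (contDiffOn_const.mul
    (hP.rpow_const_of_ne fun y hy => (hpos y hy).ne'))).add
    (contDiffOn_const.mul ((contDiffOn_degeneracy hO hP).inv fun y hy =>
      (degeneracy_pos (hpos y hy)).ne'))

/-- The operator maps `P^σ` to at least `-a g₀ P^σ`, because the coefficient `a (σ - 1) + 1` of the
squared gradient is nonnegative, and maps `1/θ` to at most a multiple of `1/θ`. The condition `η P^σ
≤ 1/2` lets the constant `ε` absorb the negative term of the weight. -/
theorem driftOp_concavityWeight_le {g : ℝ × EuclideanSpace ℝ (Fin N) → ℝ} {B g₀ ε η σ M : ℝ}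
    (ha : 0 < a) (hO : IsOpen O) (hz : z ∈ O) (hP : ContDiffOn ℝ ∞ P O)
    (hpos : ∀ y ∈ O, 0 < P y) (hg : ContDiffOn ℝ ∞ g O)
    (heq : ∀ y ∈ O, dirDeriv (timeDir N) P y
      = a * P y * spaceLaplacian P y + gradSq P y + a * g y)
    (hg₀ : 0 ≤ g₀) (hgz : g z ≤ g₀ * P z)
    (hgrad : ∑ j, dirDeriv (coordDir j) P z * dirDeriv (coordDir j) g z ≤ g₀ * gradSq P z)
    (he : ‖e‖ = 1) (hB0 : 0 ≤ B) (hB1 : ∀ i, |dirDeriv (coordDir i) P z| ≤ B)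
    (hB2 : ∀ i j, |dirDeriv (coordDir i) (dirDeriv (coordDir j) P) z| ≤ B)
    (hB3 : ∀ i j k, |dirDeriv (coordDir i) (dirDeriv (coordDir j) (dirDeriv (coordDir k) P)) z|
      ≤ B)
    (hε : 0 ≤ ε) (hη : 0 ≤ η) (hσ0 : 0 ≤ σ) (hσ1 : σ ≤ 1) (haσ : 0 ≤ a * (σ - 1) + 1)
    (hηP : η * P z ^ σ ≤ 1 / 2) (hM : 0 ≤ M) :
    driftOp a P e (concavityWeight P ε η σ M) z
      ≤ (a * g₀ + (degeneracyConst a B g₀ N + 2 * a * (N * (1 + 2 * N * B) ^ 2)))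
        * concavityWeight P ε η σ M z := by
  have hp := hpos z hz
  have hθ := degeneracy_pos hp
  obtain ⟨d1, d2⟩ := degeneracy_estimates ha hO hz hP hp hg heq hg₀ hgz hgrad he hB0 hB1 hB2 hB3
  have hP2 := hP.of_le two_le_infty
  have hθ2 := (contDiffOn_degeneracy hO hP).of_le two_le_infty
  have hpow2 : ContDiffOn ℝ 2 (fun y => P y ^ σ) O :=
    hP2.rpow_const_of_ne fun y hy => (hpos y hy).ne'
  have hinv2 : ContDiffOn ℝ 2 (fun y => (degeneracy P y)⁻¹) O :=
    hθ2.inv fun y hy => (degeneracy_pos (hpos y hy)).ne'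
  have e1 : -(a * g₀) * P z ^ σ ≤ driftOp a P e (fun y => P y ^ σ) z := by
    rw [driftOp_comp (φ := fun x => x ^ σ) (φ' := fun x => σ * x ^ (σ - 1))
      (φ₂ := σ * ((σ - 1) * P z ^ (σ - 2))) hO hz hP2 ?_ ?_ hpow2]
    · have h0 : driftOp a P e P z
          = gradSq P z + 2 * a * dirDeriv (spaceDir e) P z ^ 2 - a * g z := by
        have : ∑ i, dirDeriv (coordDir i) P z * dirDeriv (coordDir i) P z = gradSq P z :=
          Finset.sum_congr rfl fun i _ => by ring
        rw [driftOp, heq z hz, this]; ring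
      have h1 : P z ^ (σ - 1) = P z ^ σ / P z := Real.rpow_sub_one hp.ne' σ
      have h2 : P z ^ (σ - 2) = P z ^ σ / P z / P z := by
        rw [← Real.rpow_sub_one hp.ne', ← Real.rpow_sub_one hp.ne']; congr 1; ring
      have h3 : 0 < P z ^ σ := Real.rpow_pos_of_pos hp σ
      simp only [h0, h1, h2]
      have h4 : σ * (P z ^ σ / P z) * (gradSq P z + 2 * a * dirDeriv (spaceDir e) P z ^ 2 - a * g z)
          + a * P z * (σ * ((σ - 1) * (P z ^ σ / P z / P z)) * gradSq P z)
          = σ * (P z ^ σ / P z) * ((a * (σ - 1) + 1) * gradSq P z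
            + 2 * a * dirDeriv (spaceDir e) P z ^ 2) - a * (σ * P z ^ σ * (g z / P z)) := by
        field_simp
        ring
      rw [h4]
      have h5 : 0 ≤ σ * (P z ^ σ / P z) * ((a * (σ - 1) + 1) * gradSq P z
            + 2 * a * dirDeriv (spaceDir e) P z ^ 2) := by
        have := gradSq_nonneg (P := P) (z := z)
        positivity
      have h6 : g z / P z ≤ g₀ := (div_le_iff₀ hp).2 hgz
      have h7 : σ * P z ^ σ * (g z / P z) ≤ P z ^ σ * g₀ := by
        calc _ ≤ σ * P z ^ σ * g₀ := mul_le_mul_of_nonneg_left h6 (by positivity)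
          _ ≤ 1 * P z ^ σ * g₀ := by gcongr
          _ = _ := by ring
      have h8 := mul_le_mul_of_nonneg_left h7 ha.le
      linarith
    · filter_upwards [isOpen_ne.mem_nhds hp.ne'] with y hy
      exact Real.hasDerivAt_rpow_const (Or.inl hy)
    · refine ((Real.hasDerivAt_rpow_const (p := σ - 1) (Or.inl hp.ne')).const_mul σ).congr_deriv ?_
      rw [show σ - 1 - 1 = σ - 2 by ring]
  have e2 : driftOp a P e (fun y => (degeneracy P y)⁻¹) z
      ≤ (degeneracyConst a B g₀ N + 2 * a * (N * (1 + 2 * N * B) ^ 2)) * (degeneracy P z)⁻¹ := by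
    rw [driftOp_comp (φ := fun x => x⁻¹) (φ' := fun x => -(x ^ 2)⁻¹)
      (φ₂ := 2 / degeneracy P z ^ 3) hO hz hθ2 ?_ ?_ hinv2]
    · have h1 : -(degeneracy P z ^ 2)⁻¹ * driftOp a P e (degeneracy P) z
          ≤ degeneracyConst a B g₀ N * (degeneracy P z)⁻¹ := by
        have := mul_le_mul_of_nonneg_left d1 (show 0 ≤ (degeneracy P z ^ 2)⁻¹ by positivity)
        have h2 : (degeneracy P z ^ 2)⁻¹ * -(degeneracyConst a B g₀ N * degeneracy P z)
          = -(degeneracyConst a B g₀ N * (degeneracy P z)⁻¹) := by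
          field_simp
        linarith
      have h2 : a * P z * (2 / degeneracy P z ^ 3 * gradSq (degeneracy P) z)
          ≤ 2 * a * (N * (1 + 2 * N * B) ^ 2) * (degeneracy P z)⁻¹ := by
        have := mul_le_mul_of_nonneg_left d2 (show 0 ≤ 2 * a / degeneracy P z ^ 3 by positivity)
        calc _ = 2 * a / degeneracy P z ^ 3 * (P z * gradSq (degeneracy P) z) := by ring
          _ ≤ _ := this
          _ = _ := by field_simp
      linarith
    · filter_upwards [isOpen_ne.mem_nhds hθ.ne'] with y hy using hasDerivAt_inv hy
    · refine (HasDerivAt.fun_inv (hasDerivAt_pow 2 (degeneracy P z))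
        (pow_ne_zero 2 hθ.ne')).fun_neg.congr_deriv ?_
      field_simp
      norm_num [mul_comm]
  have e3 : driftOp a P e (concavityWeight P ε η σ M) z
      = -(ε * η) * driftOp a P e (fun y => P y ^ σ) z
        + ε * driftOp a P e (fun y => (degeneracy P y)⁻¹) z :=
    driftOp_linear hO hz hpow2 hinv2 (M + ε) (-(ε * η)) ε
  rw [e3]
  set D := degeneracyConst a B g₀ N + 2 * a * (N * (1 + 2 * N * B) ^ 2) with hD
  have hD0 : 0 ≤ D := add_nonneg (degeneracyConst_nonneg ha hB0 hg₀) (by positivity)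
  have f1 := mul_le_mul_of_nonneg_left e1 (mul_nonneg hε hη)
  have f2 := mul_le_mul_of_nonneg_left e2 hε
  have f3 : 0 ≤ ε * (1 / 2 - η * P z ^ σ) := mul_nonneg hε (by linarith)
  have f4 := mul_nonneg (mul_nonneg ha.le hg₀) f3
  have f5 := mul_nonneg hD0 f3
  have f6 : 0 ≤ (a * g₀ + D) * M := by positivity
  have f7 : 0 ≤ a * g₀ * (ε * (degeneracy P z)⁻¹) := by positivity
  have f8 : 0 ≤ D * ε := by positivity
  simp only [concavityWeight]
  linarith

/-- The concavity quantity cannot touch the weight at a point where the pressure is positive. -/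
theorem not_touching {g : ℝ × EuclideanSpace ℝ (Fin N) → ℝ} {B g₀ ε η σ M κ c K : ℝ}
    (ha : 0 < a) (hO : IsOpen O) (hz : z ∈ O) (hP : ContDiffOn ℝ ∞ P O)
    (hpos : ∀ y ∈ O, 0 < P y) (hg : ContDiffOn ℝ ∞ g O)
    (heq : ∀ y ∈ O, dirDeriv (timeDir N) P y
      = a * P y * spaceLaplacian P y + gradSq P y + a * g y)
    (hg₀ : 0 ≤ g₀) (hgz : g z ≤ g₀ * P z)
    (hgrad : ∑ j, dirDeriv (coordDir j) P z * dirDeriv (coordDir j) g z ≤ g₀ * gradSq P z)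
    (hgle : ∀ y ∈ O, g y ≤ κ * √(P y) + c * P y) (hgeq : g z = κ * √(P z) + c * P z)
    (hc : c ≤ g₀) (he : ‖e‖ = 1) (hB0 : 0 ≤ B) (hB1 : ∀ i, |dirDeriv (coordDir i) P z| ≤ B)
    (hB2 : ∀ i j, |dirDeriv (coordDir i) (dirDeriv (coordDir j) P) z| ≤ B)
    (hB3 : ∀ i j k, |dirDeriv (coordDir i) (dirDeriv (coordDir j) (dirDeriv (coordDir k) P)) z|
      ≤ B)
    (hBΔ : |spaceLaplacian P z| ≤ B)
    (hBe : dirDeriv (spaceDir e) (dirDeriv (spaceDir e) P) z ≤ B)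
    (hε : 0 < ε) (hη : 0 ≤ η) (hσ0 : 0 ≤ σ) (hσ1 : σ ≤ 1) (haσ : 0 ≤ a * (σ - 1) + 1)
    (hηP : η * P z ^ σ ≤ 1 / 2) (hM : 0 ≤ M) (hK : concavityRate a B g₀ N < K)
    (hle : ∀ y ∈ O, y.1 ≤ z.1 → ∀ ξ, 2 * P y * dirDeriv (spaceDir ξ) (dirDeriv (spaceDir ξ) P) y
      - dirDeriv (spaceDir ξ) P y ^ 2
        ≤ 4 * P y * (Real.exp (K * y.1) * concavityWeight P ε η σ M y) * ‖ξ‖ ^ 2)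
    (htouch : 2 * P z * dirDeriv (spaceDir e) (dirDeriv (spaceDir e) P) z
      - dirDeriv (spaceDir e) P z ^ 2
        = 4 * P z * (Real.exp (K * z.1) * concavityWeight P ε η σ M z)) : False := by
  have hθ := degeneracy_pos (hpos z hz)
  have hw : 0 < concavityWeight P ε η σ M z := by
    have h1 : 0 < ε * (1 - η * P z ^ σ) := mul_pos hε (by linarith)
    have h2 : 0 < ε * (degeneracy P z)⁻¹ := by positivity
    simp only [concavityWeight]
    linarith
  have hwC := (contDiffOn_concavityWeight hO hP hpos ε η σ M).of_le two_le_infty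
  have hΘC : ContDiffOn ℝ 2 (fun y : ℝ × EuclideanSpace ℝ (Fin N) =>
      Real.exp (K * y.1) * concavityWeight P ε η σ M y) O :=
    (by fun_prop : ContDiff ℝ 2 fun y : ℝ × EuclideanSpace ℝ (Fin N) =>
      Real.exp (K * y.1)).contDiffOn.mul hwC
  have h1 := evolution_at_touching ha hO hz hP hpos hg heq hgle hgeq hc hgz hΘC (by positivity)
    hle he htouch hBΔ hBe
  have h2 := driftOp_exp_mul (P := P) (e := e) (a := a) hO hz hwC K
  have h3 := driftOp_concavityWeight_le ha hO hz hP hpos hg heq hg₀ hgz hgrad he hB0 hB1 hB2 hB3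
    hε.le hη hσ0 hσ1 haσ hηP hM
  have h4 := mul_le_mul_of_nonneg_left h3 (Real.exp_pos (K * z.1)).le
  have h5 : 0 < (K - concavityRate a B g₀ N)
      * (Real.exp (K * z.1) * concavityWeight P ε η σ M z) :=
    mul_pos (by linarith) (by positivity)
  -- The evolution inequality in operator form. The factor `e^(Kt)` subtracts `K` times the weight,
  -- which exceeds all the other zeroth order contributions.
  have h6 : 0 ≤ driftOp a P e (fun y => Real.exp (K * y.1) * concavityWeight P ε η σ M y) z
      + (2 * a * B + a * N * B + 6 * B + a * g₀)
        * (Real.exp (K * z.1) * concavityWeight P ε η σ M z) := by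
    rw [driftOp]; linarith
  rw [h2] at h6
  simp only [concavityRate] at h5
  linarith

end Weight

/-! ### The reaction term -/

/-- Concavity of `v ↦ v G(v²)` yields supporting functions for `p ↦ p G(p)`. -/
theorem exists_reaction_support {G : ℝ → ℝ} {P_H : ℝ} (hG_anti : AntitoneOn G (Ici 0))
    (hG_diff : ContDiffOn ℝ 2 G (Ioc 0 P_H))
    (hG_conc : ∀ p ∈ Ioc 0 P_H,
      3 * derivWithin G (Ioc 0 P_H) p + 2 * p * iteratedDerivWithin 2 G (Ioc 0 P_H) p ≤ 0)
    {p₀ : ℝ} (hp₀ : p₀ ∈ Ioc 0 P_H) :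
    ∃ κ c, c ≤ G 0 ∧ p₀ * G p₀ = κ * √p₀ + c * p₀ ∧
      ∀ p ∈ Ioc 0 P_H, p * G p ≤ κ * √p + c * p := by
  have hPH : 0 < P_H := hp₀.1.trans_le hp₀.2
  set D := Ioc 0 P_H with hD
  set G1 := derivWithin G D with hG1
  set G2 := derivWithin G1 D with hG2
  have hu : UniqueDiffOn ℝ D := uniqueDiffOn_Ioc 0 P_H
  have hd1 : ∀ p ∈ D, HasDerivWithinAt G (G1 p) D p := fun p hp =>
    (hG_diff.differentiableOn (by norm_num) p hp).hasDerivWithinAt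
  have hd2 : ∀ p ∈ D, HasDerivWithinAt G1 (G2 p) D p := fun p hp =>
    ((hG_diff.derivWithin hu (m := 1) (by norm_num)).differentiableOn (by norm_num) p
      hp).hasDerivWithinAt
  have hit : ∀ p, iteratedDerivWithin 2 G D p = G2 p := fun p => by
    rw [iteratedDerivWithin_succ]
    congr 1
    funext q
    exact congrFun (iteratedDerivWithin_one (f := G) (s := D)) q
  have hneg : ∀ p ∈ D, G1 p ≤ 0 := fun p hp =>
    (hG_anti.mono fun q hq => mem_Ici.2 hq.1.le).derivWithin_nonpos
  set V := √P_H with hV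
  have hmap : MapsTo (fun v : ℝ => v ^ 2) (Ioc 0 V) D := fun v hv => by
    refine ⟨pow_pos hv.1 2, ?_⟩
    rw [← Real.sq_sqrt hPH.le]
    exact pow_le_pow_left₀ hv.1.le hv.2 2
  have hsq : ∀ v s, HasDerivWithinAt (fun v : ℝ => v ^ 2) (2 * v) s v := fun v s => by
    simpa using (hasDerivAt_pow 2 v).hasDerivWithinAt (s := s)
  -- Substituting `p = v²`, the second derivative is `2v (3G' + 2pG'')`, so the hypothesis on `G` is
  -- concavity of `φ`.
  set φ : ℝ → ℝ := fun v => v * G (v ^ 2) with hφ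
  set φ1 : ℝ → ℝ := fun v => G (v ^ 2) + 2 * v ^ 2 * G1 (v ^ 2) with hφ1
  have hc : ∀ {g g' : ℝ → ℝ}, (∀ p ∈ D, HasDerivWithinAt g (g' p) D p) → ∀ v ∈ Ioc 0 V,
      HasDerivWithinAt (fun v => g (v ^ 2)) (g' (v ^ 2) * (2 * v)) (Ioc 0 V) v := fun hg v hv =>
    HasDerivWithinAt.comp (h := fun v : ℝ => v ^ 2) v (hg _ (hmap hv)) (hsq v _) hmap
  have hφd : ∀ v ∈ Ioc 0 V, HasDerivWithinAt φ (φ1 v) (Ioc 0 V) v := by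
    intro v hv
    refine ((hasDerivWithinAt_id v _).mul
      (hc hd1 v hv)).congr_deriv ?_
    simp only [hφ1, id]; ring
  have hφd2 : ∀ v ∈ Ioc 0 V, HasDerivWithinAt φ1
      (2 * v * (3 * G1 (v ^ 2) + 2 * v ^ 2 * G2 (v ^ 2))) (Ioc 0 V) v := by
    intro v hv
    refine ((hc hd1 v hv).add
      (((hsq v _).const_mul 2).mul (hc hd2 v hv))).congr_deriv ?_
    ring
  have hconc : ConcaveOn ℝ (Ioc 0 V) φ := by
    refine concaveOn_of_hasDerivWithinAt2_nonpos (convex_Ioc 0 V) (f' := φ1)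
      (f'' := fun v => 2 * v * (3 * G1 (v ^ 2) + 2 * v ^ 2 * G2 (v ^ 2)))
      (fun v hv => (hφd v hv).continuousWithinAt)
      (fun v hv => (hφd v (interior_subset hv)).mono interior_subset)
      (fun v hv => (hφd2 v (interior_subset hv)).mono interior_subset) fun v hv => ?_
    have hv' := interior_subset hv
    have := hG_conc _ (hmap hv')
    rw [hit] at this
    exact mul_nonpos_of_nonneg_of_nonpos (by linarith [hv'.1]) this
  set v₀ := √p₀ with hv₀
  have hv₀2 : v₀ ^ 2 = p₀ := Real.sq_sqrt hp₀.1.le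
  have hv₀m : v₀ ∈ Ioc 0 V := ⟨Real.sqrt_pos.2 hp₀.1, Real.sqrt_le_sqrt hp₀.2⟩
  -- The tangent line is treated separately on the two sides of `v₀`: at the end point `√P_H` only
  -- the derivative from the left exists, and no point lies to the right.
  have htan : ∀ v ∈ Ioc 0 V, φ v ≤ φ v₀ + φ1 v₀ * (v - v₀) := by
    intro v hv
    rcases lt_trichotomy v v₀ with h | h | h
    · have h1 : HasDerivWithinAt φ (φ1 v₀) (Iio v₀) v₀ :=
        (hφd v₀ hv₀m).mono_of_mem_nhdsWithin
          (mem_of_superset (Ioo_mem_nhdsLT hv₀m.1) fun x hx => ⟨hx.1, hx.2.le.trans hv₀m.2⟩)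
      have h2 := hconc.le_slope_of_hasDerivWithinAt_Iio hv hv₀m h h1
      rw [slope_def_field, le_div_iff₀ (by linarith)] at h2
      linarith
    · simp [h]
    · have h1 : HasDerivWithinAt φ (φ1 v₀) (Ioi v₀) v₀ :=
        (hφd v₀ hv₀m).mono_of_mem_nhdsWithin
          (mem_of_superset (Ioo_mem_nhdsGT (h.trans_le hv.2)) fun x hx => ⟨hv₀m.1.trans hx.1, hx.2.le⟩)
      have h2 := hconc.slope_le_of_hasDerivWithinAt_Ioi hv₀m hv h h1
      rw [slope_def_field, div_le_iff₀ (by linarith)] at h2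
      linarith
  -- Multiplying the tangent line by `v = √p` gives the support: `κ` is its intercept and `c = G(p₀)
  -- + 2 p₀ G'(p₀)` its slope, at most `G(0)` since `G' ≤ 0`.
  refine ⟨φ v₀ - φ1 v₀ * v₀, φ1 v₀, ?_, ?_, fun p hp => ?_⟩
  · have h1 : G p₀ ≤ G 0 := hG_anti self_mem_Ici (mem_Ici.2 hp₀.1.le) hp₀.1.le
    have h2 : 2 * p₀ * G1 p₀ ≤ 0 :=
      mul_nonpos_of_nonneg_of_nonpos (by linarith [hp₀.1]) (hneg p₀ hp₀)
    simp only [hφ1, hv₀2]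
    linarith
  · simp only [hφ, hv₀2]
    linear_combination (φ1 v₀ - G p₀) * hv₀2
  · have h1 := htan (√p) ⟨Real.sqrt_pos.2 hp.1, Real.sqrt_le_sqrt hp.2⟩
    have h2 : √p ^ 2 = p := Real.sq_sqrt hp.1.le
    have h3 := mul_le_mul_of_nonneg_left h1 (Real.sqrt_nonneg p)
    have h4 : √p * φ √p = p * G p := by
      simp only [hφ]; rw [h2]; linear_combination G p * h2
    rw [h4] at h3
    linear_combination h3 + φ1 v₀ * h2

namespace SmoothPressure

variable {N : ℕ} {a T : ℝ} {G : ℝ → ℝ} {P Q : ℝ × EuclideanSpace ℝ (Fin N) → ℝ}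

/-- The reaction term, expressed through the derivatives of the pressure. -/
noncomputable def reaction (a : ℝ) (Q : ℝ × EuclideanSpace ℝ (Fin N) → ℝ)
    (z : ℝ × EuclideanSpace ℝ (Fin N)) : ℝ :=
  (dirDeriv (timeDir N) Q z - a * Q z * spaceLaplacian Q z - gradSq Q z) / a

theorem contDiffOn_reaction {O : Set (ℝ × EuclideanSpace ℝ (Fin N))} (hO : IsOpen O)
    (hQ : ContDiffOn ℝ ∞ Q O) : ContDiffOn ℝ ∞ (reaction a Q) O :=
  (((hQ.dirDeriv_infty hO).sub ((contDiffOn_const.mul hQ).mul (ContDiffOn.sum fun _ _ =>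
    (hQ.dirDeriv_infty hO).dirDeriv_infty hO))).sub
    (ContDiffOn.sum fun _ _ => (hQ.dirDeriv_infty hO).pow 2)).div_const a

/-- The upper and lower bounds in the equation close up where `G` is continuous. The gain is that
the reaction, written through derivatives of `Q`, is a smooth function of space-time although `G` is
not a smooth function. -/
theorem reaction_eq (h : SmoothPressure a G T P Q) {p : ℝ}
    (hp : ∀ z, z.1 ∈ Ico 0 T → P z ≤ p) (hG : ContinuousOn G (Icc 0 p))
    {z : ℝ × EuclideanSpace ℝ (Fin N)} (hz : z.1 ∈ Ioo 0 T) (hPz : 0 < P z) :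
    reaction a Q z = Q z * G (Q z) := by
  have ha := h.a_pos
  have hzT := Ioo_subset_Ico_self hz
  have key : ∀ ε > 0, |reaction a Q z - Q z * G (Q z)| ≤ ε := by
    intro ε hε
    have hGP : ContinuousOn (fun y => G (P y)) {z | z.1 ∈ Ioo 0 T ∧ 0 < P z} :=
      hG.comp (h.cont.mono fun y hy => ⟨Ioo_subset_Ico_self hy.1, mem_univ _⟩)
        fun y hy => ⟨hy.2.le, hp y (Ioo_subset_Ico_self hy.1)⟩
    set ε' := ε / P z with hε'
    have hε'0 : 0 < ε' := by positivity
    have hO := hGP.isOpen_inter_preimage h.isOpen_pos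
      (Metric.isOpen_ball (x := G (P z)) (ε := ε'))
    have hzO : z ∈ {z | z.1 ∈ Ioo 0 T ∧ 0 < P z} ∩ (fun y => G (P y)) ⁻¹' Metric.ball (G (P z)) ε' :=
      ⟨⟨hz, hPz⟩, Metric.mem_ball_self hε'0⟩
    have hb : ∀ y ∈ {z | z.1 ∈ Ioo 0 T ∧ 0 < P z} ∩ (fun y => G (P y)) ⁻¹'
        Metric.ball (G (P z)) ε', |G (P y) - G (P z)| < ε' := fun y hy => hy.2
    have h1 := h.equation_le _ hO (fun y hy => ⟨hy.1.1, mem_univ _⟩) (fun y hy => hy.1.2)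
      (G (P z) + ε') (fun y hy => by linarith [(abs_lt.1 (hb y hy)).2]) z hzO
    have h2 := h.equation_ge _ hO (fun y hy => ⟨hy.1.1, mem_univ _⟩) (fun y hy => hy.1.2)
      (G (P z) - ε') (fun y hy => by linarith [(abs_lt.1 (hb y hy)).1]) z hzO
    have h3 : reaction a Q z * a
        = dirDeriv (timeDir N) Q z - a * Q z * spaceLaplacian Q z - gradSq Q z :=
      div_mul_cancel₀ _ ha.ne'
    have h4 : P z * ε' = ε := mul_div_cancel₀ _ hPz.ne'
    rw [h.eq z hzT hPz] at h1 h2 h3 ⊢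
    rw [abs_le]
    constructor
    · refine le_of_mul_le_mul_right ?_ ha
      linear_combination h2 - h3 + a * h4
    · refine le_of_mul_le_mul_right ?_ ha
      linear_combination h1 + h3 + a * h4
  have := le_of_forall_pos_le_add fun ε hε => (key ε hε).trans (zero_add ε).ge
  exact sub_eq_zero.1 (abs_nonpos_iff.1 this)

/-- Formally `∇Q · ∇(Q G(Q)) = (G + Q G') |∇Q|²` with `G' ≤ 0`. Difference quotients along the
gradient use only the monotonicity of `G`. -/
theorem sum_mul_dirDeriv_reaction_le (h : SmoothPressure a G T P Q) {p : ℝ}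
    (hp : ∀ z, z.1 ∈ Ico 0 T → P z ≤ p) (hG : ContinuousOn G (Icc 0 p))
    {z : ℝ × EuclideanSpace ℝ (Fin N)} (hz : z.1 ∈ Ioo 0 T) (hPz : 0 < P z) :
    ∑ j, dirDeriv (coordDir j) Q z * dirDeriv (coordDir j) (reaction a Q) z
      ≤ G (P z) * gradSq Q z := by
  have hO := h.isOpen_pos
  have hzO : z ∈ {z : ℝ × EuclideanSpace ℝ (Fin N) | z.1 ∈ Ioo 0 T ∧ 0 < P z} := ⟨hz, hPz⟩
  have hQC := h.contDiffOn_nhds (O := {z : ℝ × EuclideanSpace ℝ (Fin N) | z.1 ∈ Ioo 0 T ∧ 0 < P z})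
    fun y hy => hy.1.2
  have hgC := contDiffOn_reaction (a := a) hO hQC
  set q : EuclideanSpace ℝ (Fin N) := WithLp.toLp 2 fun j => dirDeriv (coordDir j) Q z with hq
  have e1 : ∑ j, dirDeriv (coordDir j) Q z * dirDeriv (coordDir j) (reaction a Q) z
      = dirDeriv (spaceDir q) (reaction a Q) z := by
    rw [dirDeriv_spaceDir_eq_sum]
  have e2 : gradSq Q z = dirDeriv (spaceDir q) Q z := by
    rw [dirDeriv_spaceDir_eq_sum]
    exact Finset.sum_congr rfl fun i _ => pow_two _
  have hgs : 0 ≤ gradSq Q z := gradSq_nonneg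
  rcases hgs.eq_or_lt with h0 | h0
  · have hz0 : ∀ j, dirDeriv (coordDir j) Q z = 0 := fun j => by
      have := (Finset.sum_eq_zero_iff_of_nonneg (s := Finset.univ)
        (f := fun j => dirDeriv (coordDir j) Q z ^ 2) (fun i _ => sq_nonneg _)).1 h0.symm j
        (Finset.mem_univ j)
      exact pow_eq_zero_iff (two_ne_zero) |>.1 this
    rw [← h0, mul_zero]
    exact (Finset.sum_eq_zero fun j _ => by rw [hz0, zero_mul]).le
  · have d1 := (hasJet_line_infty (v := spaceDir q) hO hQC hzO).hasDerivAt
    have d2 := (hasJet_line_infty (v := spaceDir q) hO hgC hzO).hasDerivAt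
    have d3 := (d1.const_mul (G (P z))).sub d2
    have h1 := d3.nonneg_of_eventually_le_left ?_
    · rw [e1, e2]; linarith
    -- Moving against the gradient lowers `Q` and so does not lower `G(Q)`; hence `G(P z) Q - Q
    -- G(Q)`, which is zero at `z`, is nonpositive there.
    · have hlt : ∀ᶠ s : ℝ in 𝓝[<] 0, Q (z + s • spaceDir q) < Q z := by
        rw [e2] at h0
        have := d1.tendsto_slope.mono_left
          (nhdsWithin_mono 0 fun s (hs : s ∈ Iio (0 : ℝ)) => (ne_of_lt hs : s ≠ 0))
        filter_upwards [this.eventually (lt_mem_nhds h0), self_mem_nhdsWithin] with s hs hs0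
        rw [slope_def_field, zero_smul, add_zero] at hs
        have hs0' : s - 0 < 0 := by simpa using hs0
        have := (div_pos_iff.1 hs).resolve_left fun h => absurd h.2 (not_lt.2 hs0'.le)
        linarith [this.1]
      filter_upwards [hlt, ((tendsto_line z (spaceDir q)).eventually
        (hO.mem_nhds hzO)).filter_mono nhdsWithin_le_nhds] with s hs hsO
      have e3 := h.reaction_eq hp hG hsO.1 hsO.2
      have e4 := h.reaction_eq hp hG hz hPz
      have e5 := h.eq _ (Ioo_subset_Ico_self hsO.1) hsO.2
      have e6 := h.eq _ (Ioo_subset_Ico_self hz) hPz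
      simp only [Pi.sub_apply, zero_smul, add_zero, e3, e4]
      rw [e5] at hs ⊢
      rw [e6] at hs ⊢
      have h2 := h.anti (mem_Ici.2 hsO.2.le) (mem_Ici.2 hPz.le) hs.le
      have h3 := mul_le_mul_of_nonneg_left h2 hsO.2.le
      linarith

end SmoothPressure

/-! ### The concavity quantity near the free boundary -/

section Form

variable {N : ℕ} {D : Set (ℝ × EuclideanSpace ℝ (Fin N))}
  {Q : ℝ × EuclideanSpace ℝ (Fin N) → ℝ} {z : ℝ × EuclideanSpace ℝ (Fin N)}
  {e ν : EuclideanSpace ℝ (Fin N)}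

/-- A multiple of the second derivative of `√Q`. -/
noncomputable def concavityForm (Q : ℝ × EuclideanSpace ℝ (Fin N) → ℝ)
    (z : ℝ × EuclideanSpace ℝ (Fin N)) (ξ : EuclideanSpace ℝ (Fin N)) : ℝ :=
  2 * Q z * dirDeriv (spaceDir ξ) (dirDeriv (spaceDir ξ) Q) z - dirDeriv (spaceDir ξ) Q z ^ 2

theorem dirDeriv_dirDeriv_spaceDir_eq_sum (hD : IsOpen D) (hQ : ContDiffOn ℝ ∞ Q D) (hz : z ∈ D)
    (ξ : EuclideanSpace ℝ (Fin N)) : dirDeriv (spaceDir ξ) (dirDeriv (spaceDir ξ) Q) z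
      = ∑ i, ξ i * ∑ j, ξ j * dirDeriv (coordDir i) (dirDeriv (coordDir j) Q) z := by
  rw [dirDeriv_spaceDir_eq_sum]
  refine Finset.sum_congr rfl fun i _ => ?_
  rw [dirDeriv_comm_infty hD hQ hz, dirDeriv_spaceDir_eq_sum]
  congr 1
  refine Finset.sum_congr rfl fun j _ => ?_
  rw [dirDeriv_comm_infty hD hQ hz]

/-- Quadratic homogeneity reduces everything to unit directions, which form a compact set. -/
theorem concavityForm_smul (hD : IsOpen D) (hQ : ContDiffOn ℝ ∞ Q D) (hz : z ∈ D) (c : ℝ)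
    (ξ : EuclideanSpace ℝ (Fin N)) : concavityForm Q z (c • ξ) = c ^ 2 * concavityForm Q z ξ := by
  simp only [concavityForm, dirDeriv_dirDeriv_spaceDir_eq_sum hD hQ hz,
    dirDeriv_spaceDir_eq_sum _ Q, PiLp.smul_apply, smul_eq_mul, mul_assoc, ← Finset.mul_sum,
    mul_left_comm _ c]
  ring

theorem tendsto_dirDeriv_dirDeriv (hD : IsOpen D) (hQ : ContDiffOn ℝ ∞ Q D) (hz : z ∈ D)
    {ι : Type*} {l : Filter ι} {y : ι → ℝ × EuclideanSpace ℝ (Fin N)}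
    {ξ : ι → EuclideanSpace ℝ (Fin N)} (hy : Tendsto y l (𝓝 z)) (hξ : Tendsto ξ l (𝓝 e)) :
    Tendsto (fun n => dirDeriv (spaceDir (ξ n)) (dirDeriv (spaceDir (ξ n)) Q) (y n)) l
      (𝓝 (dirDeriv (spaceDir e) (dirDeriv (spaceDir e) Q) z)) := by
  have h1 : Tendsto (fun n => ∑ i, (ξ n) i * ∑ j, (ξ n) j
      * dirDeriv (coordDir i) (dirDeriv (coordDir j) Q) (y n)) l
      (𝓝 (∑ i, e i * ∑ j, e j * dirDeriv (coordDir i) (dirDeriv (coordDir j) Q) z)) := by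
    have hc : ∀ i, Tendsto (fun n => (ξ n) i) l (𝓝 (e i)) := fun i =>
      (((continuous_apply i).comp (PiLp.continuous_ofLp 2 _)).tendsto e).comp hξ
    refine tendsto_finsetSum _ fun i _ => (hc i).mul (tendsto_finsetSum _ fun j _ =>
      (hc j).mul ?_)
    exact (((hQ.dirDeriv_infty hD).dirDeriv_infty hD).continuousOn.continuousAt
      (hD.mem_nhds hz)).tendsto.comp hy
  rw [← dirDeriv_dirDeriv_spaceDir_eq_sum hD hQ hz] at h1
  refine h1.congr' ?_
  filter_upwards [hy.eventually (hD.mem_nhds hz)] with n hn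
  exact (dirDeriv_dirDeriv_spaceDir_eq_sum hD hQ hn _).symm

theorem tendsto_dirDeriv (hD : IsOpen D) (hQ : ContDiffOn ℝ ∞ Q D) (hz : z ∈ D)
    {ι : Type*} {l : Filter ι} {y : ι → ℝ × EuclideanSpace ℝ (Fin N)}
    {ξ : ι → EuclideanSpace ℝ (Fin N)} (hy : Tendsto y l (𝓝 z)) (hξ : Tendsto ξ l (𝓝 e)) :
    Tendsto (fun n => dirDeriv (spaceDir (ξ n)) Q (y n)) l (𝓝 (dirDeriv (spaceDir e) Q z)) := by
  have hc : ∀ i, Tendsto (fun n => (ξ n) i) l (𝓝 (e i)) := fun i =>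
    (((continuous_apply i).comp (PiLp.continuous_ofLp 2 _)).tendsto e).comp hξ
  simp only [dirDeriv_spaceDir_eq_sum]
  exact tendsto_finsetSum _ fun i _ => (hc i).mul
    (((hQ.dirDeriv_infty hD).continuousOn.continuousAt (hD.mem_nhds hz)).tendsto.comp hy)

/-- The comparison cannot become an equality in the limit towards a boundary point of the support
at which the gradient does not vanish. -/
theorem not_touching_boundary {c s₀ ε η σ M K : ℝ} (hD : IsOpen D) (hQ : ContDiffOn ℝ ∞ Q D)
    (hz : z ∈ D) (hν : 0 < dirDeriv (spaceDir ν) Q z)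
    (he0 : dirDeriv (spaceDir e) Q z = 0) (he : ‖e‖ = 1) (hθ : 0 < degeneracy Q z)
    (hε : 0 < ε) (hη : 0 < η) (hσ0 : 0 < σ) (hσ1 : σ < 1) (hc : 0 < c) (hs₀ : 0 < s₀)
    (hin : ∀ s ∈ Ioc 0 s₀, c * s ≤ Q (z + s • spaceDir ν))
    (hle : ∀ s ∈ Ioc 0 s₀, ∀ ξ, concavityForm Q (z + s • spaceDir ν) ξ
      ≤ 4 * Q (z + s • spaceDir ν) * (Real.exp (K * z.1)
        * concavityWeight Q ε η σ M (z + s • spaceDir ν)) * ‖ξ‖ ^ 2)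
    (h0 : 2 * (Real.exp (K * z.1) * (M + ε + ε * (degeneracy Q z)⁻¹))
      ≤ dirDeriv (spaceDir e) (dirDeriv (spaceDir e) Q) z) : False := by
  have dline : ∀ f : ℝ × EuclideanSpace ℝ (Fin N) → ℝ, ContDiffOn ℝ ∞ f D →
      DifferentiableAt ℝ (fun s : ℝ => f (z + s • spaceDir ν)) 0 := fun f hf =>
    (hasJet_line_infty hD hf hz).hasDerivAt.differentiableAt
  have hQ1 : ∀ v, ContDiffOn ℝ ∞ (dirDeriv v Q) D := fun v => hQ.dirDeriv_infty hD
  -- The direction `e - r(s) ν` is tangent to the level set of `Q` at `z + s ν`. There the squared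
  -- first derivative drops out of the concavity form, which becomes divisible by `Q`.
  set r : ℝ → ℝ := fun s => dirDeriv (spaceDir e) Q (z + s • spaceDir ν)
    / dirDeriv (spaceDir ν) Q (z + s • spaceDir ν) with hr
  have hr0 : r 0 = 0 := by simp [hr, he0]
  have dr : DifferentiableAt ℝ r 0 := by
    refine (dline _ (hQ1 _)).div (dline _ (hQ1 _)) ?_
    simpa using hν.ne'
  set nrm : ℝ → ℝ := fun s => ‖e + -(r s) • ν‖ ^ 2 with hnrm
  have dn : DifferentiableAt ℝ nrm 0 := by
    have : DifferentiableAt ℝ (fun s => e + -(r s) • ν) 0 :=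
      (dr.neg.smul_const ν).const_add e
    exact this.norm_sq ℝ
  have hn0 : nrm 0 = 1 := by simp [hnrm, hr0, he]
  -- The form divided by `2Q`, minus the part of the weight that is smooth up to the boundary. It is
  -- differentiable with `J 0 ≥ 0`, while the comparison forces `J s` below a negative multiple of
  -- `Q^σ`, hence of `s^σ`; for `σ < 1` these are incompatible.
  set J : ℝ → ℝ := fun s =>
    (dirDeriv (spaceDir e) (dirDeriv (spaceDir e) Q) (z + s • spaceDir ν)
      + 2 * -(r s) * dirDeriv (spaceDir ν) (dirDeriv (spaceDir e) Q) (z + s • spaceDir ν)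
      + (-(r s)) ^ 2 * dirDeriv (spaceDir ν) (dirDeriv (spaceDir ν) Q) (z + s • spaceDir ν))
    - 2 * (Real.exp (K * z.1) * (M + ε + ε * (degeneracy Q (z + s • spaceDir ν))⁻¹)) * nrm s with hJ
  have dJ : DifferentiableAt ℝ J 0 := by
    have d1 := dline _ ((hQ1 (spaceDir e)).dirDeriv_infty (v := spaceDir e) hD)
    have d2 := dline _ ((hQ1 (spaceDir e)).dirDeriv_infty (v := spaceDir ν) hD)
    have d3 := dline _ ((hQ1 (spaceDir ν)).dirDeriv_infty (v := spaceDir ν) hD)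
    have d4 := (dline _ (contDiffOn_degeneracy hD hQ)).inv (by simpa using hθ.ne')
    exact ((d1.add ((dr.neg.const_mul 2).mul d2)).add ((dr.neg.pow 2).mul d3)).sub
      ((((d4.const_mul ε).const_add (M + ε)).const_mul (Real.exp (K * z.1))).const_mul 2 |>.mul dn)
  have hJ0 : 0 ≤ J 0 := by
    simp only [hJ, hr0, hn0, zero_smul, add_zero]
    linarith
  obtain ⟨C, hC⟩ := dJ.isBigO_sub.bound
  have hev : ∀ᶠ s : ℝ in 𝓝[>] 0, Real.exp (K * z.1) * (ε * η) * c ^ σ * s ^ σ ≤ C * s := by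
    have e1 : ∀ᶠ s : ℝ in 𝓝 0, z + s • spaceDir ν ∈ D :=
      (tendsto_line z (spaceDir ν)).eventually (hD.mem_nhds hz)
    have e2 : ∀ᶠ s : ℝ in 𝓝 0, 1 / 2 < nrm s :=
      dn.continuousAt.eventually (lt_mem_nhds (by rw [hn0]; norm_num))
    have e3 : ∀ᶠ s : ℝ in 𝓝 0, 0 < dirDeriv (spaceDir ν) Q (z + s • spaceDir ν) :=
      (dline _ (hQ1 (spaceDir ν))).continuousAt.eventually (lt_mem_nhds (by simpa using hν))
    filter_upwards [nhdsWithin_le_nhds hC, nhdsWithin_le_nhds e1, nhdsWithin_le_nhds e2,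
      nhdsWithin_le_nhds e3, Ioc_mem_nhdsGT hs₀] with s g1 g2 g3 g4 g5
    have hQpos : 0 < Q (z + s • spaceDir ν) := (mul_pos hc g5.1).trans_le (hin s g5)
    have hk := hle s g5 (e + -(r s) • ν)
    have hsp : spaceDir (e + -(r s) • ν) = spaceDir e + -(r s) • spaceDir ν :=
      Prod.ext (by simp [spaceDir]) rfl
    have hz0 : dirDeriv (spaceDir (e + -(r s) • ν)) Q (z + s • spaceDir ν) = 0 := by
      rw [hsp, dirDeriv_add_vec, dirDeriv_smul_vec]
      simp only [hr]
      field_simp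
      ring
    rw [concavityForm, hz0, hsp, dirDeriv_dirDeriv_add_smul hD hQ g2] at hk
    have hk2 : J s ≤ -(2 * Real.exp (K * z.1) * (ε * η) * Q (z + s • spaceDir ν) ^ σ * nrm s) := by
      have h4 : 0 < 2 * Q (z + s • spaceDir ν) := by linarith
      refine le_of_mul_le_mul_left ?_ h4
      simp only [concavityWeight] at hk
      simp only [hJ, hnrm] at hk ⊢
      linear_combination hk
    have hJs : -(C * s) ≤ J s := by
      rw [Real.norm_eq_abs, Real.norm_eq_abs, sub_zero, abs_of_pos g5.1] at g1
      linarith [(abs_le.1 g1).1]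
    have hpow : c ^ σ * s ^ σ ≤ Q (z + s • spaceDir ν) ^ σ := by
      rw [← Real.mul_rpow hc.le g5.1.le]
      exact Real.rpow_le_rpow (mul_pos hc g5.1).le (hin s g5) hσ0.le
    have h5 : Real.exp (K * z.1) * (ε * η) * (c ^ σ * s ^ σ)
        ≤ 2 * Real.exp (K * z.1) * (ε * η) * Q (z + s • spaceDir ν) ^ σ * nrm s := by
      have h6 : 0 ≤ Real.exp (K * z.1) * (ε * η) * Q (z + s • spaceDir ν) ^ σ := by positivity
      calc _ ≤ Real.exp (K * z.1) * (ε * η) * Q (z + s • spaceDir ν) ^ σ :=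
            mul_le_mul_of_nonneg_left hpow (by positivity)
        _ ≤ Real.exp (K * z.1) * (ε * η) * Q (z + s • spaceDir ν) ^ σ * (2 * nrm s) :=
            le_mul_of_one_le_right h6 (by linarith)
        _ = _ := by ring
    linarith
  have hev2 : ∀ᶠ s : ℝ in 𝓝[>] 0, Real.exp (K * z.1) * (ε * η) * c ^ σ ≤ C * s ^ (1 - σ) := by
    filter_upwards [hev, self_mem_nhdsWithin] with s hs hs0
    have hs0' : 0 < s := hs0
    have h1 : s = s ^ (1 - σ) * s ^ σ := by
      rw [← Real.rpow_add hs0']; simp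
    have h2 : 0 < s ^ σ := Real.rpow_pos_of_pos hs0' σ
    refine le_of_mul_le_mul_right ?_ h2
    calc _ ≤ C * s := hs
      _ = _ := by rw [mul_assoc, ← h1]
  have hlim : Tendsto (fun s : ℝ => C * s ^ (1 - σ)) (𝓝[>] 0) (𝓝 0) := by
    have h1 : Continuous fun s : ℝ => C * s ^ (1 - σ) :=
      continuous_const.mul (Real.continuous_rpow_const (by linarith))
    have h2 := h1.tendsto 0
    simp only [Real.zero_rpow (by linarith : 1 - σ ≠ 0), mul_zero] at h2
    exact h2.mono_left nhdsWithin_le_nhds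
  have := ge_of_tendsto hlim hev2
  have h3 : 0 < Real.exp (K * z.1) * (ε * η) * c ^ σ := by positivity
  linarith

end Form

namespace SmoothPressure

variable {N : ℕ} {a T : ℝ} {G : ℝ → ℝ} {P Q : ℝ × EuclideanSpace ℝ (Fin N) → ℝ}

/-- At a regular boundary point of the support, the pressure is positive in directions in which
its smooth extension grows. -/
theorem pos_inward (h : SmoothPressure a G T P Q) {z : ℝ × EuclideanSpace ℝ (Fin N)}
    (hz : z.1 ∈ Ico 0 T) (hQz : Q z = 0) {ν : EuclideanSpace ℝ (Fin N)}
    (hν : 0 < dirDeriv (spaceDir ν) Q z) {y : ℕ → ℝ × EuclideanSpace ℝ (Fin N)}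
    (hy : Tendsto y atTop (𝓝 z)) (hyT : ∀ n, (y n).1 ∈ Ico 0 T) (hyP : ∀ n, 0 < P (y n)) :
    ∃ c > 0, ∃ s₀ > 0, ∀ s ∈ Ioc (0 : ℝ) s₀,
      c * s ≤ Q (z + s • spaceDir ν) ∧ 0 < P (z + s • spaceDir ν) := by
  have hD := isOpen_domain (N := N) (T := T)
  have hzD : z ∈ Iio T ×ˢ (univ : Set (EuclideanSpace ℝ (Fin N))) := ⟨hz.2, mem_univ _⟩
  -- Half the slope at `z` remains a lower bound for the slope in a whole ball around `z`.
  set c := dirDeriv (spaceDir ν) Q z / 2 with hc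
  have hc0 : 0 < c := by positivity
  have hcont : ContinuousAt (dirDeriv (spaceDir ν) Q) z :=
    (h.smooth.dirDeriv_infty hD).continuousOn.continuousAt (hD.mem_nhds hzD)
  obtain ⟨ρ, hρ, hball⟩ := Metric.mem_nhds_iff.1 (inter_mem (hD.mem_nhds hzD)
    (hcont.eventually (lt_mem_nhds (show c < _ by rw [hc]; linarith))))
  set s₀ := ρ / (2 * (‖spaceDir ν‖ + 1)) with hs₀
  have hs₀0 : 0 < s₀ := by positivity
  have hsmall : ∀ s ∈ Icc 0 s₀, ‖s • spaceDir ν‖ < ρ / 2 := by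
    intro s hs
    rw [norm_smul, Real.norm_eq_abs, abs_of_nonneg hs.1]
    calc s * ‖spaceDir ν‖ ≤ s₀ * ‖spaceDir ν‖ :=
          mul_le_mul_of_nonneg_right hs.2 (norm_nonneg _)
      _ < s₀ * (‖spaceDir ν‖ + 1) := by linarith
      _ = ρ / 2 := by rw [hs₀]; field_simp
  have hmem : ∀ n, y n ∈ Metric.ball z (ρ / 2) → ∀ s ∈ Icc 0 s₀,
      y n + s • spaceDir ν ∈ Metric.ball z ρ := by
    intro n hn s hs
    rw [Metric.mem_ball, dist_eq_norm] at hn ⊢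
    calc ‖y n + s • spaceDir ν - z‖ = ‖(y n - z) + s • spaceDir ν‖ := by congr 1; abel
      _ ≤ ‖y n - z‖ + ‖s • spaceDir ν‖ := norm_add_le _ _
      _ < ρ := by linarith [hsmall s hs]
  have hgrow : ∀ n, y n ∈ Metric.ball z (ρ / 2) → ∀ s ∈ Icc 0 s₀,
      Q (y n) + c * s ≤ Q (y n + s • spaceDir ν) := by
    intro n hn s hs
    have hder : ∀ r ∈ Icc 0 s₀, HasDerivAt (fun s : ℝ => Q (y n + s • spaceDir ν))
        (dirDeriv (spaceDir ν) Q (y n + r • spaceDir ν)) r := fun r hr =>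
      hasDerivAt_comp_line (((h.smooth.contDiffAt (hD.mem_nhds
        (hball (hmem n hn r hr)).1))).differentiableAt (by simp))
    have := (convex_Icc 0 s₀).mul_sub_le_image_sub_of_le_deriv
      (f := fun s : ℝ => Q (y n + s • spaceDir ν)) (C := c)
      (fun r hr => (hder r hr).continuousAt.continuousWithinAt)
      (fun r hr => (hder r (interior_subset hr)).differentiableAt.differentiableWithinAt)
      (fun r hr => by
        rw [(hder r (interior_subset hr)).deriv]
        exact (hball (hmem n hn r (interior_subset hr))).2.le)
      0 (left_mem_Icc.2 hs₀0.le) s hs hs.1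
    simp only [zero_smul, add_zero, sub_zero] at this
    linarith
  have hpos : ∀ n, y n ∈ Metric.ball z (ρ / 2) → ∀ s ∈ Icc 0 s₀,
      Q (y n) ≤ P (y n + s • spaceDir ν) ∧ Q (y n + s • spaceDir ν) = P (y n + s • spaceDir ν) := by
    intro n hn
    have htime : ∀ s : ℝ, (y n + s • spaceDir ν).1 ∈ Ico 0 T := fun s => by
      simpa [spaceDir] using hyT n
    have hQy : 0 < Q (y n) := by rw [h.eq _ (hyT n) (hyP n)]; exact hyP n
    have hPc : Continuous fun s : ℝ => P (y n + s • spaceDir ν) :=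
      h.cont.comp_continuous (by fun_prop) fun s => ⟨htime s, mem_univ _⟩
    have hQP : ∀ s ∈ Icc 0 s₀, 0 < P (y n + s • spaceDir ν) →
        Q (y n) ≤ P (y n + s • spaceDir ν) ∧
          Q (y n + s • spaceDir ν) = P (y n + s • spaceDir ν) := by
      intro s hs hp
      have h1 := h.eq _ (htime s) hp
      have h2 := hgrow n hn s hs
      have h3 : 0 ≤ c * s := mul_nonneg hc0.le hs.1
      exact ⟨by linarith, h1⟩
    -- Continuation along the segment: as long as the pressure is positive it equals the increasing
    -- function `Q`, so it stays above the positive number `Q (y n)` and cannot vanish. The bound `c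
    -- s` is independent of `n` and passes to the limit.
    have hall : Icc 0 s₀ ⊆ {s : ℝ | Q (y n) ≤ P (y n + s • spaceDir ν)} := by
      refine IsClosed.Icc_subset_of_forall_mem_nhdsWithin
        ((isClosed_le continuous_const hPc).inter isClosed_Icc) ?_ fun r hr => ?_
      · simpa using (h.eq _ (hyT n) (hyP n)).le
      · have h1 : ∀ᶠ s in 𝓝 r, 0 < P (y n + s • spaceDir ν) :=
          hPc.continuousAt.eventually (lt_mem_nhds (hQy.trans_le hr.1))
        filter_upwards [nhdsWithin_le_nhds h1, Ioc_mem_nhdsGT hr.2.2] with s hs hs'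
        exact (hQP s ⟨hr.2.1.trans hs'.1.le, hs'.2⟩ hs).1
    exact fun s hs => hQP s hs (hQy.trans_le (hall hs))
  refine ⟨c, hc0, s₀, hs₀0, fun s hs => ?_⟩
  have hs' : s ∈ Icc 0 s₀ := ⟨hs.1.le, hs.2⟩
  have hline : Tendsto (fun n => y n + s • spaceDir ν) atTop (𝓝 (z + s • spaceDir ν)) :=
    hy.add_const _
  have htime : ∀ w : ℝ × EuclideanSpace ℝ (Fin N), (w + s • spaceDir ν).1 = w.1 := fun w => by
    simp [spaceDir]
  have hnear : ∀ᶠ n in atTop, y n ∈ Metric.ball z (ρ / 2) :=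
    hy.eventually (Metric.ball_mem_nhds z (by positivity))
  have hlow : Tendsto (fun n => Q (y n) + c * s) atTop (𝓝 (Q z + c * s)) :=
    ((h.smooth.continuousOn.continuousAt (hD.mem_nhds hzD)).tendsto.comp hy).add_const _
  rw [hQz, zero_add] at hlow
  constructor
  · have hQl : Tendsto (fun n => Q (y n + s • spaceDir ν)) atTop (𝓝 (Q (z + s • spaceDir ν))) :=
      (h.smooth.continuousOn.continuousAt (hD.mem_nhds
        ⟨show (z + s • spaceDir ν).1 < T by rw [htime]; exact hz.2, mem_univ _⟩)).tendsto.comp hline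
    exact le_of_tendsto_of_tendsto hlow hQl (hnear.mono fun n hn => hgrow n hn s hs')
  · have hPl : Tendsto (fun n => P (y n + s • spaceDir ν)) atTop (𝓝 (P (z + s • spaceDir ν))) := by
      refine (h.cont _ ⟨by rw [htime]; exact hz, mem_univ _⟩).tendsto.comp
        (tendsto_nhdsWithin_iff.2 ⟨hline, Eventually.of_forall fun n => ⟨?_, mem_univ _⟩⟩)
      rw [htime]; exact hyT n
    have := le_of_tendsto_of_tendsto hlow hPl (hnear.mono fun n hn =>
      (hgrow n hn s hs').trans (hpos n hn s hs').2.le)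
    exact (mul_pos hc0 hs.1).trans_le this

end SmoothPressure

/-! ### Square root concavity is preserved -/

theorem IsCompact.exists_bound_of_finite {X ι : Type*} [TopologicalSpace X] [Finite ι] {s : Set X}
    (hs : IsCompact s) {f : ι → X → ℝ} (hf : ∀ i, ContinuousOn (f i) s) :
    ∃ C, ∀ i, ∀ x ∈ s, |f i x| ≤ C := by
  choose C hC using fun i => hs.exists_bound_of_continuousOn (hf i)
  obtain ⟨M, hM⟩ := Finite.exists_le C
  exact ⟨M, fun i x hx => (hC i x hx).trans (hM i)⟩

theorem concavityWeight_eq_add {N : ℕ} {Q : ℝ × EuclideanSpace ℝ (Fin N) → ℝ} {ε η σ M : ℝ}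
    {y : ℝ × EuclideanSpace ℝ (Fin N)} :
    concavityWeight Q ε η σ M y = M + concavityWeight Q ε η σ 0 y := by
  simp only [concavityWeight]; ring

theorem concavityRate_nonneg {a B g₀ : ℝ} {N : ℕ} (ha : 0 < a) (hB : 0 ≤ B) (hg₀ : 0 ≤ g₀) :
    0 ≤ concavityRate a B g₀ N := by
  have := degeneracyConst_nonneg (N := N) ha hB hg₀
  unfold concavityRate; positivity

namespace SmoothPressure

variable {N : ℕ} {a T : ℝ} {G : ℝ → ℝ} {P Q : ℝ × EuclideanSpace ℝ (Fin N) → ℝ}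

theorem exists_derivative_bound (h : SmoothPressure a G T P Q) {S : ℝ} (hS : S < T) (R : ℝ) :
    ∃ B, 0 ≤ B ∧ ∀ z : ℝ × EuclideanSpace ℝ (Fin N), z.1 ∈ Icc 0 S → ‖z.2‖ ≤ R →
      (∀ i, |dirDeriv (coordDir i) Q z| ≤ B) ∧
      (∀ i j, |dirDeriv (coordDir i) (dirDeriv (coordDir j) Q) z| ≤ B) ∧
      (∀ i j k, |dirDeriv (coordDir i) (dirDeriv (coordDir j) (dirDeriv (coordDir k) Q)) z| ≤ B) ∧
      |spaceLaplacian Q z| ≤ B ∧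
      ∀ e : EuclideanSpace ℝ (Fin N), ‖e‖ = 1 →
        dirDeriv (spaceDir e) (dirDeriv (spaceDir e) Q) z ≤ B := by
  set K := Icc 0 S ×ˢ Metric.closedBall (0 : EuclideanSpace ℝ (Fin N)) R with hK
  have hKc : IsCompact K := isCompact_Icc.prod (isCompact_closedBall _ _)
  have hD := isOpen_domain (N := N) (T := T)
  have hKD : K ⊆ Iio T ×ˢ univ := fun z hz => ⟨hz.1.2.trans_lt hS, mem_univ _⟩
  have s1 : ∀ i, ContDiffOn ℝ ∞ (dirDeriv (coordDir i) Q) (Iio T ×ˢ univ) := fun i =>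
    h.smooth.dirDeriv_infty hD
  have s2 : ∀ i j, ContDiffOn ℝ ∞ (dirDeriv (coordDir i) (dirDeriv (coordDir j) Q))
    (Iio T ×ˢ univ) := fun i j => (s1 j).dirDeriv_infty hD
  have s3 : ∀ i j k, ContDiffOn ℝ ∞
    (dirDeriv (coordDir i) (dirDeriv (coordDir j) (dirDeriv (coordDir k) Q)))
    (Iio T ×ˢ univ) := fun i j k => (s2 j k).dirDeriv_infty hD
  obtain ⟨B1, hB1⟩ := hKc.exists_bound_of_finite fun i => (s1 i).continuousOn.mono hKD
  obtain ⟨B2, hB2⟩ := hKc.exists_bound_of_finite fun p : Fin N × Fin N =>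
    (s2 p.1 p.2).continuousOn.mono hKD
  obtain ⟨B3, hB3⟩ := hKc.exists_bound_of_finite fun p : Fin N × Fin N × Fin N =>
    (s3 p.1 p.2.1 p.2.2).continuousOn.mono hKD
  have p1 : 0 ≤ N * |B2| := by positivity
  have p2 : 0 ≤ N * (N * |B2|) := by positivity
  have a1 := le_abs_self B1
  have a2 := le_abs_self B2
  have a3 := le_abs_self B3
  have q1 := abs_nonneg B1
  have q2 := abs_nonneg B2
  have q3 := abs_nonneg B3
  refine ⟨|B1| + |B2| + |B3| + N * |B2| + N * (N * |B2|), by positivity, fun z hz hzR => ?_⟩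
  have hzK : z ∈ K := ⟨hz, by simpa using hzR⟩
  have b2 : ∀ i j, |dirDeriv (coordDir i) (dirDeriv (coordDir j) Q) z| ≤ |B2| := fun i j =>
    (hB2 (i, j) z hzK).trans a2
  refine ⟨fun i => (hB1 i z hzK).trans (by linarith), fun i j => (b2 i j).trans (by linarith),
    fun i j k => (hB3 (i, j, k) z hzK).trans (by linarith), ?_, fun e he => ?_⟩
  · exact (abs_sum_le_card_mul fun i => b2 i i).trans (by linarith)
  · have hei : ∀ i, |e i| ≤ 1 := fun i => by
      rw [← he]
      exact PiLp.norm_apply_le e i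
    have hm : ∀ {i : Fin N} {x b : ℝ}, |x| ≤ b → |e i * x| ≤ b := fun {i x b} hx => by
      rw [abs_mul]
      exact (mul_le_of_le_one_left (abs_nonneg _) (hei i)).trans hx
    rw [dirDeriv_dirDeriv_spaceDir_eq_sum hD h.smooth (hKD hzK)]
    refine (le_abs_self _).trans ((abs_sum_le_card_mul fun i => hm (abs_sum_le_card_mul
      fun j => hm (b2 i j))).trans (by linarith))

/-- The comparison of the concavity quantity with the weight. -/
theorem concavityForm_le_weight (h : SmoothPressure a G T P Q) {S R p B η σ ε : ℝ} (hS : S < T)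
    (hp : ∀ z, z.1 ∈ Ico 0 T → P z ≤ p) (hG : ContinuousOn G (Icc 0 p))
    (hsupp : ∀ p₀ ∈ Ioc 0 p, ∃ κ c, c ≤ G 0 ∧ p₀ * G p₀ = κ * √p₀ + c * p₀ ∧
      ∀ q ∈ Ioc 0 p, q * G q ≤ κ * √q + c * q)
    (hR : ∀ t ∈ Icc 0 S, ∀ x, 0 < P (t, x) → ‖x‖ ≤ R)
    (h0 : ∀ x, 0 < P (0, x) → ∀ ξ, concavityForm Q (0, x) ξ ≤ 0) (hB0 : 0 ≤ B)
    (hB : ∀ z : ℝ × EuclideanSpace ℝ (Fin N), z.1 ∈ Icc 0 S → ‖z.2‖ ≤ R →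
      (∀ i, |dirDeriv (coordDir i) Q z| ≤ B) ∧
      (∀ i j, |dirDeriv (coordDir i) (dirDeriv (coordDir j) Q) z| ≤ B) ∧
      (∀ i j k, |dirDeriv (coordDir i) (dirDeriv (coordDir j) (dirDeriv (coordDir k) Q)) z| ≤ B) ∧
      |spaceLaplacian Q z| ≤ B ∧
      ∀ e : EuclideanSpace ℝ (Fin N), ‖e‖ = 1 →
        dirDeriv (spaceDir e) (dirDeriv (spaceDir e) Q) z ≤ B)
    (hη : 0 < η) (hηp : η * p ^ σ ≤ 1 / 2) (hσ0 : 0 < σ) (hσ1 : σ < 1) (haσ : 0 ≤ a * (σ - 1) + 1)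
    (hε : 0 < ε) {z : ℝ × EuclideanSpace ℝ (Fin N)} (hz : z.1 ∈ Icc 0 S) (hPz : 0 < P z)
    {e : EuclideanSpace ℝ (Fin N)} (he : ‖e‖ = 1) :
    concavityForm Q z e / (4 * Q z) ≤ Real.exp ((concavityRate a B (max (G 0) 0) N + 1) * z.1)
      * concavityWeight Q ε η σ 0 z := by
  have ha := h.a_pos
  set g₀ := max (G 0) 0 with hg₀
  have hg₀0 : 0 ≤ g₀ := le_max_right _ _
  set K := concavityRate a B g₀ N + 1 with hK
  have hK0 : 0 ≤ K := by
    have := concavityRate_nonneg (N := N) ha hB0 hg₀0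
    linarith
  have hD := isOpen_domain (N := N) (T := T)
  have hIT : Icc 0 S ⊆ Ico 0 T := fun t ht => ⟨ht.1, ht.2.trans_lt hS⟩
  set A : Set ((ℝ × EuclideanSpace ℝ (Fin N)) × EuclideanSpace ℝ (Fin N)) :=
    {q | q.1.1 ∈ Icc 0 S ∧ 0 < P q.1 ∧ ‖q.2‖ = 1} with hA
  set f : (ℝ × EuclideanSpace ℝ (Fin N)) × EuclideanSpace ℝ (Fin N) → ℝ := fun q =>
    Real.exp (-(K * q.1.1)) * (concavityForm Q q.1 q.2 / (4 * Q q.1))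
      - concavityWeight Q ε η σ 0 q.1 with hf
  have hQP : ∀ q ∈ A, Q q.1 = P q.1 := fun q hq => h.eq _ (hIT hq.1) hq.2.1
  have hQpos : ∀ q ∈ A, 0 < Q q.1 := fun q hq => (hQP q hq).symm ▸ hq.2.1
  have hηQ : ∀ y : ℝ × EuclideanSpace ℝ (Fin N), y.1 ∈ Ico 0 T → 0 < P y → η * Q y ^ σ ≤ 1 / 2 := by
    intro y hy hy0
    rw [h.eq y hy hy0]
    refine le_trans ?_ hηp
    exact mul_le_mul_of_nonneg_left (Real.rpow_le_rpow hy0.le (hp y hy) hσ0.le) hη.le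
  have hw0 : ∀ q ∈ A, ε / 2 + ε * (degeneracy Q q.1)⁻¹ ≤ concavityWeight Q ε η σ 0 q.1 := by
    intro q hq
    have := mul_le_mul_of_nonneg_left (hηQ q.1 (hIT hq.1) hq.2.1) hε.le
    simp only [concavityWeight]
    linarith
  have hθA : ∀ q ∈ A, 0 < degeneracy Q q.1 := fun q hq => degeneracy_pos (hQpos q hq)
  -- Dropping the squared first derivative leaves half a second derivative, bounded up to the free
  -- boundary although the quotient has a vanishing denominator.
  have hform : ∀ q ∈ A, concavityForm Q q.1 q.2 / (4 * Q q.1)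
      ≤ dirDeriv (spaceDir q.2) (dirDeriv (spaceDir q.2) Q) q.1 / 2 := by
    intro q hq
    have h1 := hQpos q hq
    rw [div_le_iff₀ (by linarith), concavityForm]
    have := sq_nonneg (dirDeriv (spaceDir q.2) Q q.1)
    linarith
  have hexp : ∀ q ∈ A, Real.exp (-(K * q.1.1)) ≤ 1 := by
    intro q hq
    rw [Real.exp_le_one_iff, neg_nonpos]
    exact mul_nonneg hK0 hq.1.1
  have hfle : ∀ q ∈ A, f q ≤ B / 2 - concavityWeight Q ε η σ 0 q.1 := by
    intro q hq
    have h1 : concavityForm Q q.1 q.2 / (4 * Q q.1) ≤ B / 2 :=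
      (hform q hq).trans (by
        have := (hB q.1 hq.1 (hR _ hq.1 _ hq.2.1)).2.2.2.2 q.2 hq.2.2
        linarith)
    have h2 := mul_le_mul_of_nonneg_left h1 (Real.exp_pos (-(K * q.1.1))).le
    have h3 := mul_le_mul_of_nonneg_right (hexp q hq) (show 0 ≤ B / 2 by linarith)
    simp only [hf]
    linarith
  have hwpos : ∀ q ∈ A, 0 < concavityWeight Q ε η σ 0 q.1 := fun q hq => by
    have h1 := hθA q hq
    have h2 : 0 < ε / 2 + ε * (degeneracy Q q.1)⁻¹ := by positivity
    exact h2.trans_le (hw0 q hq)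
  by_contra! hcon
  have hqA : (z, e) ∈ A := ⟨hz, hPz, he⟩
  have hfpos : 0 < f (z, e) := by
    have h1 := mul_lt_mul_of_pos_left hcon (Real.exp_pos (-(K * z.1)))
    rw [← mul_assoc, ← Real.exp_add, neg_add_cancel, Real.exp_zero, one_mul] at h1
    simp only [hf]
    linarith
  have hbdd : BddAbove (f '' A) := by
    refine ⟨B / 2, ?_⟩
    rintro _ ⟨q, hq, rfl⟩
    linarith [hfle q hq, hwpos q hq]
  -- The set `A` is not closed, because of `P > 0`; so the supremum is followed along a maximizing
  -- sequence, whose limit may lie on the free boundary.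
  set M := sSup (f '' A) with hM
  have hfM : ∀ q ∈ A, f q ≤ M := fun q hq => le_csSup hbdd (mem_image_of_mem f hq)
  have hMpos : 0 < M := hfpos.trans_le (hfM _ hqA)
  obtain ⟨w, -, hwM, hwA⟩ := exists_seq_tendsto_sSup (Set.Nonempty.image f ⟨_, hqA⟩) hbdd
  choose q hqA' hqw using hwA
  have hqc : ∀ n, q n ∈ (Icc 0 S ×ˢ Metric.closedBall (0 : EuclideanSpace ℝ (Fin N)) R)
      ×ˢ Metric.sphere (0 : EuclideanSpace ℝ (Fin N)) 1 := fun n =>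
    ⟨⟨(hqA' n).1, by simpa using hR _ (hqA' n).1 _ (hqA' n).2.1⟩, by simpa using (hqA' n).2.2⟩
  obtain ⟨⟨z₁, e₁⟩, hlimK, φ, hφ, hlim⟩ := ((isCompact_Icc.prod (isCompact_closedBall _ _)).prod
    (isCompact_sphere _ _)).tendsto_subseq hqc
  have hz₁ : z₁.1 ∈ Icc 0 S := hlimK.1.1
  have he₁ : ‖e₁‖ = 1 := by simpa using hlimK.2
  have hz₁T := hIT hz₁
  have hz₁D : z₁ ∈ Iio T ×ˢ (univ : Set (EuclideanSpace ℝ (Fin N))) := ⟨hz₁T.2, mem_univ _⟩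
  set y : ℕ → ℝ × EuclideanSpace ℝ (Fin N) := fun n => (q (φ n)).1 with hy
  set ξ : ℕ → EuclideanSpace ℝ (Fin N) := fun n => (q (φ n)).2 with hξ
  have hyl : Tendsto y atTop (𝓝 z₁) := (continuous_fst.tendsto _).comp hlim
  have hξl : Tendsto ξ atTop (𝓝 e₁) := (continuous_snd.tendsto _).comp hlim
  have hyA : ∀ n, (y n, ξ n) ∈ A := fun n => hqA' (φ n)
  have hfl : Tendsto (fun n => f (y n, ξ n)) atTop (𝓝 M) := by
    have := hwM.comp hφ.tendsto_atTop
    exact this.congr fun n => (hqw (φ n)).symm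
  have hcl : ∀ {f : ℝ × EuclideanSpace ℝ (Fin N) → ℝ}, ContDiffOn ℝ ∞ f (Iio T ×ˢ univ) →
      Tendsto (fun n => f (y n)) atTop (𝓝 (f z₁)) := fun hf =>
    (hf.continuousOn.continuousAt (hD.mem_nhds hz₁D)).tendsto.comp hyl
  have hQl := hcl h.smooth
  have hPl : Tendsto (fun n => P (y n)) atTop (𝓝 (P z₁)) :=
    (h.cont z₁ ⟨hz₁T, mem_univ _⟩).tendsto.comp (tendsto_nhdsWithin_iff.2
      ⟨hyl, Eventually.of_forall fun n => ⟨hIT (hyA n).1, mem_univ _⟩⟩)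
  have hQPz : Q z₁ = P z₁ :=
    tendsto_nhds_unique hQl (hPl.congr fun n => (hQP _ (hyA n)).symm)
  have hθl := hcl (contDiffOn_degeneracy hD h.smooth)
  have hel : Tendsto (fun n => Real.exp (-(K * (y n).1))) atTop (𝓝 (Real.exp (-(K * z₁.1)))) := by
    have : Continuous fun y : ℝ × EuclideanSpace ℝ (Fin N) => Real.exp (-(K * y.1)) := by fun_prop
    exact (this.tendsto _).comp hyl
  have hDl := tendsto_dirDeriv_dirDeriv hD h.smooth hz₁D hyl hξl
  have hdl := tendsto_dirDeriv hD h.smooth hz₁D hyl hξl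
  have hσl : Tendsto (fun n => Q (y n) ^ σ) atTop (𝓝 (Q z₁ ^ σ)) :=
    ((Real.continuous_rpow_const hσ0.le).tendsto _).comp hQl
  have hfev : ∀ᶠ n in atTop, 0 < f (y n, ξ n) := hfl.eventually (lt_mem_nhds hMpos)
  -- A positive value of `f` requires `ε / θ ≤ B / 2`; so the limit cannot be a degenerate boundary
  -- point.
  have hθz : 0 < degeneracy Q z₁ := by
    have h1 : ∀ᶠ n in atTop, ε ≤ (B / 2) * degeneracy Q (y n) := by
      filter_upwards [hfev] with n hn
      have h2 := hfle _ (hyA n)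
      have h3 := hw0 _ (hyA n)
      have h4 := hθA _ (hyA n)
      simp only at h2 h3 h4
      have h5 : ε * (degeneracy Q (y n))⁻¹ ≤ B / 2 := by linarith
      rwa [← div_eq_mul_inv, div_le_iff₀ h4] at h5
    have h2 := ge_of_tendsto (hθl.const_mul (B / 2)) h1
    by_contra! h3
    have := mul_nonpos_of_nonneg_of_nonpos (show 0 ≤ B / 2 by linarith) h3
    linarith
  have hwl : Tendsto (fun n => concavityWeight Q ε η σ 0 (y n)) atTop
      (𝓝 (concavityWeight Q ε η σ 0 z₁)) :=
    ((tendsto_const_nhds (x := 0 + ε)).add (hσl.const_mul (-(ε * η)))).add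
      ((hθl.inv₀ hθz.ne').const_mul ε)
  -- the comparison holds at every point with the constant `M`
  have hle : ∀ y : ℝ × EuclideanSpace ℝ (Fin N), y.1 ∈ Icc 0 S → 0 < P y → ∀ ζ,
      concavityForm Q y ζ ≤ 4 * Q y * (Real.exp (K * y.1) * concavityWeight Q ε η σ M y)
        * ‖ζ‖ ^ 2 := by
    intro y hy0 hyP ζ
    have hyD : y ∈ Iio T ×ˢ (univ : Set (EuclideanSpace ℝ (Fin N))) := ⟨(hIT hy0).2, mem_univ _⟩
    rcases eq_or_ne ζ 0 with rfl | hζ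
    · have := concavityForm_smul hD h.smooth hyD 0 (0 : EuclideanSpace ℝ (Fin N))
      simp only [zero_smul] at this
      rw [this]
      simp
    · have hn : ‖ζ‖ ≠ 0 := norm_ne_zero_iff.2 hζ
      have hu : (y, ‖ζ‖⁻¹ • ζ) ∈ A := ⟨hy0, hyP, norm_smul_inv_norm (𝕜 := ℝ) hζ⟩
      have h1 := hfM _ hu
      have h2 := hQpos _ hu
      simp only [hf] at h1 h2
      rw [concavityForm_smul hD h.smooth hyD] at h1
      rw [concavityWeight_eq_add]
      have h3 : ‖ζ‖⁻¹ ^ 2 * concavityForm Q y ζ / (4 * Q y)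
          ≤ Real.exp (K * y.1) * (M + concavityWeight Q ε η σ 0 y) := by
        have h4 := mul_le_mul_of_nonneg_left
          (show Real.exp (-(K * y.1)) * (‖ζ‖⁻¹ ^ 2 * concavityForm Q y ζ / (4 * Q y))
            ≤ M + concavityWeight Q ε η σ 0 y by linarith) (Real.exp_pos (K * y.1)).le
        rwa [← mul_assoc, ← Real.exp_add, add_neg_cancel, Real.exp_zero, one_mul] at h4
      rw [div_le_iff₀ (by linarith), inv_pow, inv_mul_le_iff₀ (by positivity)] at h3
      linarith
  rcases (h.nonneg z₁ hz₁T).lt_or_eq with hpos | hzero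
  · -- interior points
    have hzA : (z₁, e₁) ∈ A := ⟨hz₁, hpos, he₁⟩
    have hQz := hQpos _ hzA
    have hfz : f (z₁, e₁) = M := by
      refine tendsto_nhds_unique ?_ hfl
      exact (hel.mul ((((hQl.const_mul 2).mul hDl).sub (hdl.pow 2)).div (hQl.const_mul 4)
        (by simp only at hQz; linarith))).sub hwl
    have htouch : concavityForm Q z₁ e₁
        = 4 * Q z₁ * (Real.exp (K * z₁.1) * concavityWeight Q ε η σ M z₁) := by
      have h1 : Real.exp (-(K * z₁.1)) * (concavityForm Q z₁ e₁ / (4 * Q z₁))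
          = M + concavityWeight Q ε η σ 0 z₁ := by
        simp only [hf] at hfz
        linarith
      rw [concavityWeight_eq_add, ← h1, ← mul_assoc (Real.exp _), ← Real.exp_add, add_neg_cancel,
        Real.exp_zero, one_mul]
      simp only at hQz
      field_simp
    -- At the initial time the form is nonpositive, whereas touching would make it positive.
    have hz₁0 : 0 < z₁.1 := by
      rcases hz₁.1.lt_or_eq with h1 | h1
      · exact h1
      · have h2 := h0 z₁.2 (by rwa [show ((0 : ℝ), z₁.2) = z₁ from Prod.ext h1 rfl]) e₁
        rw [show ((0 : ℝ), z₁.2) = z₁ from Prod.ext h1 rfl, htouch, concavityWeight_eq_add] at h2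
        have h3 := hwpos _ hzA
        simp only at hQz h3
        have h4 : 0 < 4 * Q z₁ * (Real.exp (K * z₁.1) * (M + concavityWeight Q ε η σ 0 z₁)) := by
          positivity
        linarith
    have hzt : z₁.1 ∈ Ioo 0 T := ⟨hz₁0, hz₁T.2⟩
    have hO := h.isOpen_pos
    have hQC := h.contDiffOn_nhds (O := {z : ℝ × EuclideanSpace ℝ (Fin N) |
      z.1 ∈ Ioo 0 T ∧ 0 < P z}) fun y hy => hy.1.2
    have hrG : ∀ y ∈ {z : ℝ × EuclideanSpace ℝ (Fin N) | z.1 ∈ Ioo 0 T ∧ 0 < P z},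
        reaction a Q y = Q y * G (Q y) ∧ Q y = P y := fun y hy =>
      ⟨h.reaction_eq hp hG hy.1 hy.2, h.eq y (Ioo_subset_Ico_self hy.1) hy.2⟩
    have hzO : z₁ ∈ {z : ℝ × EuclideanSpace ℝ (Fin N) | z.1 ∈ Ioo 0 T ∧ 0 < P z} := ⟨hzt, hpos⟩
    obtain ⟨κ, c, hc, hκz, hκ⟩ := hsupp (P z₁) ⟨hpos, hp z₁ hz₁T⟩
    have hGg : G (P z₁) ≤ g₀ :=
      (h.anti self_mem_Ici (mem_Ici.2 hpos.le) hpos.le).trans (le_max_left _ _)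
    obtain ⟨b1, b2, b3, b4, b5⟩ := hB z₁ hz₁ (hR _ hz₁ _ hpos)
    refine not_touching (g := reaction a Q) (κ := κ) (c := c) (e := e₁) (M := M) (K := K) ha hO hzO
      hQC (fun y hy => (hrG y hy).2.symm ▸ hy.2) (contDiffOn_reaction hO hQC) (fun y hy => ?_) hg₀0
      ?_ ?_ (fun y hy => ?_) ?_ (hc.trans (le_max_left _ _)) he₁ hB0 b1 b2 b3 b4 (b5 e₁ he₁) hε hη.le
      hσ0.le hσ1.le haσ (hηQ z₁ hz₁T hpos) hMpos.le (by rw [hK]; linarith)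
      (fun y hy hyz ζ => hle y ⟨hy.1.1.le, hyz.trans hz₁.2⟩ hy.2 ζ) htouch
    · rw [reaction, mul_div_cancel₀ _ ha.ne']; ring
    · rw [(hrG z₁ hzO).1, hQPz, mul_comm]
      exact mul_le_mul_of_nonneg_right hGg hpos.le
    · exact (h.sum_mul_dirDeriv_reaction_le hp hG hzt hpos).trans
        (mul_le_mul_of_nonneg_right hGg gradSq_nonneg)
    · rw [(hrG y hy).1, (hrG y hy).2]
      exact hκ _ ⟨hy.2, hp y (Ioo_subset_Ico_self hy.1)⟩
    · rw [(hrG z₁ hzO).1, hQPz, hκz]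
  · -- boundary points
    have hQ0 : Q z₁ = 0 := by rw [hQPz, ← hzero]
    have hgs : 0 < gradSq Q z₁ := by
      rw [degeneracy, hQ0, zero_add] at hθz
      exact hθz
    -- `ν` is the spatial gradient of `Q`, nonzero because `Q z₁ = 0` and the degeneracy is
    -- positive.
    set ν : EuclideanSpace ℝ (Fin N) := WithLp.toLp 2 fun j => dirDeriv (coordDir j) Q z₁ with hν
    have hνd : 0 < dirDeriv (spaceDir ν) Q z₁ := by
      rw [dirDeriv_spaceDir_eq_sum]
      refine hgs.trans_le (Finset.sum_congr rfl fun i _ => pow_two _).le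
    -- Along the sequence the form is nonnegative, and in the limit only minus the square of this
    -- derivative remains.
    have he0 : dirDeriv (spaceDir e₁) Q z₁ = 0 := by
      have h1 : Tendsto (fun n => concavityForm Q (y n) (ξ n)) atTop
          (𝓝 (2 * Q z₁ * dirDeriv (spaceDir e₁) (dirDeriv (spaceDir e₁) Q) z₁
            - dirDeriv (spaceDir e₁) Q z₁ ^ 2)) := ((hQl.const_mul 2).mul hDl).sub (hdl.pow 2)
      have h2 : ∀ᶠ n in atTop, 0 ≤ concavityForm Q (y n) (ξ n) := by
        filter_upwards [hfev] with n hn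
        have h3 := hwpos _ (hyA n)
        have h4 := hQpos _ (hyA n)
        simp only [hf] at hn h3 h4
        by_contra! h5
        have h6 : concavityForm Q (y n) (ξ n) / (4 * Q (y n)) ≤ 0 :=
          div_nonpos_of_nonpos_of_nonneg h5.le (by linarith)
        have h7 := mul_nonpos_of_nonneg_of_nonpos (Real.exp_pos (-(K * (y n).1))).le h6
        linarith
      have h3 := ge_of_tendsto h1 h2
      rw [hQ0] at h3
      have h4 := sq_nonneg (dirDeriv (spaceDir e₁) Q z₁)
      exact pow_eq_zero_iff two_ne_zero |>.1 (by linarith)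
    obtain ⟨c, hc, s₀, hs₀, hin⟩ := h.pos_inward hz₁T hQ0 hνd hyl (fun n => hIT (hyA n).1)
      fun n => (hyA n).2.1
    have ht : ∀ s : ℝ, (z₁ + s • spaceDir ν).1 = z₁.1 := fun s => by simp [spaceDir]
    refine not_touching_boundary (K := K) (M := M) (ε := ε) (η := η) hD h.smooth hz₁D hνd he0 he₁
      hθz hε hη hσ0 hσ1 hc hs₀ (fun s hs => (hin s hs).1) (fun s hs ζ => ?_) ?_
    · have := hle (z₁ + s • spaceDir ν) (by rw [ht]; exact hz₁) (hin s hs).2 ζ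
      rwa [ht] at this
    · have h1 : Tendsto (fun n => Real.exp (-(K * (y n).1))
          * (dirDeriv (spaceDir (ξ n)) (dirDeriv (spaceDir (ξ n)) Q) (y n) / 2)
            - concavityWeight Q ε η σ 0 (y n)) atTop (𝓝 (Real.exp (-(K * z₁.1))
          * (dirDeriv (spaceDir e₁) (dirDeriv (spaceDir e₁) Q) z₁ / 2)
            - concavityWeight Q ε η σ 0 z₁)) := (hel.mul (hDl.div_const 2)).sub hwl
      have h2 := le_of_tendsto_of_tendsto hfl h1 (Eventually.of_forall fun n => by
        have := mul_le_mul_of_nonneg_left (hform _ (hyA n)) (Real.exp_pos (-(K * (y n).1))).le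
        simp only [hf]
        linarith)
      have h3 : concavityWeight Q ε η σ 0 z₁ = ε + ε * (degeneracy Q z₁)⁻¹ := by
        simp only [concavityWeight, hQ0, Real.zero_rpow hσ0.ne']
        ring
      rw [h3] at h2
      have h4 := mul_le_mul_of_nonneg_left
        (show M + ε + ε * (degeneracy Q z₁)⁻¹ ≤ Real.exp (-(K * z₁.1))
          * (dirDeriv (spaceDir e₁) (dirDeriv (spaceDir e₁) Q) z₁ / 2) by linarith)
        (Real.exp_pos (K * z₁.1)).le
      rw [← mul_assoc (Real.exp _) (Real.exp _), ← Real.exp_add, add_neg_cancel, Real.exp_zero,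
        one_mul] at h4
      linarith

/-- Concavity of the square root of the pressure is preserved. -/
theorem concavityForm_nonpos (h : SmoothPressure a G T P Q) {S R p : ℝ} (hS : S < T) (hp0 : 0 < p)
    (hp : ∀ z, z.1 ∈ Ico 0 T → P z ≤ p) (hG : ContinuousOn G (Icc 0 p))
    (hsupp : ∀ p₀ ∈ Ioc 0 p, ∃ κ c, c ≤ G 0 ∧ p₀ * G p₀ = κ * √p₀ + c * p₀ ∧
      ∀ q ∈ Ioc 0 p, q * G q ≤ κ * √q + c * q)
    (hR : ∀ t ∈ Icc 0 S, ∀ x, 0 < P (t, x) → ‖x‖ ≤ R)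
    (h0 : ∀ x, 0 < P (0, x) → ∀ ξ, concavityForm Q (0, x) ξ ≤ 0)
    {z : ℝ × EuclideanSpace ℝ (Fin N)} (hz : z.1 ∈ Icc 0 S) (hPz : 0 < P z)
    (ξ : EuclideanSpace ℝ (Fin N)) : concavityForm Q z ξ ≤ 0 := by
  have ha := h.a_pos
  have hzT : z.1 ∈ Ico 0 T := ⟨hz.1, hz.2.trans_lt hS⟩
  have hD := isOpen_domain (N := N) (T := T)
  have hzD : z ∈ Iio T ×ˢ (univ : Set (EuclideanSpace ℝ (Fin N))) := ⟨hzT.2, mem_univ _⟩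
  have hQz : 0 < Q z := by rw [h.eq z hzT hPz]; exact hPz
  obtain ⟨B, hB0, hB⟩ := h.exists_derivative_bound hS R
  -- `σ < 1` is needed at the boundary; `σ ≥ 1 - 1/a` keeps the squared gradient term in the
  -- evolution of `P^σ` nonnegative.
  set σ := max (1 / 2) (1 - 1 / a) with hσ
  have hσ0 : 0 < σ := lt_max_of_lt_left (by norm_num)
  have hσ1 : σ < 1 := max_lt (by norm_num) (by have : 0 < 1 / a := by positivity
                                               linarith)
  have haσ : 0 ≤ a * (σ - 1) + 1 := by
    have h1 : 1 - 1 / a ≤ σ := le_max_right _ _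
    have h2 := mul_le_mul_of_nonneg_left h1 ha.le
    have h3 : a * (1 - 1 / a) = a - 1 := by field_simp
    linarith
  have hpσ : 0 < p ^ σ := Real.rpow_pos_of_pos hp0 σ
  have unit : ∀ e : EuclideanSpace ℝ (Fin N), ‖e‖ = 1 → concavityForm Q z e ≤ 0 := by
    intro e he
    -- With `M = 0` the weight is linear in `ε`, and its growth rate does not depend on `ε`; so `ε`
    -- may tend to zero.
    have h1 : ∀ ε > 0, concavityForm Q z e / (4 * Q z) ≤ ε * (Real.exp ((concavityRate a B
        (max (G 0) 0) N + 1) * z.1) * concavityWeight Q 1 (1 / (2 * p ^ σ)) σ 0 z) := by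
      intro ε hε
      have := h.concavityForm_le_weight (η := 1 / (2 * p ^ σ)) hS hp hG hsupp hR h0 hB0 hB
        (by positivity) (by field_simp; rfl) hσ0 hσ1 haσ hε hz hPz he
      refine this.trans (le_of_eq ?_)
      simp only [concavityWeight]
      ring
    have h2 : Tendsto (fun ε : ℝ => ε * (Real.exp ((concavityRate a B
        (max (G 0) 0) N + 1) * z.1) * concavityWeight Q 1 (1 / (2 * p ^ σ)) σ 0 z)) (𝓝[>] 0)
        (𝓝 0) := by
      have : Continuous fun ε : ℝ => ε * (Real.exp ((concavityRate a B
        (max (G 0) 0) N + 1) * z.1) * concavityWeight Q 1 (1 / (2 * p ^ σ)) σ 0 z) := by fun_prop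
      have h3 := this.tendsto 0
      rw [zero_mul] at h3
      exact h3.mono_left nhdsWithin_le_nhds
    have h3 := ge_of_tendsto h2 (by filter_upwards [self_mem_nhdsWithin] with ε hε using h1 ε hε)
    rw [div_le_iff₀ (by linarith), zero_mul] at h3
    exact h3
  rcases eq_or_ne ξ 0 with rfl | hξ
  · have := concavityForm_smul hD h.smooth hzD 0 (0 : EuclideanSpace ℝ (Fin N))
    simp only [zero_smul] at this
    rw [this]
    simp
  · have hu := unit (‖ξ‖⁻¹ • ξ) (norm_smul_inv_norm (𝕜 := ℝ) hξ)
    rw [concavityForm_smul hD h.smooth hzD] at hu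
    have hn : 0 < ‖ξ‖ := norm_pos_iff.2 hξ
    exact nonpos_of_mul_nonpos_right hu (by positivity)

end SmoothPressure

theorem HasJet.comp_neg {f : ℝ → ℝ} {f₀ f₁ f₂ : ℝ} (hf : HasJet f f₀ f₁ f₂) :
    HasJet (fun s => f (-s)) f₀ (-f₁) f₂ := by
  obtain ⟨f', h1, h2, h3, h4⟩ := hf
  have ht : Tendsto (fun s : ℝ => -s) (𝓝 0) (𝓝 0) := by
    simpa using (continuous_neg (G := ℝ)).tendsto 0
  refine ⟨fun s => -f' (-s), ?_, ?_, by simpa using h3, by simpa using h4⟩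
  · filter_upwards [ht.eventually h1] with s hs
    exact (HasDerivAt.comp s hs (hasDerivAt_neg s)).congr_deriv (by ring)
  · have h2' : HasDerivAt f' f₂ (-0) := by simpa using h2
    exact (HasDerivAt.comp (0 : ℝ) h2' (hasDerivAt_neg 0)).fun_neg.congr_deriv (by ring)

/-- The second derivative of a function which is midpoint concave at a point is not positive. -/
theorem HasJet.nonpos_of_midpoint {f : ℝ → ℝ} {f₀ f₁ f₂ : ℝ} (hf : HasJet f f₀ f₁ f₂)
    (h : ∀ᶠ s in 𝓝 0, f s + f (-s) ≤ 2 * f 0) : f₂ ≤ 0 := by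
  have := (hf.add hf.comp_neg).of_isLocalMax (h.mono fun s hs => by simpa [two_mul] using hs)
  linarith [this.2]

theorem ConcaveOn.midpoint_line {V : Type*} [NormedAddCommGroup V] [NormedSpace ℝ V] {O : Set V}
    {f : V → ℝ} (hf : ConcaveOn ℝ O f) (hO : IsOpen O) {x : V} (hx : x ∈ O) (v : V) :
    ∀ᶠ s : ℝ in 𝓝 0, f (x + s • v) + f (x + (-s) • v) ≤ 2 * f x := by
  have h1 := (tendsto_line x v).eventually (hO.mem_nhds hx)
  have h2 := (tendsto_line x (-v)).eventually (hO.mem_nhds hx)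
  filter_upwards [h1, h2] with s hs hs'
  rw [smul_neg, ← neg_smul] at hs'
  have := hf.2 hs hs' (show (0 : ℝ) ≤ 1 / 2 by norm_num) (show (0 : ℝ) ≤ 1 / 2 by norm_num)
    (by norm_num)
  rw [show (1 / 2 : ℝ) • (x + s • v) + (1 / 2 : ℝ) • (x + (-s) • v) = x by module] at this
  simp only [smul_eq_mul] at this
  linarith

theorem sqrtConcave_iff {N : ℕ} {f : EuclideanSpace ℝ (Fin N) → ℝ} (hf : ∀ x, 0 ≤ f x) :
    PowerConcave (1 / 2) f ↔ ConcaveOn ℝ {x | 0 < f x} fun x => √(f x) := by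
  have h1 : Function.support f = {x | 0 < f x} := by
    ext x
    exact ⟨fun h => (hf x).lt_of_ne' h, fun h => ne_of_gt h⟩
  have h2 : (fun x => f x ^ (1 / 2 : ℝ)) = fun x => √(f x) := by
    funext x; rw [Real.sqrt_eq_rpow]
  rw [PowerConcave, h1, h2]
  exact ⟨fun h => h.2 (by norm_num), fun h => ⟨fun h0 => by norm_num at h0, fun _ => h⟩⟩

namespace SmoothPressure

variable {N : ℕ} {a T : ℝ} {G : ℝ → ℝ} {P Q : ℝ × EuclideanSpace ℝ (Fin N) → ℝ}

/-- Identifies the concavity form with the second derivative of `√P` up to a positive factor; used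
in both directions, at the initial time and at time `t`. -/
theorem hasJet_sqrt (h : SmoothPressure a G T P Q) {t : ℝ} (ht : t ∈ Ico 0 T)
    {x : EuclideanSpace ℝ (Fin N)} (hx : 0 < P (t, x)) (ξ : EuclideanSpace ℝ (Fin N)) :
    ∃ d, HasJet (fun s : ℝ => √(P (t, x + s • ξ))) (√(Q (t, x))) d
      (concavityForm Q (t, x) ξ / (4 * √(Q (t, x)) ^ 3)) := by
  have hQ : 0 < Q (t, x) := by rw [h.eq _ ht hx]; exact hx
  refine ⟨_, ((hasJet_line_infty (v := spaceDir ξ) isOpen_domain h.smooth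
    (z := (t, x)) ⟨ht.2, mem_univ _⟩).sqrt hQ).congr ?_⟩
  filter_upwards [(tendsto_line x ξ).eventually ((h.isOpen_slice ht).mem_nhds hx)] with s hs
  have : ((t, x) : ℝ × EuclideanSpace ℝ (Fin N)) + s • spaceDir ξ = (t, x + s • ξ) := by
    simp [spaceDir]
  rw [this, h.eq (t, x + s • ξ) ht hs]

/-- The pressure remains square root concave. -/
theorem sqrtConcave (h : SmoothPressure a G T P Q) {R₀ p : ℝ} (hp0 : 0 < p) (hGp : G p ≤ 0)
    (hG : ContinuousOn G (Icc 0 p))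
    (hsupp : ∀ p₀ ∈ Ioc 0 p, ∃ κ c, c ≤ G 0 ∧ p₀ * G p₀ = κ * √p₀ + c * p₀ ∧
      ∀ q ∈ Ioc 0 p, q * G q ≤ κ * √q + c * q)
    (hR₀ : ∀ x, 0 < P (0, x) → ‖x‖ ≤ R₀) (hle : ∀ x, P (0, x) ≤ p)
    (hconc : ConcaveOn ℝ {x | 0 < P (0, x)} fun x => √(P (0, x))) {t : ℝ} (ht : t ∈ Ico 0 T) :
    ConcaveOn ℝ {x | 0 < P (t, x)} fun x => √(P (t, x)) := by
  have hT : 0 < T := ht.1.trans_lt ht.2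
  have hp : ∀ z, z.1 ∈ Ico 0 T → P z ≤ p := fun z hz => by
    obtain ⟨R, hR⟩ := h.support_bounded hz.2 hR₀
    exact h.le_of_initial_le hz.2 hp0.le hGp hR hle ⟨hz.1, le_rfl⟩ z.2
  obtain ⟨R, hR⟩ := h.support_bounded ht.2 hR₀
  have h0 : ∀ x, 0 < P (0, x) → ∀ ξ, concavityForm Q (0, x) ξ ≤ 0 := by
    intro x hx ξ
    obtain ⟨d, hd⟩ := h.hasJet_sqrt ⟨le_rfl, hT⟩ hx ξ
    have h1 := hd.nonpos_of_midpoint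
      ((hconc.midpoint_line (h.isOpen_slice ⟨le_rfl, hT⟩) hx ξ).mono fun s hs => by simpa using hs)
    have hQ : 0 < Q (0, x) := by rw [h.eq _ ⟨le_rfl, hT⟩ hx]; exact hx
    have h2 : 0 < √(Q (0, x)) := Real.sqrt_pos.2 hQ
    rw [div_le_iff₀ (by positivity), zero_mul] at h1
    exact h1
  have hPc : Continuous fun x => P (t, x) :=
    h.cont.comp_continuous (by fun_prop) fun x => ⟨ht, mem_univ _⟩
  have hO := h.isOpen_slice ht
  have hC : ContDiffOn ℝ 2 (fun x => √(P (t, x))) {x | 0 < P (t, x)} := by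
    have h1 : ContDiffOn ℝ ∞ (fun x => P (t, x)) {x | 0 < P (t, x)} :=
      ((h.smooth.comp (f := fun x : EuclideanSpace ℝ (Fin N) => (t, x))
        (s := {x | 0 < P (t, x)}) (by fun_prop) fun x _ => ⟨ht.2, mem_univ _⟩)).congr
        fun x hx => (h.eq (t, x) ht hx).symm
    exact (h1.of_le two_le_infty).sqrt fun x hx => ne_of_gt hx
  refine concaveOn_of_locally_concave hPc.sqrt (by simp only [Real.sqrt_pos])
    (h.isPreconnected_slice ht hR hconc.1.isPreconnected) hC fun x hx v => ?_
  obtain ⟨d, hd⟩ := h.hasJet_sqrt ht hx v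
  rw [(hd.dirDeriv_eq hO hC hx).2.2]
  exact div_nonpos_of_nonpos_of_nonneg (h.concavityForm_nonpos ht.2 hp0 hp hG hsupp hR h0
    (z := (t, x)) ⟨ht.1, le_rfl⟩ hx v) (by positivity)

end SmoothPressure

theorem IsWeakSolution.sqrtConcave {N : ℕ} {m T P_M P_H : ℝ} {G : ℝ → ℝ}
    {P₀ : EuclideanSpace ℝ (Fin N) → ℝ} {u : ℝ → EuclideanSpace ℝ (Fin N) → ℝ}
    (hu : IsWeakSolution m G T u) (hm : 1 < m) (hPM : 0 < P_M) (hPH : P_M ≤ P_H)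
    (hG_anti : AntitoneOn G (Ici 0)) (hG_zero : G P_M = 0)
    (hG_cont : ContinuousOn G (Icc 0 P_H)) (hG_diff : ContDiffOn ℝ 2 G (Ioc 0 P_H))
    (hG_conc : ∀ p ∈ Ioc 0 P_H,
      3 * derivWithin G (Ioc 0 P_H) p + 2 * p * iteratedDerivWithin 2 G (Ioc 0 P_H) p ≤ 0)
    (hP₀ : ∀ x, 0 ≤ P₀ x ∧ P₀ x ≤ P_H) (hcomp : HasCompactSupport P₀)
    (hconc : PowerConcave (1 / 2) P₀) (hu0 : ∀ x, pressure m (u 0 x) = P₀ x)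
    (hs : SmoothUpToFreeBoundary T (fun t x => pressure m (u t x))) {t : ℝ} (ht : t ∈ Ico 0 T) :
    PowerConcave (1 / 2) fun x => pressure m (u t x) := by
  obtain ⟨Q, h⟩ := hu.exists_smoothPressure hm hG_anti hs
  obtain ⟨R₀, hR₀⟩ := hcomp.isCompact.isBounded.exists_norm_le
  rw [sqrtConcave_iff fun x => (hP₀ x).1] at hconc
  rw [sqrtConcave_iff fun x => h.nonneg (t, x) ht]
  refine h.sqrtConcave (p := P_H) (R₀ := R₀) (hPM.trans_le hPH) ?_ hG_cont
    (fun p₀ hp₀ => exists_reaction_support hG_anti hG_diff hG_conc hp₀)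
    (fun x hx => hR₀ x (subset_tsupport _ ?_)) (fun x => ?_) ?_ ht
  -- Since `G(P_H) ≤ G(P_M) = 0`, the constant `P_H` is a supersolution.
  · exact (hG_anti (mem_Ici.2 hPM.le) (mem_Ici.2 (hPM.le.trans hPH)) hPH).trans hG_zero.le
  · rw [hu0] at hx; exact ne_of_gt hx
  · rw [hu0]; exact (hP₀ x).2
  · simpa only [hu0] using hconc

/-! ### Gluing concave functions -/

/-- `ψ` is a smooth convex approximation of the positive part. -/
structure IsSoftPlus (ψ : ℝ → ℝ) (ε c : ℝ) : Prop where
  smooth : ContDiff ℝ ∞ ψ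
  convex : ConvexOn ℝ univ ψ
  mono : Monotone ψ
  sub_le : ∀ x y, x ≤ y → ψ y - ψ x ≤ y - x
  eq_zero : ∀ z ≤ 0, ψ z = 0
  eq_sub : ∀ z, ε ≤ z → ψ z = z - c

/-- The primitive of a smooth nondecreasing step from `0` to `1` is convex, has slope in `[0, 1]`,
vanishes on the left and is affine with slope one beyond `1`. -/
theorem exists_isSoftPlus : ∃ ψ c, 0 ≤ c ∧ IsSoftPlus ψ 1 c := by
  set τ := Real.smoothTransition with hτ
  have hτc : Continuous τ := Real.smoothTransition.continuous
  set ψ : ℝ → ℝ := fun z => ∫ t in (0 : ℝ)..z, τ t with hψ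
  have hd : ∀ z, HasDerivAt ψ (τ z) z := fun z =>
    (hτc.integral_hasStrictDerivAt 0 z).hasDerivAt
  have hderiv : deriv ψ = τ := funext fun z => (hd z).deriv
  have hmono : Monotone ψ := monotone_of_deriv_nonneg (fun z => (hd z).differentiableAt) fun z => by
    rw [hderiv]; exact Real.smoothTransition.nonneg z
  have hlip : ∀ x y, x ≤ y → ψ y - ψ x ≤ y - x := by
    intro x y hxy
    have : Monotone fun z => z - ψ z := monotone_of_deriv_nonneg
      (fun z => ((hasDerivAt_id' z).fun_sub (hd z)).differentiableAt) fun z => by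
        rw [((hasDerivAt_id' z).fun_sub (hd z)).deriv]
        exact sub_nonneg.2 (Real.smoothTransition.le_one z)
    have := this hxy
    simp only at this
    linarith
  have h0 : ψ 0 = 0 := by simp [hψ]
  refine ⟨ψ, 1 - ψ 1, ?_, ?_, ?_, hmono, hlip, ?_, ?_⟩
  · have := hlip 0 1 zero_le_one
    linarith
  · rw [contDiff_infty_iff_deriv]
    exact ⟨fun z => (hd z).differentiableAt, by rw [hderiv]; exact Real.smoothTransition.contDiff⟩
  · refine Monotone.convexOn_univ_of_deriv (fun z => (hd z).differentiableAt) ?_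
    rw [hderiv]
    exact Real.smoothTransition.monotone
  · intro z hz
    have : ∫ t in (0 : ℝ)..z, τ t = ∫ t in (0 : ℝ)..z, (0 : ℝ) := by
      refine intervalIntegral.integral_congr fun t ht => ?_
      rw [uIcc_of_ge hz] at ht
      exact Real.smoothTransition.zero_of_nonpos ht.2
    simp only [hψ]
    rw [this]
    simp
  · intro z hz
    have h1 : ∫ t in (1 : ℝ)..z, τ t = ∫ t in (1 : ℝ)..z, (1 : ℝ) := by
      refine intervalIntegral.integral_congr fun t ht => ?_
      rw [uIcc_of_le hz] at ht
      exact Real.smoothTransition.one_of_one_le ht.1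
    have h2 := intervalIntegral.integral_add_adjacent_intervals
      (hτc.intervalIntegrable (μ := volume) 0 1) (hτc.intervalIntegrable (μ := volume) 1 z)
    rw [h1] at h2
    simp only [hψ, ← h2]
    simp
    ring

namespace IsSoftPlus

variable {ψ : ℝ → ℝ} {ε c : ℝ}

theorem scale (h : IsSoftPlus ψ 1 c) (hε : 0 < ε) :
    IsSoftPlus (fun z => ε * ψ (z / ε)) ε (ε * c) where
  smooth := contDiff_const.mul (h.smooth.comp (contDiff_id.div_const ε))
  convex := by
    refine ⟨convex_univ, fun x _ y _ a b ha hb hab => ?_⟩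
    have := h.convex.2 (mem_univ (x / ε)) (mem_univ (y / ε)) ha hb hab
    have e : a • (x / ε) + b • (y / ε) = (a • x + b • y) / ε := by
      simp only [smul_eq_mul]; ring
    rw [e] at this
    have := mul_le_mul_of_nonneg_left this hε.le
    simp only [smul_eq_mul] at this ⊢
    linarith
  mono := fun x y hxy => mul_le_mul_of_nonneg_left (h.mono (by gcongr)) hε.le
  sub_le := fun x y hxy => by
    have := mul_le_mul_of_nonneg_left (h.sub_le (x / ε) (y / ε) (by gcongr)) hε.le
    have e : ε * (y / ε - x / ε) = y - x := by field_simp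
    rw [e] at this
    linarith
  eq_zero := fun z hz => by
    rw [h.eq_zero _ (div_nonpos_of_nonpos_of_nonneg hz hε.le), mul_zero]
  eq_sub := fun z hz => by
    rw [h.eq_sub _ ((one_le_div hε).2 hz)]
    field_simp

theorem nonneg (h : IsSoftPlus ψ ε c) (z : ℝ) : 0 ≤ ψ z := by
  rcases le_total z 0 with hz | hz
  · exact (h.eq_zero z hz).ge
  · rw [← h.eq_zero 0 le_rfl]; exact h.mono hz

theorem le_max (h : IsSoftPlus ψ ε c) (z : ℝ) : ψ z ≤ max z 0 := by
  rcases le_total z 0 with hz | hz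
  · rw [h.eq_zero z hz]; exact le_max_right _ _
  · have := h.sub_le 0 z hz
    rw [h.eq_zero 0 le_rfl] at this
    exact (by linarith : ψ z ≤ z).trans (le_max_left _ _)

/-- The smooth minimum of two concave functions is concave. -/
theorem concaveOn (h : IsSoftPlus ψ ε c) {V : Type*} [AddCommGroup V] [Module ℝ V] {s : Set V}
    {b l : V → ℝ} (hb : ConcaveOn ℝ s b) (hl : ConcaveOn ℝ s l) :
    ConcaveOn ℝ s fun x => b x - ψ (b x - l x) := by
  refine ⟨hb.1, fun x hx y hy p q hp hq hpq => ?_⟩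
  have h1 := hb.2 hx hy hp hq hpq
  have h2 := hl.2 hx hy hp hq hpq
  have h3 := h.convex.2 (mem_univ (b x - l x)) (mem_univ (b y - l y)) hp hq hpq
  simp only [smul_eq_mul] at *
  set B := b (p • x + q • y)
  set L := l (p • x + q • y)
  -- The smooth minimum `b - ψ(b - l)` is jointly concave in `(b, l)`, nondecreasing in `l` since
  -- `ψ` is monotone, and nondecreasing in `b` since `ψ` has slope at most one.
  have h4 : ψ (B - L) ≤ ψ (B - (p * l x + q * l y)) := h.mono (by linarith)
  have h5 := h.sub_le (p * (b x - l x) + q * (b y - l y)) (B - (p * l x + q * l y)) (by linarith)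
  linarith

end IsSoftPlus

/-- A smooth increasing concave change of variables on `(0, ∞)`, with inverse `E` defined on the
upper set `I`. -/
structure ConcaveGauge (H E : ℝ → ℝ) (I : Set ℝ) : Prop where
  isOpen : IsOpen I
  isUpper : IsUpperSet I
  smooth_inv : ContDiffOn ℝ ∞ E I
  smooth : ContDiffOn ℝ ∞ H (Ioi 0)
  mem : ∀ s > 0, H s ∈ I
  inv_apply : ∀ s > 0, E (H s) = s
  pos : ∀ g ∈ I, 0 < E g
  apply_inv : ∀ g ∈ I, H (E g) = g
  mono_inv : MonotoneOn E I
  mono : MonotoneOn H (Ioi 0)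
  concave : ConcaveOn ℝ (Ioi 0) H

theorem concaveGauge_log : ConcaveGauge Real.log Real.exp univ where
  isOpen := isOpen_univ
  isUpper := isUpperSet_univ
  smooth_inv := Real.contDiff_exp.contDiffOn
  smooth := fun _ hx => (Real.contDiffAt_log.2 (ne_of_gt hx)).contDiffWithinAt
  mem := fun _ _ => mem_univ _
  inv_apply := fun _ hs => Real.exp_log hs
  pos := fun g _ => Real.exp_pos g
  apply_inv := fun g _ => Real.log_exp g
  mono_inv := Real.exp_monotone.monotoneOn _
  mono := Real.strictMonoOn_log.monotoneOn
  concave := strictConcaveOn_log_Ioi.concaveOn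

theorem concaveGauge_rpow {α : ℝ} (hα0 : 0 < α) (hα1 : α ≤ 1) :
    ConcaveGauge (fun s => s ^ α) (fun g => g ^ (1 / α)) (Ioi 0) where
  isOpen := isOpen_Ioi
  isUpper := isUpperSet_Ioi 0
  smooth_inv := contDiffOn_id.rpow_const_of_ne fun _ hx => ne_of_gt hx
  smooth := contDiffOn_id.rpow_const_of_ne fun _ hx => ne_of_gt hx
  mem := fun _ hs => Real.rpow_pos_of_pos hs α
  inv_apply := fun s hs => by
    rw [← Real.rpow_mul (le_of_lt hs), mul_one_div_cancel hα0.ne', Real.rpow_one]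
  pos := fun _ hg => Real.rpow_pos_of_pos hg _
  apply_inv := fun g hg => by
    rw [← Real.rpow_mul (le_of_lt hg), one_div_mul_cancel hα0.ne', Real.rpow_one]
  mono_inv := fun x hx y _ hxy => Real.rpow_le_rpow (le_of_lt hx) hxy (by positivity)
  mono := fun x hx y _ hxy => Real.rpow_le_rpow (le_of_lt hx) hxy hα0.le
  concave := (Real.concaveOn_rpow hα0.le hα1).subset Ioi_subset_Ici_self (convex_Ioi 0)

/-! ### The glued initial pressure on the unit ball. -/

section Profile

variable {N : ℕ} {H E : ℝ → ℝ} {I : Set ℝ} {ψ : ℝ → ℝ} {ε c p : ℝ}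
  {l : EuclideanSpace ℝ (Fin N) → ℝ}

/-- The paraboloid `p (1 - |x|²)`, modified in the interior of the unit ball by gluing in `l` in
the gauge `H`. -/
noncomputable def gluedProfile (H E ψ : ℝ → ℝ) (p : ℝ) (l : EuclideanSpace ℝ (Fin N) → ℝ)
    (x : EuclideanSpace ℝ (Fin N)) : ℝ :=
  open Classical in
  if x ∈ Metric.ball (0 : EuclideanSpace ℝ (Fin N)) 1 then
    E (H (p * (1 - ‖x‖ ^ 2)) - ψ (H (p * (1 - ‖x‖ ^ 2)) - l x)) else 0

theorem paraboloid_pos (hp : 0 < p) {x : EuclideanSpace ℝ (Fin N)}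
    (hx : x ∈ Metric.ball (0 : EuclideanSpace ℝ (Fin N)) 1) : 0 < p * (1 - ‖x‖ ^ 2) := by
  have h1 : ‖x‖ < 1 := by simpa using hx
  have h2 := norm_nonneg x
  exact mul_pos hp (by nlinarith)

theorem gluedProfile_of_mem {x : EuclideanSpace ℝ (Fin N)}
    (hx : x ∈ Metric.ball (0 : EuclideanSpace ℝ (Fin N)) 1) : gluedProfile H E ψ p l x
      = E (H (p * (1 - ‖x‖ ^ 2)) - ψ (H (p * (1 - ‖x‖ ^ 2)) - l x)) := if_pos hx

theorem gluedProfile_of_notMem {x : EuclideanSpace ℝ (Fin N)}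
    (hx : x ∉ Metric.ball (0 : EuclideanSpace ℝ (Fin N)) 1) : gluedProfile H E ψ p l x = 0 :=
  if_neg hx

theorem concaveOn_gauge_paraboloid (hg : ConcaveGauge H E I) (hp : 0 < p) :
    ConcaveOn ℝ (Metric.ball (0 : EuclideanSpace ℝ (Fin N)) 1) fun x => H (p * (1 - ‖x‖ ^ 2)) := by
  refine ⟨convex_ball _ _, fun x hx y hy a b ha hb hab => ?_⟩
  have hz := convex_ball (0 : EuclideanSpace ℝ (Fin N)) 1 hx hy ha hb hab
  have h1 : ConvexOn ℝ univ fun x : EuclideanSpace ℝ (Fin N) => ‖x‖ ^ 2 :=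
    convexOn_univ_norm.pow (fun _ _ => norm_nonneg _) 2
  have h2 := h1.2 (mem_univ x) (mem_univ y) ha hb hab
  have hx0 := paraboloid_pos hp hx
  have hy0 := paraboloid_pos hp hy
  have h3 := hg.concave.2 (mem_Ioi.2 hx0) (mem_Ioi.2 hy0) ha hb hab
  refine h3.trans (hg.mono ?_ (paraboloid_pos hp hz) ?_)
  · exact hg.concave.1 (mem_Ioi.2 hx0) (mem_Ioi.2 hy0) ha hb hab
  · simp only [smul_eq_mul] at h2 ⊢
    have := mul_le_mul_of_nonneg_left h2 hp.le
    have hb' : b = 1 - a := by linarith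
    subst hb'
    linarith

/-- The smooth minimum is at least the true minimum, and both arguments lie in the upper set `I`. -/
theorem glued_mem (hg : ConcaveGauge H E I) (hsp : IsSoftPlus ψ ε c) (hp : 0 < p)
    (hlI : ∀ x ∈ Metric.ball (0 : EuclideanSpace ℝ (Fin N)) 1, l x ∈ I)
    {x : EuclideanSpace ℝ (Fin N)} (hx : x ∈ Metric.ball (0 : EuclideanSpace ℝ (Fin N)) 1) :
    H (p * (1 - ‖x‖ ^ 2)) - ψ (H (p * (1 - ‖x‖ ^ 2)) - l x) ∈ I := by
  have h1 := hsp.le_max (H (p * (1 - ‖x‖ ^ 2)) - l x)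
  rcases max_choice (H (p * (1 - ‖x‖ ^ 2)) - l x) 0 with h | h <;> rw [h] at h1
  · exact hg.isUpper (by linarith) (hlI x hx)
  · exact hg.isUpper (by linarith) (hg.mem _ (paraboloid_pos hp hx))

theorem gluedProfile_pos (hg : ConcaveGauge H E I) (hsp : IsSoftPlus ψ ε c) (hp : 0 < p)
    (hlI : ∀ x ∈ Metric.ball (0 : EuclideanSpace ℝ (Fin N)) 1, l x ∈ I)
    {x : EuclideanSpace ℝ (Fin N)} (hx : x ∈ Metric.ball (0 : EuclideanSpace ℝ (Fin N)) 1) :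
    0 < gluedProfile H E ψ p l x := by
  rw [gluedProfile_of_mem hx]
  exact hg.pos _ (glued_mem hg hsp hp hlI hx)

theorem gluedProfile_le (hg : ConcaveGauge H E I) (hsp : IsSoftPlus ψ ε c) (hp : 0 < p)
    (hlI : ∀ x ∈ Metric.ball (0 : EuclideanSpace ℝ (Fin N)) 1, l x ∈ I)
    {x : EuclideanSpace ℝ (Fin N)} (hx : x ∈ Metric.ball (0 : EuclideanSpace ℝ (Fin N)) 1) :
    gluedProfile H E ψ p l x ≤ p * (1 - ‖x‖ ^ 2) := by
  have h0 := paraboloid_pos hp hx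
  rw [gluedProfile_of_mem hx]
  conv_rhs => rw [← hg.inv_apply _ h0]
  exact hg.mono_inv (glued_mem hg hsp hp hlI hx) (hg.mem _ h0)
    (sub_le_self _ (hsp.nonneg _))

theorem support_gluedProfile (hg : ConcaveGauge H E I) (hsp : IsSoftPlus ψ ε c) (hp : 0 < p)
    (hlI : ∀ x ∈ Metric.ball (0 : EuclideanSpace ℝ (Fin N)) 1, l x ∈ I) :
    Function.support (gluedProfile H E ψ p l) = Metric.ball 0 1 := by
  ext x
  refine ⟨fun h => ?_, fun h => (gluedProfile_pos hg hsp hp hlI h).ne'⟩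
  by_contra hx
  exact h (gluedProfile_of_notMem hx)

theorem concaveOn_gluedProfile (hg : ConcaveGauge H E I) (hsp : IsSoftPlus ψ ε c) (hp : 0 < p)
    (hlI : ∀ x ∈ Metric.ball (0 : EuclideanSpace ℝ (Fin N)) 1, l x ∈ I)
    (hl : ConcaveOn ℝ (Metric.ball (0 : EuclideanSpace ℝ (Fin N)) 1) l) :
    ConcaveOn ℝ (Metric.ball (0 : EuclideanSpace ℝ (Fin N)) 1)
      fun x => H (gluedProfile H E ψ p l x) :=
  (hsp.concaveOn (concaveOn_gauge_paraboloid hg hp) hl).congr fun x hx => by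
    simp only
    rw [gluedProfile_of_mem hx, hg.apply_inv _ (glued_mem hg hsp hp hlI hx)]

/-- In a neighbourhood of the sphere, within the closed ball, the profile is the paraboloid. -/
theorem gluedProfile_eventuallyEq (hg : ConcaveGauge H E I) (hsp : IsSoftPlus ψ ε c) (hp : 0 < p)
    {r : ℝ} (hr : r < 1) (hbd : ∀ x ∈ Metric.ball (0 : EuclideanSpace ℝ (Fin N)) 1, r < ‖x‖ →
      H (p * (1 - ‖x‖ ^ 2)) ≤ l x) {x : EuclideanSpace ℝ (Fin N)}
    (hx : x ∈ Metric.sphere (0 : EuclideanSpace ℝ (Fin N)) 1) :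
    gluedProfile H E ψ p l =ᶠ[𝓝[Metric.closedBall 0 1] x] fun x => p * (1 - ‖x‖ ^ 2) := by
  have hx1 : ‖x‖ = 1 := by simpa using hx
  have h1 : ∀ᶠ y in 𝓝[Metric.closedBall 0 1] x, r < ‖y‖ :=
    nhdsWithin_le_nhds (continuous_norm.continuousAt.eventually (lt_mem_nhds (hr.trans_eq hx1.symm)))
  filter_upwards [h1, self_mem_nhdsWithin] with y hy hyb
  by_cases hyB : y ∈ Metric.ball (0 : EuclideanSpace ℝ (Fin N)) 1
  · rw [gluedProfile_of_mem hyB, hsp.eq_zero _ (by linarith [hbd y hyB hy]), sub_zero,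
      hg.inv_apply _ (paraboloid_pos hp hyB)]
  · have h2 : ‖y‖ = 1 := le_antisymm (by simpa using hyb) (by simpa using hyB)
    rw [gluedProfile_of_notMem hyB, h2]
    norm_num

theorem contDiff_paraboloid : ContDiff ℝ ∞ fun x : EuclideanSpace ℝ (Fin N) => p * (1 - ‖x‖ ^ 2) :=
  contDiff_const.mul (contDiff_const.sub (contDiff_id.norm_sq ℝ))

/-- The gauge may be singular at zero, but near the sphere the profile is exactly the paraboloid,
which is smooth across it. -/
theorem contDiffOn_gluedProfile (hg : ConcaveGauge H E I) (hsp : IsSoftPlus ψ ε c) (hp : 0 < p)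
    (hlI : ∀ x ∈ Metric.ball (0 : EuclideanSpace ℝ (Fin N)) 1, l x ∈ I)
    (hlC : ContDiffOn ℝ ∞ l (Metric.ball 0 1))
    {r : ℝ} (hr : r < 1) (hbd : ∀ x ∈ Metric.ball (0 : EuclideanSpace ℝ (Fin N)) 1, r < ‖x‖ →
      H (p * (1 - ‖x‖ ^ 2)) ≤ l x) :
    ContDiffOn ℝ ∞ (gluedProfile H E ψ p l) (Metric.closedBall 0 1) := by
  intro x hx
  by_cases hxB : x ∈ Metric.ball (0 : EuclideanSpace ℝ (Fin N)) 1
  · have h1 : ContDiffOn ℝ ∞ (fun x => H (p * (1 - ‖x‖ ^ 2)))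
        (Metric.ball (0 : EuclideanSpace ℝ (Fin N)) 1) :=
      hg.smooth.comp contDiff_paraboloid.contDiffOn fun y hy => paraboloid_pos hp hy
    have h2 : ContDiffOn ℝ ∞ (fun x => H (p * (1 - ‖x‖ ^ 2)) - ψ (H (p * (1 - ‖x‖ ^ 2)) - l x))
        (Metric.ball (0 : EuclideanSpace ℝ (Fin N)) 1) :=
      h1.sub (hsp.smooth.comp_contDiffOn (h1.sub hlC))
    have h3 : ContDiffOn ℝ ∞ (gluedProfile H E ψ p l) (Metric.ball 0 1) :=
      (hg.smooth_inv.comp h2 fun y hy => glued_mem hg hsp hp hlI hy).congr fun y hy =>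
        gluedProfile_of_mem hy
    exact (h3.contDiffAt (Metric.isOpen_ball.mem_nhds hxB)).contDiffWithinAt
  · have hxS : x ∈ Metric.sphere (0 : EuclideanSpace ℝ (Fin N)) 1 := by
      rw [mem_sphere_zero_iff_norm]
      exact le_antisymm (by simpa using hx) (by simpa using hxB)
    exact contDiff_paraboloid.contDiffAt.contDiffWithinAt.congr_of_eventuallyEq_of_mem
      (gluedProfile_eventuallyEq hg hsp hp hr hbd hxS) hx

theorem fderivWithin_gluedProfile_ne_zero (hg : ConcaveGauge H E I) (hsp : IsSoftPlus ψ ε c)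
    (hp : 0 < p) {r : ℝ} (hr : r < 1)
    (hbd : ∀ x ∈ Metric.ball (0 : EuclideanSpace ℝ (Fin N)) 1, r < ‖x‖ →
      H (p * (1 - ‖x‖ ^ 2)) ≤ l x) {x : EuclideanSpace ℝ (Fin N)}
    (hx : x ∈ Metric.sphere (0 : EuclideanSpace ℝ (Fin N)) 1) :
    fderivWithin ℝ (gluedProfile H E ψ p l) (Metric.closedBall 0 1) x ≠ 0 := by
  have hxc : x ∈ Metric.closedBall (0 : EuclideanSpace ℝ (Fin N)) 1 :=
    Metric.sphere_subset_closedBall hx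
  have hu : UniqueDiffWithinAt ℝ (Metric.closedBall (0 : EuclideanSpace ℝ (Fin N)) 1) x :=
    uniqueDiffOn_convex (convex_closedBall _ _)
      ⟨0, Metric.ball_subset_interior_closedBall (Metric.mem_ball_self one_pos)⟩ x hxc
  have hd : HasFDerivAt (fun x : EuclideanSpace ℝ (Fin N) => p * (1 - ‖x‖ ^ 2)) _ x :=
    ((hasStrictFDerivAt_norm_sq x).hasFDerivAt.const_sub 1).const_mul p
  rw [(gluedProfile_eventuallyEq hg hsp hp hr hbd hx).fderivWithin_eq_of_mem hxc,
    hd.hasFDerivWithinAt.fderivWithin hu]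
  intro h0
  have h1 := congrArg (fun L => L x) h0
  have hx1 : ‖x‖ = 1 := by simpa using hx
  simp [hx1] at h1
  exact hp.ne' h1

/-- Where the paraboloid exceeds `l` by more than the width of the smoothing, the smooth minimum is
exactly `l + c`, so the jets of the profile are those of `l` composed with `E`. -/
theorem gluedProfile_eventuallyEq_glued (hg : ConcaveGauge H E I) (hsp : IsSoftPlus ψ ε c)
    (hp : 0 < p) (hlC : ContDiffOn ℝ ∞ l (Metric.ball 0 1)) {x : EuclideanSpace ℝ (Fin N)}
    (hx : x ∈ Metric.ball (0 : EuclideanSpace ℝ (Fin N)) 1)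
    (hε : ε < H (p * (1 - ‖x‖ ^ 2)) - l x) :
    ∀ᶠ y in 𝓝 x, gluedProfile H E ψ p l y = E (l y + c) := by
  have h1 : ContinuousOn (fun x => H (p * (1 - ‖x‖ ^ 2)) - l x)
      (Metric.ball (0 : EuclideanSpace ℝ (Fin N)) 1) :=
    (hg.smooth.comp contDiff_paraboloid.contDiffOn fun y hy =>
      paraboloid_pos hp hy).continuousOn.sub hlC.continuousOn
  have h2 := (h1.continuousAt (Metric.isOpen_ball.mem_nhds hx)).eventually (lt_mem_nhds hε)
  filter_upwards [h2, Metric.isOpen_ball.mem_nhds hx] with y hy hyB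
  rw [gluedProfile_of_mem hyB, hsp.eq_sub _ hy.le]
  congr 1
  ring

end Profile

/-! ### The initial time derivative of the pressure -/

section Within

variable {V : Type*} [NormedAddCommGroup V] [NormedSpace ℝ V] {W : Set V} {F : V → ℝ} {z v : V}

/-- The directional derivative of `F` within `W`. -/
noncomputable def dirDerivWithin (W : Set V) (v : V) (F : V → ℝ) (z : V) : ℝ :=
  fderivWithin ℝ F W z v

theorem ContDiffOn.dirDerivWithin {m n : ℕ∞ω} (hF : ContDiffOn ℝ n F W) (hW : UniqueDiffOn ℝ W)
    (hmn : m + 1 ≤ n) : ContDiffOn ℝ m (dirDerivWithin W v F) W :=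
  (hF.fderivWithin hW hmn).clm_apply contDiffOn_const

theorem dirDerivWithin_eq_dirDeriv (h : W ∈ 𝓝 z) : dirDerivWithin W v F z = dirDeriv v F z := by
  rw [dirDerivWithin, dirDeriv, fderivWithin_of_mem_nhds h]

/-- Meant for spatial lines at time `0`: the positivity set is not a neighbourhood of their points,
yet contains the line on both sides, so the derivative within the set gives a genuine derivative
along it. -/
theorem hasDerivAt_line_within (hF : DifferentiableWithinAt ℝ F W z)
    (h : ∀ᶠ s : ℝ in 𝓝 0, z + s • v ∈ W) :
    HasDerivAt (fun s : ℝ => F (z + s • v)) (dirDerivWithin W v F z) 0 := by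
  have h1 : HasDerivAt (fun s : ℝ => z + s • v) v 0 := by
    simpa using ((hasDerivAt_id (0 : ℝ)).smul_const v).const_add z
  have h2 : HasFDerivWithinAt F (fderivWithin ℝ F W z) W (z + (0 : ℝ) • v) := by
    simpa using hF.hasFDerivWithinAt
  exact (h2.comp_hasDerivWithinAt (t := W) (s := {s : ℝ | z + s • v ∈ W}) 0 h1.hasDerivWithinAt
    fun s hs => hs).hasDerivAt h

theorem hasJet_line_within (hW : UniqueDiffOn ℝ W) (hF : ContDiffOn ℝ 2 F W)
    (h : ∀ᶠ s : ℝ in 𝓝 0, z + s • v ∈ W) :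
    HasJet (fun s : ℝ => F (z + s • v)) (F z) (dirDerivWithin W v F z)
      (dirDerivWithin W v (dirDerivWithin W v F) z) := by
  have hz : z ∈ W := by simpa using h.self_of_nhds
  refine ⟨fun s => dirDerivWithin W v F (z + s • v), ?_, ?_, by simp, by simp⟩
  · filter_upwards [h.eventually_nhds] with s hs
    have hsW : z + s • v ∈ W := hs.self_of_nhds
    have ht : Tendsto (fun r : ℝ => s + r) (𝓝 0) (𝓝 s) := by
      simpa using (continuous_const_add s).tendsto 0
    have h1 := hasDerivAt_line_within (v := v) (hF.differentiableOn (by norm_num) _ hsW)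
      ((ht.eventually hs).mono fun r hr => by rwa [add_assoc, ← add_smul])
    have h2 : HasDerivAt (fun r : ℝ => r - s) 1 s := (hasDerivAt_id s).sub_const s
    have h1' : HasDerivAt (fun r : ℝ => F (z + s • v + r • v))
      (dirDerivWithin W v F (z + s • v)) (s - s) := by rwa [sub_self]
    refine ((HasDerivAt.comp (h := fun r : ℝ => r - s) s h1' h2).congr_of_eventuallyEq
      (Eventually.of_forall fun r => ?_)).congr_deriv (mul_one _)
    simp only [Function.comp_apply]
    rw [add_assoc, ← add_smul, add_sub_cancel]
  · exact hasDerivAt_line_within ((hF.dirDerivWithin (m := 1) hW (by norm_num)).differentiableOn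
      (by norm_num) _ hz) h

end Within

section InitialDerivative

variable {N : ℕ} {m T : ℝ} {G : ℝ → ℝ} {u : ℝ → EuclideanSpace ℝ (Fin N) → ℝ}

theorem IsWeakSolution.continuousOn_pressure (hu : IsWeakSolution m G T u) (hm : 1 < m) :
    ContinuousOn (fun z : ℝ × EuclideanSpace ℝ (Fin N) => pressure m (u z.1 z.2))
      (Ico 0 T ×ˢ univ) :=
  (continuous_pressure hm).comp_continuousOn hu.continuousOn

theorem IsWeakSolution.positivitySet_eq (hu : IsWeakSolution m G T u) (hm : 1 < m) :
    ∃ U : Set (ℝ × EuclideanSpace ℝ (Fin N)), IsOpen U ∧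
      positivitySet T (fun t x => pressure m (u t x)) = (Ico 0 T ×ˢ univ) ∩ U := by
  obtain ⟨U, hU, h⟩ := continuousOn_iff'.1 (hu.continuousOn_pressure hm) (Ioi 0) isOpen_Ioi
  refine ⟨U, hU, ?_⟩
  rw [inter_comm, ← h]
  ext z
  simp [positivitySet, and_comm]

/-- The set is relatively open in `[0, T) × ℝᴺ`. Unique differentiability makes the derivatives
within it well defined and continuous down to the initial time. -/
theorem IsWeakSolution.uniqueDiffOn_positivitySet (hu : IsWeakSolution m G T u) (hm : 1 < m) :
    UniqueDiffOn ℝ (positivitySet T fun t x => pressure m (u t x)) := by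
  obtain ⟨U, hU, h⟩ := hu.positivitySet_eq hm
  rw [h]
  exact ((uniqueDiffOn_Ico 0 T).prod uniqueDiffOn_univ).inter hU

/-- The right derivative at `t = 0` of the pressure of a solution which is `C²` on its positivity
set is given by the equation. -/
theorem IsWeakSolution.hasDerivWithinAt_zero (hu : IsWeakSolution m G T u) (hm : 1 < m)
    (hT : 0 < T) (hG : AntitoneOn G (Ici 0)) {p : ℝ} (hGc : ContinuousOn G (Icc 0 p))
    (hC : ContDiffOn ℝ 2 (fun z : ℝ × EuclideanSpace ℝ (Fin N) => pressure m (u z.1 z.2))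
      (positivitySet T (fun t x => pressure m (u t x))))
    {v : EuclideanSpace ℝ (Fin N) → ℝ} (hv : ∀ x, pressure m (u 0 x) = v x)
    {x : EuclideanSpace ℝ (Fin N)} (hx0 : 0 < v x) (hxp : v x < p) {d dd : Fin N → ℝ}
    (hj : ∀ i, HasJet (fun s : ℝ => v (x + s • EuclideanSpace.single i 1)) (v x) (d i) (dd i)) :
    HasDerivWithinAt (fun t => pressure m (u t x))
      ((m - 1) * v x * ∑ i, dd i + ∑ i, d i ^ 2 + (m - 1) * v x * G (v x)) (Ici 0) 0 := by
  set P : ℝ × EuclideanSpace ℝ (Fin N) → ℝ := fun z => pressure m (u z.1 z.2) with hP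
  set W := positivitySet T (fun t x => pressure m (u t x)) with hWdef
  have hW : UniqueDiffOn ℝ W := hu.uniqueDiffOn_positivitySet hm
  obtain ⟨U, hU, hWU⟩ := hu.positivitySet_eq hm
  rw [← hWdef] at hWU
  have hPv : P (0, x) = v x := hv x
  have hxW : ((0 : ℝ), x) ∈ W := ⟨⟨le_rfl, hT⟩, by simpa only [hv] using hx0⟩
  have hxU : ((0 : ℝ), x) ∈ U := by rw [hWU] at hxW; exact hxW.2
  -- derivatives in space at the initial time
  have hspace : ∀ i, dirDerivWithin W (coordDir i) P (0, x) = d i ∧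
      dirDerivWithin W (coordDir i) (dirDerivWithin W (coordDir i) P) (0, x) = dd i := by
    intro i
    have hmem : ∀ᶠ s : ℝ in 𝓝 0, ((0 : ℝ), x) + s • coordDir i ∈ W := by
      filter_upwards [(tendsto_line ((0 : ℝ), x) (coordDir i)).eventually (hU.mem_nhds hxU)]
        with s hs
      rw [hWU]
      exact ⟨⟨by simp [coordDir, spaceDir, hT], mem_univ _⟩, hs⟩
    have h1 := hasJet_line_within hW hC hmem
    have h2 := (h1.congr (g := fun s : ℝ => v (x + s • EuclideanSpace.single i 1))
      (Eventually.of_forall fun s => by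
        rw [← hv]
        simp [hP, coordDir, spaceDir])).unique (hj i)
    exact h2.2
  -- the equation
  set O : Set (ℝ × EuclideanSpace ℝ (Fin N)) := (Ioo 0 T ×ˢ univ) ∩ P ⁻¹' Ioo 0 p with hOdef
  have hPc := hu.continuousOn_pressure hm
  have hO : IsOpen O := (hPc.mono (prod_mono Ioo_subset_Ico_self Subset.rfl)).isOpen_inter_preimage
    (isOpen_Ioo.prod isOpen_univ) isOpen_Ioo
  have hOW : O ⊆ W := fun z hz => ⟨Ioo_subset_Ico_self hz.1.1, hz.2.1⟩
  have heq : ∀ z ∈ O, dirDerivWithin W (timeDir N) P z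
      = (m - 1) * P z * ∑ i, dirDerivWithin W (coordDir i) (dirDerivWithin W (coordDir i) P) z
        + ∑ i, dirDerivWithin W (coordDir i) P z ^ 2 + (m - 1) * P z * G (P z) := by
    intro z hz
    have hWn : ∀ y ∈ O, W ∈ 𝓝 y := fun y hy => mem_of_superset (hO.mem_nhds hy) hOW
    have h1 := hu.pressure_equation hm hG hO (fun y hy => ⟨hy.1.1, mem_univ _⟩) (P := P)
      (fun y _ => rfl) (hC.mono hOW) (fun y hy => hy.2.1)
      (hGc.comp (hPc.mono fun y hy => ⟨Ioo_subset_Ico_self hy.1.1, mem_univ _⟩)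
        fun y hy => Ioo_subset_Icc_self hy.2) hz
    have h2 : ∀ i, dirDerivWithin W (coordDir i) (dirDerivWithin W (coordDir i) P) z
        = dirDeriv (coordDir i) (dirDeriv (coordDir i) P) z := by
      intro i
      rw [dirDerivWithin_eq_dirDeriv (hWn z hz)]
      exact dirDeriv_eqOn hO (fun y hy => dirDerivWithin_eq_dirDeriv (hWn y hy)) hz
    simp only [h2, dirDerivWithin_eq_dirDeriv (hWn z hz)]
    exact h1
  -- passage to the limit
  have htend : Tendsto (fun t : ℝ => (t, x)) (𝓝[>] 0) (𝓝[W] (0, x)) := by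
    have h1 : Tendsto (fun t : ℝ => (t, x)) (𝓝[>] 0) (𝓝 (0, x)) :=
      ((by fun_prop : Continuous fun t : ℝ => (t, x)).tendsto 0).mono_left nhdsWithin_le_nhds
    refine tendsto_nhdsWithin_iff.2 ⟨h1, ?_⟩
    filter_upwards [h1.eventually (hU.mem_nhds hxU), Ioo_mem_nhdsGT hT] with t ht ht'
    rw [hWU]
    exact ⟨⟨⟨ht'.1.le, ht'.2⟩, mem_univ _⟩, ht⟩
  have hPl : Tendsto (fun t : ℝ => P (t, x)) (𝓝[>] 0) (𝓝 (P (0, x))) :=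
    (hC.continuousOn _ hxW).tendsto.comp htend
  have hOev : ∀ᶠ t : ℝ in 𝓝[>] 0, (t, x) ∈ O := by
    filter_upwards [Ioo_mem_nhdsGT hT, hPl.eventually (Ioo_mem_nhds (by rwa [hPv])
      (by rwa [hPv] : P (0, x) < p))] with t ht ht'
    exact ⟨⟨ht, mem_univ _⟩, ht'⟩
  have hGl : Tendsto (fun t : ℝ => G (P (t, x))) (𝓝[>] 0) (𝓝 (G (P (0, x)))) := by
    refine (hGc (P (0, x)) (by rw [hPv]; exact ⟨hx0.le, hxp.le⟩)).tendsto.comp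
      (tendsto_nhdsWithin_iff.2 ⟨hPl, ?_⟩)
    filter_upwards [hOev] with t ht using Ioo_subset_Icc_self ht.2
  have hc1 : ∀ w, ContDiffOn ℝ 1 (dirDerivWithin W w P) W := fun w =>
    hC.dirDerivWithin hW (by norm_num)
  have l1 : ∀ w, Tendsto (fun t : ℝ => dirDerivWithin W w P (t, x)) (𝓝[>] 0)
      (𝓝 (dirDerivWithin W w P (0, x))) := fun w =>
    ((hc1 w).continuousOn _ hxW).tendsto.comp htend
  have l2 : ∀ w, Tendsto (fun t : ℝ => dirDerivWithin W w (dirDerivWithin W w P) (t, x)) (𝓝[>] 0)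
      (𝓝 (dirDerivWithin W w (dirDerivWithin W w P) (0, x))) := fun w =>
    (((hc1 w).dirDerivWithin (m := 0) hW (by norm_num)).continuousOn _ hxW).tendsto.comp htend
  have hlim : dirDerivWithin W (timeDir N) P (0, x)
      = (m - 1) * v x * ∑ i, dd i + ∑ i, d i ^ 2 + (m - 1) * v x * G (v x) := by
    have h1 := (((hPl.const_mul (m - 1)).mul (tendsto_finsetSum Finset.univ fun i _ =>
      l2 (coordDir i))).add (tendsto_finsetSum Finset.univ fun i _ => (l1 (coordDir i)).pow 2)).add
      ((hPl.const_mul (m - 1)).mul hGl)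
    simp only [hspace, hPv] at h1
    exact tendsto_nhds_unique (l1 (timeDir N)) (h1.congr' (hOev.mono fun t ht => (heq _ ht).symm))
  rw [← hlim]
  have hpath : HasDerivWithinAt (fun t : ℝ => (t, x)) (timeDir N) {t | (t, x) ∈ W} 0 :=
    ((hasDerivAt_id (0 : ℝ)).prodMk (hasDerivAt_const 0 x)).hasDerivWithinAt
  refine ((((hC.differentiableOn (by norm_num)) _ hxW).hasFDerivWithinAt).comp_hasDerivWithinAt
    (f := fun t : ℝ => (t, x)) (0 : ℝ) hpath fun t ht => ht).mono_of_mem_nhdsWithin ?_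
  have h1 := tendsto_nhdsWithin_iff.1 htend
  rw [← Ioi_insert, nhdsWithin_insert]
  exact mem_sup.2 ⟨hxW, h1.2⟩

end InitialDerivative

/-! ### Instantaneous loss of concavity, seen at three collinear points. -/

section LossOfConcavity

/-- A function of time which vanishes at `0` with a positive right derivative is positive for
small times. -/
theorem HasDerivWithinAt.eventually_pos {f : ℝ → ℝ} {f' : ℝ} (hf : HasDerivWithinAt f f' (Ici 0) 0)
    (h0 : f 0 = 0) (hf' : 0 < f') : ∀ᶠ t in 𝓝[>] 0, 0 < f t := by
  have h1 := (hasDerivWithinAt_iff_tendsto_slope' (by simp)).1 hf.Ioi_of_Ici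
  filter_upwards [h1.eventually (lt_mem_nhds hf'), self_mem_nhdsWithin] with t ht ht0
  rw [slope_def_field, h0, sub_zero, sub_zero] at ht
  exact (div_pos_iff_of_pos_right ht0).1 ht

variable {N : ℕ} {m T : ℝ} {G : ℝ → ℝ} {u : ℝ → EuclideanSpace ℝ (Fin N) → ℝ}

/-- If the time derivative of `H ∘ P` has a positive second difference at three equidistant
collinear points where the second difference of `H ∘ P` vanishes, then `H ∘ P` does not stay
concave. -/
theorem IsWeakSolution.exists_not_concaveOn (hu : IsWeakSolution m G T u) (hm : 1 < m)
    (hT : 0 < T) (hG : AntitoneOn G (Ici 0)) {p : ℝ} (hGc : ContinuousOn G (Icc 0 p))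
    (hC : ContDiffOn ℝ 2 (fun z : ℝ × EuclideanSpace ℝ (Fin N) => pressure m (u z.1 z.2))
      (positivitySet T (fun t x => pressure m (u t x))))
    {v : EuclideanSpace ℝ (Fin N) → ℝ} (hv : ∀ x, pressure m (u 0 x) = v x)
    {H : ℝ → ℝ} {x : Fin 3 → EuclideanSpace ℝ (Fin N)} {d dd : Fin 3 → Fin N → ℝ} {H' : Fin 3 → ℝ}
    (hx : x 0 + x 2 = (2 : ℝ) • x 1) (hx0 : ∀ j, 0 < v (x j)) (hxp : ∀ j, v (x j) < p)
    (hH : ∀ j, HasDerivAt H (H' j) (v (x j)))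
    (hj : ∀ j i, HasJet (fun s : ℝ => v (x j + s • EuclideanSpace.single i 1)) (v (x j)) (d j i)
      (dd j i))
    (h2 : H (v (x 0)) + H (v (x 2)) = 2 * H (v (x 1))) {R : Fin 3 → ℝ}
    (hR : ∀ j, R j = H' j * ((m - 1) * v (x j) * ∑ i, dd j i + ∑ i, d j i ^ 2
      + (m - 1) * v (x j) * G (v (x j))))
    (hpos : 2 * R 1 < R 0 + R 2) :
    ∃ δ ∈ Ioc 0 T, ∀ t ∈ Ioo 0 δ, ¬ ConcaveOn ℝ (Function.support fun x => pressure m (u t x))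
      fun x => H (pressure m (u t x)) := by
  have hd : ∀ j, HasDerivWithinAt (fun t => pressure m (u t (x j))) _ (Ici 0) 0 := fun j =>
    hu.hasDerivWithinAt_zero hm hT hG hGc hC hv (hx0 j) (hxp j) (hj j)
  have hHd : ∀ j, HasDerivWithinAt (fun t => H (pressure m (u t (x j)))) (R j) (Ici 0) 0 := by
    intro j
    rw [hR]
    have h1 : HasDerivAt H (H' j) (pressure m (u 0 (x j))) := by rw [hv]; exact hH j
    exact HasDerivAt.comp_hasDerivWithinAt (h := fun t => pressure m (u t (x j))) 0 h1 (hd j)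
  have hD := (((hHd 0).fun_add (hHd 2)).fun_sub ((hHd 1).const_mul 2)).eventually_pos
    (by simp only [hv]; linarith) (by linarith)
  have hp : ∀ j, ∀ᶠ t in 𝓝[>] 0, 0 < pressure m (u t (x j)) := fun j =>
    (((hd j).continuousWithinAt.tendsto.eventually (lt_mem_nhds (by rw [hv]; exact hx0 j)))).filter_mono
      (nhdsWithin_mono 0 Ioi_subset_Ici_self)
  obtain ⟨δ, hδ, hδs⟩ := mem_nhdsGT_iff_exists_Ioo_subset.1
    (hD.and ((hp 0).and ((hp 1).and (hp 2))))
  refine ⟨min δ T, ⟨lt_min hδ hT, min_le_right _ _⟩, fun t ht hconc => ?_⟩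
  obtain ⟨g0, g1, -, g3⟩ := hδs ⟨ht.1, ht.2.trans_le (min_le_left _ _)⟩
  have := hconc.2 (x := x 0) (y := x 2) (ne_of_gt g1) (ne_of_gt g3)
    (show (0 : ℝ) ≤ 1 / 2 by norm_num) (show (0 : ℝ) ≤ 1 / 2 by norm_num) (by norm_num)
  rw [show (1 / 2 : ℝ) • x 0 + (1 / 2 : ℝ) • x 2 = x 1 by
    rw [← smul_add, hx, smul_smul]; norm_num] at this
  simp only [smul_eq_mul] at this
  linarith

end LossOfConcavity

/-! ### Profiles which lose their concavity -/

/-- The initial time derivative of `H ∘ P` at a point where `H ∘ P` has the value `g`, a gradient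
of squared norm `k` and the Laplacian `l`; here `E` is the inverse of `H`. -/
noncomputable def gaugeRate (a : ℝ) (G E E₁ E₂ : ℝ → ℝ) (g k l : ℝ) : ℝ :=
  a * E g * (E₂ g / E₁ g * k + l) + E₁ g * k + a * E g * G (E g) / E₁ g

theorem IsSoftPlus.const_le {ψ : ℝ → ℝ} {ε c : ℝ} (h : IsSoftPlus ψ ε c) : c ≤ ε := by
  have h1 := h.nonneg ε
  rw [h.eq_sub ε le_rfl] at h1
  linarith

theorem ConcaveGauge.hasDerivAt {H E : ℝ → ℝ} {I : Set ℝ} (hg : ConcaveGauge H E I) {g e : ℝ}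
    (hgI : g ∈ I) (he : HasDerivAt E e g) : e ≠ 0 ∧ HasDerivAt H (1 / e) (E g) := by
  have h1 : DifferentiableAt ℝ H (E g) :=
    (hg.smooth.contDiffAt (isOpen_Ioi.mem_nhds (hg.pos g hgI))).differentiableAt (by simp)
  have h2 := HasDerivAt.comp g h1.hasDerivAt he
  have h3 : HasDerivAt (H ∘ E) 1 g := (hasDerivAt_id g).congr_of_eventuallyEq (by
    filter_upwards [hg.isOpen.mem_nhds hgI] with y hy using hg.apply_inv y hy)
  have h4 := h2.unique h3
  have h5 : e ≠ 0 := right_ne_zero_of_mul_eq_one h4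
  refine ⟨h5, ?_⟩
  rw [← eq_div_iff h5] at h4
  rw [← h4]
  exact h1.hasDerivAt

/-- There is an initial pressure in the class `C`, with values in `[0, p]`, supported in the unit
ball and smooth with non-vanishing gradient up to the boundary, such that the pressure of no
solution that is `C²` on its positivity set stays in the class `C` for small times. -/
def LosesConcavity (N : ℕ) (m p : ℝ) (G : ℝ → ℝ) (C : (EuclideanSpace ℝ (Fin N) → ℝ) → Prop) :
    Prop :=
  ∃ v₀ : EuclideanSpace ℝ (Fin N) → ℝ,
    ContDiffOn ℝ ∞ v₀ (Metric.closedBall 0 1) ∧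
    (∀ x ∈ Metric.ball 0 1, 0 < v₀ x ∧ v₀ x ≤ p) ∧
    (∀ x ∉ Metric.ball 0 1, v₀ x = 0) ∧
    C v₀ ∧
    (∀ x ∈ Metric.sphere 0 1, fderivWithin ℝ v₀ (Metric.closedBall 0 1) x ≠ 0) ∧
    ∀ (T : ℝ) (u : ℝ → EuclideanSpace ℝ (Fin N) → ℝ),
      0 < T →
      IsWeakSolution m G T u → (∀ x, pressure m (u 0 x) = v₀ x) →
      ContDiffOn ℝ 2 (fun z : ℝ × EuclideanSpace ℝ (Fin N) => pressure m (u z.1 z.2))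
        (positivitySet T (fun t x => pressure m (u t x))) →
      ∃ δ ∈ Ioc 0 T, ∀ t ∈ Ioo 0 δ, ¬ C (fun x => pressure m (u t x))

/-- Near the three points the profile is `E (l + c)`, so the chain rule turns the initial derivative
of `H ∘ P` into an explicit function of the value, gradient and Laplacian of `l`. The construction
of the initial pressure is thereby reduced to the choice of `l`. -/
theorem losesConcavity_of_rate {N : ℕ} {m p ε c r : ℝ} {G H E E₁ E₂ ψ : ℝ → ℝ} {I : Set ℝ}
    {l : EuclideanSpace ℝ (Fin N) → ℝ} (hm : 1 < m) (hG : AntitoneOn G (Ici 0))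
    (hGc : ContinuousOn G (Icc 0 p)) (hp : 0 < p) (hg : ConcaveGauge H E I)
    (hE₁ : ∀ g ∈ I, HasDerivAt E (E₁ g) g) (hE₂ : ∀ g ∈ I, HasDerivAt E₁ (E₂ g) g)
    (hsp : IsSoftPlus ψ ε c) (hc : 0 ≤ c) (hlC : ContDiffOn ℝ ∞ l (Metric.ball 0 1))
    (hl : ConcaveOn ℝ (Metric.ball 0 1) l)
    (hlI : ∀ x ∈ Metric.ball (0 : EuclideanSpace ℝ (Fin N)) 1, l x ∈ I) (hr : r < 1)
    (hbd : ∀ x ∈ Metric.ball (0 : EuclideanSpace ℝ (Fin N)) 1, r < ‖x‖ →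
      H (p * (1 - ‖x‖ ^ 2)) ≤ l x)
    {x : Fin 3 → EuclideanSpace ℝ (Fin N)} (hx : x 0 + x 2 = (2 : ℝ) • x 1)
    (hxB : ∀ j, x j ∈ Metric.ball (0 : EuclideanSpace ℝ (Fin N)) 1)
    (hxε : ∀ j, l (x j) + ε < H (p * (1 - ‖x j‖ ^ 2))) {d dd : Fin 3 → Fin N → ℝ}
    (hj : ∀ j i, HasJet (fun s : ℝ => l (x j + s • EuclideanSpace.single i 1)) (l (x j)) (d j i)
      (dd j i))
    (h2 : l (x 0) + l (x 2) = 2 * l (x 1)) {R : Fin 3 → ℝ}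
    (hR : ∀ j, R j
      = gaugeRate (m - 1) G E E₁ E₂ (l (x j) + c) (∑ i, d j i ^ 2) (∑ i, dd j i))
    (hpos : 2 * R 1 < R 0 + R 2) :
    LosesConcavity N m p G fun f => ConcaveOn ℝ (Function.support f) fun x => H (f x) := by
  have hpB : ∀ x ∈ Metric.ball (0 : EuclideanSpace ℝ (Fin N)) 1, p * (1 - ‖x‖ ^ 2) ≤ p :=
    fun x _ => mul_le_of_le_one_right hp.le (by linarith [sq_nonneg ‖x‖])
  refine ⟨gluedProfile H E ψ p l, contDiffOn_gluedProfile hg hsp hp hlI hlC hr hbd,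
    fun x hx => ⟨gluedProfile_pos hg hsp hp hlI hx,
      (gluedProfile_le hg hsp hp hlI hx).trans (hpB x hx)⟩, fun x hx => gluedProfile_of_notMem hx,
    ?_, fun x hx => fderivWithin_gluedProfile_ne_zero hg hsp hp hr hbd hx, ?_⟩
  · beta_reduce
    rw [support_gluedProfile hg hsp hp hlI]
    exact concaveOn_gluedProfile hg hsp hp hlI hl
  · intro T u hT hu hv hC
    set v := gluedProfile H E ψ p l with hvdef
    have hgI : ∀ j, l (x j) + c ∈ I := fun j =>
      hg.isUpper (le_add_of_nonneg_right hc) (hlI _ (hxB j))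
    have hvev : ∀ j, ∀ᶠ y in 𝓝 (x j), v y = E (l y + c) := fun j =>
      gluedProfile_eventuallyEq_glued hg hsp hp hlC (hxB j) (by linarith [hxε j])
    have hvx : ∀ j, v (x j) = E (l (x j) + c) := fun j => (hvev j).self_of_nhds
    have hHv : ∀ j, H (v (x j)) = l (x j) + c := fun j => by
      rw [hvx, hg.apply_inv _ (hgI j)]
    have hvp : ∀ j, 0 < v (x j) := fun j => gluedProfile_pos hg hsp hp hlI (hxB j)
    -- The strict inequality keeps the pressure, for short times, in the range where `G` is
    -- continuous; it holds because the value `l + c` in the gauge lies below that of the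
    -- paraboloid.
    have hvlt : ∀ j, v (x j) < p := by
      intro j
      refine lt_of_lt_of_le ?_ (hpB _ (hxB j))
      by_contra! hcon
      have h3 := hg.mono (paraboloid_pos hp (hxB j)) (hvp j) hcon
      rw [hHv] at h3
      linarith [hxε j, hsp.const_le]
    have hjv : ∀ j i, HasJet (fun s : ℝ => v (x j + s • EuclideanSpace.single i 1)) (v (x j))
        (E₁ (l (x j) + c) * (d j i + 0))
        (E₂ (l (x j) + c) * (d j i + 0) ^ 2 + E₁ (l (x j) + c) * (dd j i + 0)) := by
      intro j i
      rw [hvx]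
      refine (((hj j i).add (HasJet.const c)).comp ?_ (hE₂ _ (hgI j))).congr ?_
      · filter_upwards [hg.isOpen.mem_nhds (hgI j)] with y hy using hE₁ y hy
      · exact (tendsto_line (x j) _).eventually (hvev j)
    refine hu.exists_not_concaveOn hm hT hG hGc hC hv hx hvp hvlt (H := H)
      (H' := fun j => 1 / E₁ (l (x j) + c)) (R := R) (fun j => ?_) hjv ?_ (fun j => ?_) hpos
    · rw [hvx]
      exact (hg.hasDerivAt (hgI j) (hE₁ _ (hgI j))).2
    · rw [hHv, hHv, hHv]; linarith
    · have h3 := (hg.hasDerivAt (hgI j) (hE₁ _ (hgI j))).1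
      simp only [hR, hvx, gaugeRate, add_zero, mul_pow, Finset.sum_add_distrib, ← Finset.mul_sum]
      field_simp

/-- The condition which makes the glued profile coincide with the paraboloid near the sphere. -/
theorem ConcaveGauge.exists_radius {N : ℕ} {H E : ℝ → ℝ} {I : Set ℝ} {p A : ℝ}
    {l : EuclideanSpace ℝ (Fin N) → ℝ} (hg : ConcaveGauge H E I) (hp : 0 < p) (hA : A ∈ I)
    (hl : ∀ x ∈ Metric.ball (0 : EuclideanSpace ℝ (Fin N)) 1, A ≤ l x) :
    ∃ r < 1, ∀ x ∈ Metric.ball (0 : EuclideanSpace ℝ (Fin N)) 1, r < ‖x‖ →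
      H (p * (1 - ‖x‖ ^ 2)) ≤ l x := by
  have hE := hg.pos A hA
  refine ⟨1 - E A / (2 * p), sub_lt_self _ (by positivity), fun x hx hr => ?_⟩
  refine le_trans ?_ (hl x hx)
  rw [← hg.apply_inv A hA]
  refine hg.mono (paraboloid_pos hp hx) hE ?_
  have h1 : ‖x‖ < 1 := by simpa using hx
  have h2 : 1 - ‖x‖ < E A / (2 * p) := by linarith
  rw [lt_div_iff₀ (by positivity)] at h2
  nlinarith [norm_nonneg x]

/-- Profiles which, in the gauge `H`, are affine near three points close to the boundary. -/
theorem losesConcavity_of_affine {N : ℕ} {m p ε c A q δ : ℝ}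
    {G H E E₁ E₂ ψ : ℝ → ℝ} {I : Set ℝ} (i₀ : Fin N) (hm : 1 < m) (hG : AntitoneOn G (Ici 0))
    (hGc : ContinuousOn G (Icc 0 p)) (hp : 0 < p) (hg : ConcaveGauge H E I)
    (hE₁ : ∀ g ∈ I, HasDerivAt E (E₁ g) g) (hE₂ : ∀ g ∈ I, HasDerivAt E₁ (E₂ g) g)
    (hsp : IsSoftPlus ψ ε c) (hc : 0 ≤ c) (hA : A ∈ I) (hq : 0 < q) (hδ : 0 < δ) (hδ3 : δ ≤ 1 / 3)
    (hε : A + 3 * q + ε < H (p * δ))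
    (hpos : 2 * gaugeRate (m - 1) G E E₁ E₂ (A + 2 * q + c) ((q / δ) ^ 2) 0
      < gaugeRate (m - 1) G E E₁ E₂ (A + q + c) ((q / δ) ^ 2) 0
        + gaugeRate (m - 1) G E E₁ E₂ (A + 3 * q + c) ((q / δ) ^ 2) 0) :
    LosesConcavity N m p G fun f => ConcaveOn ℝ (Function.support f) fun x => H (f x) := by
  set l : EuclideanSpace ℝ (Fin N) → ℝ := fun x => A + q / δ * (1 - x i₀) with hl
  -- The points lie on an axis at distances `δ`, `2δ`, `3δ` from the sphere, where `l` takes the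
  -- values `A + q`, `A + 2q`, `A + 3q`; its slope `q / δ` is large for small `δ`.
  set n : Fin 3 → ℝ := fun j => (j : ℝ) + 1 with hn
  have hn1 : ∀ j, 1 ≤ n j ∧ n j ≤ 3 := by intro j; fin_cases j <;> norm_num [hn]
  set x : Fin 3 → EuclideanSpace ℝ (Fin N) := fun j =>
    (1 - n j * δ) • EuclideanSpace.single i₀ 1 with hx
  have hxi : ∀ j, (x j) i₀ = 1 - n j * δ := fun j => by simp [hx]
  have hlx : ∀ j, l (x j) = A + q * n j := fun j => by
    simp only [hl, hxi]; field_simp; ring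
  have hxn : ∀ j, ‖x j‖ ^ 2 = (1 - n j * δ) ^ 2 := fun j => by
    simp [hx, norm_smul]
  have hnδ : ∀ j, 0 < n j * δ ∧ n j * δ ≤ 1 := fun j =>
    ⟨by nlinarith [(hn1 j).1], by nlinarith [(hn1 j).2]⟩
  have hlA : ∀ x ∈ Metric.ball (0 : EuclideanSpace ℝ (Fin N)) 1, A ≤ l x := by
    intro x hx
    have h1 : ‖x‖ < 1 := by simpa using hx
    have h2 := (le_abs_self _).trans (PiLp.norm_apply_le x i₀)
    have : 0 ≤ q / δ * (1 - x i₀) := mul_nonneg (by positivity) (by linarith)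
    simp only [hl]; linarith
  obtain ⟨r, hr, hbd⟩ := hg.exists_radius hp hA hlA
  have hlC : ContDiff ℝ ∞ l := by simp only [hl]; fun_prop
  have hj : ∀ j i, HasJet (fun s : ℝ => l (x j + s • EuclideanSpace.single i 1)) (l (x j))
      (if i = i₀ then -(q / δ) else 0) 0 := by
    intro j i
    have h1 : HasJet (fun s : ℝ => l (x j) + (if i = i₀ then -(q / δ) else 0) * s) (l (x j))
        (if i = i₀ then -(q / δ) else 0) 0 :=
      ((HasJet.const _).add (HasJet.id.const_mul _)).cast (by ring) (by ring) (by ring)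
    refine h1.congr (Eventually.of_forall fun s => ?_)
    simp only [hl]
    split_ifs with h
    · subst h; simp; ring
    · simp [Ne.symm h]
  refine losesConcavity_of_rate (x := x) (l := l)
    (R := fun j => gaugeRate (m - 1) G E E₁ E₂ (A + q * n j + c) ((q / δ) ^ 2) 0)
    hm hG hGc hp hg hE₁ hE₂ hsp hc hlC.contDiffOn ?_
    (fun x hx => hg.isUpper (hlA x hx) hA) hr hbd ?_ (fun j => ?_) (fun j => ?_) hj ?_ (fun j => ?_)
    ?_
  · refine ⟨convex_ball _ _, fun x _ y _ s t _ _ hst => le_of_eq ?_⟩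
    have ht : t = 1 - s := by linarith
    subst ht
    simp [hl]; ring
  · simp only [hx]
    rw [← add_smul, smul_smul]
    norm_num [hn]
    ring
  · rw [mem_ball_zero_iff, ← sq_lt_one_iff₀ (norm_nonneg _), hxn]
    nlinarith [hnδ j]
  · rw [hlx, hxn]
    -- `1 - (1 - nδ)² = nδ (2 - nδ) ≥ δ`, using `n ≥ 1` and `nδ ≤ 1`.
    have h1 : p * δ ≤ p * (1 - (1 - n j * δ) ^ 2) := by
      refine mul_le_mul_of_nonneg_left ?_ hp.le
      nlinarith [hnδ j, hn1 j]
    have h2 := hg.mono (show p * δ ∈ Ioi 0 from mul_pos hp hδ)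
      (show p * (1 - (1 - n j * δ) ^ 2) ∈ Ioi 0 from (mul_pos hp hδ).trans_le h1) h1
    nlinarith [hn1 j]
  · simp only [hlx]; norm_num [hn]; ring
  · rw [hlx]
    simp [Finset.sum_ite_eq', ite_pow]
  · norm_num [hn]
    rw [show A + q * 2 = A + 2 * q by ring, show A + q * 3 = A + 3 * q by ring]
    exact hpos

/-! ### Steep affine profiles: the logarithm and the exponents below one half. -/

section Cases

variable {N : ℕ} {m p α : ℝ} {G : ℝ → ℝ}

theorem AntitoneOn.abs_le_of_mem_Icc (hG : AntitoneOn G (Ici 0)) {s : ℝ} (hs : s ∈ Icc 0 p) :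
    |G s| ≤ |G 0| + |G p| := by
  have h1 := hG self_mem_Ici (mem_Ici.2 hs.1) hs.1
  have h2 := hG (mem_Ici.2 hs.1) (mem_Ici.2 (hs.1.trans hs.2)) hs.2
  exact abs_le.2 ⟨by linarith [neg_abs_le (G p), abs_nonneg (G 0)],
    by linarith [le_abs_self (G 0), abs_nonneg (G p)]⟩

/-- The rate is `m e^g |∇l|² + a G(e^g)`. With slope `1/δ` and `e^g` of order `δ`, the first term is
of order `1/δ` and strictly convex in `g`, while the reaction stays bounded. -/
theorem losesConcavity_log (i₀ : Fin N) (hm : 1 < m) (hG : AntitoneOn G (Ici 0))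
    (hGc : ContinuousOn G (Icc 0 p)) (hp : 0 < p) :
    LosesConcavity N m p G fun f => ConcaveOn ℝ (Function.support f) fun x => Real.log (f x) := by
  obtain ⟨ψ, c, hc, hsp⟩ := exists_isSoftPlus
  have ha : 0 < m - 1 := by linarith
  set Γ := |G 0| + |G p| with hΓ
  have hΓ0 : 0 ≤ Γ := by positivity
  -- the distance of the three points from the boundary
  set b := p * Real.exp (c - 5) with hb
  have hb0 : 0 < b := by positivity
  set δ := min (1 / 3) (b / (4 * (m - 1) * Γ + 1)) with hδ
  have hδ0 : 0 < δ := by positivity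
  have hδ3 : δ ≤ 1 / 3 := min_le_left _ _
  have hδb : δ * (4 * (m - 1) * Γ + 1) ≤ b := by
    rw [← le_div_iff₀ (by positivity)]; exact min_le_right _ _
  refine losesConcavity_of_affine (E₁ := Real.exp) (E₂ := Real.exp) (A := Real.log (p * δ) - 5)
    (q := 1) (δ := δ) i₀ hm hG hGc hp concaveGauge_log (fun g _ => Real.hasDerivAt_exp g)
    (fun g _ => Real.hasDerivAt_exp g) hsp hc (mem_univ _) one_pos hδ0 hδ3 (by linarith) ?_
  have hrate : ∀ g k, gaugeRate (m - 1) G Real.exp Real.exp Real.exp g k 0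
      = m * Real.exp g * k + (m - 1) * G (Real.exp g) := by
    intro g k
    have := Real.exp_pos g
    simp only [gaugeRate]
    field_simp
    ring
  have hexp : ∀ s, Real.exp (Real.log (p * δ) - 5 + s + c) = b * δ * Real.exp s := by
    intro s
    rw [show Real.log (p * δ) - 5 + s + c = Real.log (p * δ) + (c - 5) + s by ring, Real.exp_add,
      Real.exp_add, Real.exp_log (by positivity), hb]
    ring
  have hc1 := hsp.const_le
  have hle : ∀ s ≤ 3, b * δ * Real.exp s ∈ Icc 0 p := by
    intro s hs
    refine ⟨by positivity, ?_⟩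
    have h1 : b * Real.exp s ≤ p := by
      rw [hb, mul_assoc, ← Real.exp_add]
      exact mul_le_of_le_one_right hp.le (Real.exp_le_one_iff.2 (by linarith))
    calc b * δ * Real.exp s = δ * (b * Real.exp s) := by ring
      _ ≤ 1 * p := mul_le_mul (by linarith) h1 (by positivity) zero_le_one
      _ = p := one_mul p
  have g1 := abs_le.1 (hG.abs_le_of_mem_Icc (hle 1 (by norm_num)))
  have g2 := abs_le.1 (hG.abs_le_of_mem_Icc (hle 2 (by norm_num)))
  have g3 := abs_le.1 (hG.abs_le_of_mem_Icc (hle 3 (by norm_num)))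
  rw [hrate, hrate, hrate, mul_one, mul_one, hexp, hexp, hexp]
  have e2 : Real.exp 2 = Real.exp 1 ^ 2 := by rw [← Real.exp_nat_mul]; norm_num
  have e3 : Real.exp 3 = Real.exp 1 ^ 3 := by rw [← Real.exp_nat_mul]; norm_num
  have e1 : 2 ≤ Real.exp 1 := by linarith [Real.add_one_le_exp (1 : ℝ)]
  have hD : 1 ≤ Real.exp 1 - 2 * Real.exp 2 + Real.exp 3 := by
    rw [e2, e3]; nlinarith [mul_nonneg (by linarith : 0 ≤ Real.exp 1 - 2) (sq_nonneg (Real.exp 1 - 1)), sq_nonneg (Real.exp 1 - 1)]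
  have hk : m * b / δ * 1 ≤ m * b / δ * (Real.exp 1 - 2 * Real.exp 2 + Real.exp 3) :=
    mul_le_mul_of_nonneg_left hD (by positivity)
  have hbig : 4 * (m - 1) * Γ < m * b / δ * 1 := by
    rw [mul_one, lt_div_iff₀ hδ0]
    nlinarith
  have hsimp : ∀ s, m * (b * δ * Real.exp s) * (1 / δ) ^ 2 = m * b / δ * Real.exp s := by
    intro s; field_simp
  rw [hsimp, hsimp, hsimp]
  nlinarith [mul_le_mul_of_nonneg_left g1.1 ha.le, mul_le_mul_of_nonneg_left g2.2 ha.le,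
    mul_le_mul_of_nonneg_left g3.1 ha.le]

theorem hasDerivAt_rpow_of_pos {g : ℝ} (hg : 0 < g) (r : ℝ) :
    HasDerivAt (fun g : ℝ => g ^ r) (r * g ^ (r - 1)) g ∧
      HasDerivAt (fun g : ℝ => r * g ^ (r - 1)) (r * ((r - 1) * g ^ (r - 2))) g := by
  refine ⟨Real.hasDerivAt_rpow_const (Or.inl hg.ne'), ?_⟩
  have := (Real.hasDerivAt_rpow_const (x := g) (p := r - 1) (Or.inl hg.ne')).const_mul r
  rwa [show r - 1 - 1 = r - 2 by ring] at this

/-- For a power gauge the gradient term has weight `g^(r-1)`, strictly convex if `r > 2`, and the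
diffusion term has weight `g^r`; this is where the exponents below and above one half part ways. -/
theorem gaugeRate_rpow {a r g : ℝ} (hr : r ≠ 0) (hg : 0 < g) (k l : ℝ) :
    gaugeRate a G (fun g => g ^ r) (fun g => r * g ^ (r - 1)) (fun g => r * ((r - 1) * g ^ (r - 2)))
      g k l = (a * (r - 1) + r) * g ^ (r - 1) * k + a * g ^ r * l + a / r * g * G (g ^ r) := by
  have h1 : g ^ r = g ^ (r - 1) * g := by
    rw [← Real.rpow_add_one hg.ne']; congr 1; ring
  have h2 : g ^ (r - 1) = g ^ (r - 2) * g := by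
    rw [← Real.rpow_add_one hg.ne']; congr 1; ring
  have h3 : 0 < g ^ (r - 2) := Real.rpow_pos_of_pos hg _
  simp only [gaugeRate]
  generalize hγ : G (g ^ r) = γ
  rw [h1, h2]
  field_simp
  ring

/-- Now `r - 1 > 1`, so `g^(r-1)` is strictly convex. After the common factor `q` is removed, the
gradient term has second difference of order `1/δ` and the reaction term is bounded. -/
theorem losesConcavity_rpow_of_lt (i₀ : Fin N) (hm : 1 < m) (hG : AntitoneOn G (Ici 0))
    (hGc : ContinuousOn G (Icc 0 p)) (hp : 0 < p) (hα0 : 0 < α) (hα : α < 1 / 2) :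
    LosesConcavity N m p G fun f => ConcaveOn ℝ (Function.support f) fun x => f x ^ α := by
  obtain ⟨ψ, c, hc, hsp⟩ := exists_isSoftPlus
  have hc1 := hsp.const_le
  have ha : 0 < m - 1 := by linarith
  set Γ := |G 0| + |G p| with hΓ
  have hΓ0 : 0 ≤ Γ := by positivity
  set r := 1 / α with hr
  have hr2 : 2 < r := by rw [hr, lt_div_iff₀ hα0]; linarith
  have hr0 : 0 < r := by linarith
  set C := (m - 1) * (r - 1) + r with hC
  have hC0 : 0 < C := by
    have : 0 < (m - 1) * (r - 1) := mul_pos ha (by linarith)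
    linarith
  -- In units of `q` the three values in the gauge are `2 + c`, `3 + c`, `4 + c`, the smooth minimum
  -- having width `q` and offset `q c`.
  set D := (2 + c) ^ (r - 1) - 2 * (3 + c) ^ (r - 1) + (4 + c) ^ (r - 1) with hD
  have hD0 : 0 < D := by
    have := (strictConvexOn_rpow (show 1 < r - 1 by linarith)).2
      (show 2 + c ∈ Ici 0 from mem_Ici.2 (by linarith)) (show 4 + c ∈ Ici 0 from mem_Ici.2 (by linarith))
      (by linarith) (show (0 : ℝ) < 1 / 2 by norm_num) (show (0 : ℝ) < 1 / 2 by norm_num)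
      (by norm_num)
    simp only [smul_eq_mul] at this
    rw [show 1 / 2 * (2 + c) + 1 / 2 * (4 + c) = 3 + c by ring] at this
    linarith
  set b := C * p / 8 ^ r * D with hb
  have hb0 : 0 < b := by positivity
  set δ := min (1 / 3) (b / (20 * ((m - 1) / r) * Γ + 1)) with hδ
  have hδ0 : 0 < δ := by positivity
  have hδ3 : δ ≤ 1 / 3 := min_le_left _ _
  have hδb : δ * (20 * ((m - 1) / r) * Γ + 1) ≤ b := by
    rw [← le_div_iff₀ (by positivity)]; exact min_le_right _ _
  -- Then `A + 3q` plus the smoothing width `q` is `5q`, below the value `8q` of the gauge at `p δ`.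
  set q := (p * δ) ^ α / 8 with hq
  have hpδ : 0 < p * δ := by positivity
  have hq0 : 0 < q := by positivity
  have hq8 : (p * δ) ^ α = 8 * q := by rw [hq]; ring
  have hqr : q ^ r = p * δ / 8 ^ r := by
    rw [hq, Real.div_rpow (by positivity) (by norm_num), hr, ← Real.rpow_mul hpδ.le,
      mul_one_div_cancel hα0.ne', Real.rpow_one]
  refine losesConcavity_of_affine (H := fun s => s ^ α) (E := fun g => g ^ r)
    (E₁ := fun g => r * g ^ (r - 1)) (E₂ := fun g => r * ((r - 1) * g ^ (r - 2))) (A := q)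
    (q := q) (δ := δ) i₀ hm hG hGc hp (concaveGauge_rpow hα0 (by linarith))
    (fun g hg => (hasDerivAt_rpow_of_pos hg r).1) (fun g hg => (hasDerivAt_rpow_of_pos hg r).2)
    (hsp.scale hq0) (by positivity) hq0 hq0 hδ0 hδ3 (by rw [hq8]; linarith) ?_
  have hrate : ∀ s, 0 < s → gaugeRate (m - 1) G (fun g => g ^ r) (fun g => r * g ^ (r - 1))
      (fun g => r * ((r - 1) * g ^ (r - 2))) (q * s) ((q / δ) ^ 2) 0
      = q * (C * p / 8 ^ r / δ * s ^ (r - 1) + (m - 1) / r * s * G ((q * s) ^ r)) := by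
    intro s hs
    rw [gaugeRate_rpow hr0.ne' (by positivity), Real.mul_rpow hq0.le hs.le]
    have h1 : q ^ (r - 1) * q = p * δ / 8 ^ r := by
      rw [← Real.rpow_add_one hq0.ne', ← hqr]; congr 1; ring
    have h2 : q ^ (r - 1) = p * δ / 8 ^ r / q := by rw [← h1]; field_simp
    rw [h2]
    field_simp
    ring
  have hmem : ∀ s, 0 < s → s ≤ 8 → (q * s) ^ r ∈ Icc 0 p := by
    intro s hs0 hs
    refine ⟨by positivity, ?_⟩
    have h1 : q * s ≤ (p * δ) ^ α := by rw [hq8]; nlinarith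
    refine (Real.rpow_le_rpow (by positivity) h1 hr0.le).trans ?_
    rw [← Real.rpow_mul hpδ.le, hr, mul_one_div_cancel hα0.ne', Real.rpow_one]
    nlinarith
  have g1 := abs_le.1 (hG.abs_le_of_mem_Icc (hmem (2 + c) (by linarith) (by linarith)))
  have g2 := abs_le.1 (hG.abs_le_of_mem_Icc (hmem (3 + c) (by linarith) (by linarith)))
  have g3 := abs_le.1 (hG.abs_le_of_mem_Icc (hmem (4 + c) (by linarith) (by linarith)))
  rw [show q + q + q * c = q * (2 + c) by ring, show q + 2 * q + q * c = q * (3 + c) by ring,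
    show q + 3 * q + q * c = q * (4 + c) by ring, hrate _ (by linarith), hrate _ (by linarith),
    hrate _ (by linarith)]
  have hmr : 0 < (m - 1) / r := by positivity
  -- With `c ≤ 1` the reaction terms weigh at most `3 + 2·4 + 5 = 16`, so `20` is ample.
  have hbig : 20 * ((m - 1) / r) * Γ < C * p / 8 ^ r / δ * D := by
    rw [div_mul_eq_mul_div, ← hb, lt_div_iff₀ hδ0]
    nlinarith
  have k1 : -(3 * ((m - 1) / r) * Γ) ≤ (m - 1) / r * (2 + c) * G ((q * (2 + c)) ^ r) := by
    have h1 : (m - 1) / r * (2 + c) * -Γ ≤ (m - 1) / r * (2 + c) * G ((q * (2 + c)) ^ r) :=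
      mul_le_mul_of_nonneg_left g1.1 (by positivity)
    have h2 : (m - 1) / r * Γ * (2 + c) ≤ (m - 1) / r * Γ * 3 :=
      mul_le_mul_of_nonneg_left (by linarith) (by positivity)
    linarith
  have k2 : (m - 1) / r * (3 + c) * G ((q * (3 + c)) ^ r) ≤ 4 * ((m - 1) / r) * Γ := by
    have h1 : (m - 1) / r * (3 + c) * G ((q * (3 + c)) ^ r) ≤ (m - 1) / r * (3 + c) * Γ :=
      mul_le_mul_of_nonneg_left g2.2 (by positivity)
    have h2 : (m - 1) / r * Γ * (3 + c) ≤ (m - 1) / r * Γ * 4 :=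
      mul_le_mul_of_nonneg_left (by linarith) (by positivity)
    linarith
  have k3 : -(5 * ((m - 1) / r) * Γ) ≤ (m - 1) / r * (4 + c) * G ((q * (4 + c)) ^ r) := by
    have h1 : (m - 1) / r * (4 + c) * -Γ ≤ (m - 1) / r * (4 + c) * G ((q * (4 + c)) ^ r) :=
      mul_le_mul_of_nonneg_left g3.1 (by positivity)
    have h2 : (m - 1) / r * Γ * (4 + c) ≤ (m - 1) / r * Γ * 5 :=
      mul_le_mul_of_nonneg_left (by linarith) (by positivity)
    linarith
  have hz : 0 ≤ (m - 1) / r * Γ := by positivity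
  rw [← mul_add, mul_left_comm]
  refine mul_lt_mul_of_pos_left ?_ hq0
  rw [hD] at hbig
  linarith

end Cases

/-! ### Profiles which lose their concavity by diffusion -/

section Cone

variable {N : ℕ}

theorem sqrt_add_sq_add_sq_le (a b c d : ℝ) :
    √((a + b) ^ 2 + (c + d) ^ 2) ≤ √(a ^ 2 + c ^ 2) + √(b ^ 2 + d ^ 2) := by
  have h1 : a * b + c * d ≤ √(a ^ 2 + c ^ 2) * √(b ^ 2 + d ^ 2) := by
    rw [← Real.sqrt_mul (by positivity)]
    refine Real.le_sqrt_of_sq_le ?_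
    nlinarith [sq_nonneg (a * d - b * c)]
  refine Real.sqrt_le_iff.2 ⟨by positivity, ?_⟩
  have h2 := Real.sq_sqrt (show 0 ≤ a ^ 2 + c ^ 2 by positivity)
  have h3 := Real.sq_sqrt (show 0 ≤ b ^ 2 + d ^ 2 by positivity)
  nlinarith

/-- The excess `√(k² + r²) - k` is nonincreasing in `k`. -/
theorem sqrt_sub_antitone {k k' r : ℝ} (h : k ≤ k') : √(k' ^ 2 + r ^ 2) - k' ≤ √(k ^ 2 + r ^ 2) - k := by
  have := sqrt_add_sq_add_sq_le k (k' - k) r 0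
  rw [add_sub_cancel, add_zero, zero_pow two_ne_zero, add_zero, Real.sqrt_sq (by linarith)] at this
  linarith

/-- The function `k - √(k² + ρ²)` is concave by the triangle inequality and homogeneity, and
nondecreasing in `k`; so a concave `k` and the norm of a linear map may be inserted. -/
theorem concaveOn_sub_sqrt {V : Type*} [NormedAddCommGroup V] [NormedSpace ℝ V] {s : Set V}
    {k : V → ℝ} (hk : ConcaveOn ℝ s k) (L : V →ₗ[ℝ] V) :
    ConcaveOn ℝ s fun x => k x - √(k x ^ 2 + ‖L x‖ ^ 2) := by
  refine ⟨hk.1, fun x hx y hy a b ha hb hab => ?_⟩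
  have h1 := hk.2 hx hy ha hb hab
  simp only [smul_eq_mul] at h1 ⊢
  have h2 := sqrt_sub_antitone (r := ‖L (a • x + b • y)‖) h1
  have h3 : ‖L (a • x + b • y)‖ ≤ a * ‖L x‖ + b * ‖L y‖ := by
    rw [map_add, map_smul, map_smul]
    refine (norm_add_le _ _).trans (le_of_eq ?_)
    rw [norm_smul, norm_smul, Real.norm_of_nonneg ha, Real.norm_of_nonneg hb]
  have h4 : √((a * k x + b * k y) ^ 2 + ‖L (a • x + b • y)‖ ^ 2)
      ≤ √((a * k x + b * k y) ^ 2 + (a * ‖L x‖ + b * ‖L y‖) ^ 2) :=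
    Real.sqrt_le_sqrt (by gcongr)
  have h5 := sqrt_add_sq_add_sq_le (a * k x) (b * k y) (a * ‖L x‖) (b * ‖L y‖)
  have h6 : ∀ {t A B : ℝ}, 0 ≤ t → √((t * A) ^ 2 + (t * B) ^ 2) = t * √(A ^ 2 + B ^ 2) := by
    intro t A B ht
    rw [mul_pow, mul_pow, ← mul_add, Real.sqrt_mul (sq_nonneg t), Real.sqrt_sq ht]
  rw [h6 ha, h6 hb] at h5
  linarith

/-- The component of `x` orthogonal to the `i₀`-th coordinate axis. -/
noncomputable def offAxis (i₀ : Fin N) :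
    EuclideanSpace ℝ (Fin N) →L[ℝ] EuclideanSpace ℝ (Fin N) :=
  ContinuousLinearMap.id ℝ _ -
    (EuclideanSpace.proj i₀ : EuclideanSpace ℝ (Fin N) →L[ℝ] ℝ).smulRight (EuclideanSpace.single i₀ 1)

theorem offAxis_apply (i₀ : Fin N) (x : EuclideanSpace ℝ (Fin N)) :
    offAxis i₀ x = x - x i₀ • EuclideanSpace.single i₀ 1 := by
  simp [offAxis]

theorem norm_offAxis_le (i₀ : Fin N) (x : EuclideanSpace ℝ (Fin N)) : ‖offAxis i₀ x‖ ≤ 2 * ‖x‖ := by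
  rw [offAxis_apply]
  refine (norm_sub_le _ _).trans ?_
  have h1 := PiLp.norm_apply_le x i₀
  rw [norm_smul]
  simp only [PiLp.norm_single, norm_one, mul_one]
  linarith

theorem offAxis_axis (i₀ : Fin N) (t : ℝ) : offAxis i₀ (t • EuclideanSpace.single i₀ 1) = 0 := by
  simp [offAxis_apply]

theorem offAxis_single (i₀ i : Fin N) :
    offAxis i₀ (EuclideanSpace.single i 1) = if i = i₀ then 0 else EuclideanSpace.single i 1 := by
  rw [offAxis_apply]
  split_ifs with h
  · subst h; simp
  · simp [Ne.symm h]

end Cone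

/-! ### Transversally curved profiles: the exponents above one half. -/

section Case

variable {N : ℕ} {m p α : ℝ} {G : ℝ → ℝ}

set_option maxHeartbeats 1600000 in
-- The profile is affine on the axis but sharply bent across it: there its Laplacian is `-β (N - 1)
-- / k`, and with `k = w g^(r/2)` the diffusion term becomes `-a β (N - 1) g^(r/2) / w`. As `r / 2 <
-- 1` this is strictly convex along the axis, and a small `w` makes it outweigh gradient and
-- reaction terms.
theorem losesConcavity_rpow_of_gt {i₀ i₁ : Fin N} (hi : i₁ ≠ i₀) (hm : 1 < m)
    (hG : AntitoneOn G (Ici 0)) (hGc : ContinuousOn G (Icc 0 p)) (hp : 0 < p) (hα : 1 / 2 < α)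
    (hα1 : α ≤ 1) :
    LosesConcavity N m p G fun f => ConcaveOn ℝ (Function.support f) fun x => f x ^ α := by
  obtain ⟨ψ, c₁, hc₁, hsp⟩ := exists_isSoftPlus
  have hα0 : 0 < α := by linarith
  have ha : 0 < m - 1 := by linarith
  set r := 1 / α with hr
  have hr1 : 1 ≤ r := by rw [hr, le_div_iff₀ hα0]; linarith
  have hr2 : r < 2 := by rw [hr, div_lt_iff₀ hα0]; linarith
  have hr0 : 0 < r := by linarith
  have hN : 0 < (N : ℝ) - 1 := by
    have h1 : 1 < Fintype.card (Fin N) := Fintype.one_lt_card_iff.2 ⟨i₁, i₀, hi⟩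
    rw [Fintype.card_fin] at h1
    have : (1 : ℝ) < N := by exact_mod_cast h1
    linarith
  -- At the three points `l` is at most `9β/2` and the smoothing width is `2β`, while the paraboloid
  -- has gauge at least `(3/4) · 16β = 12β`. The bounds `l₀ ≥ 3β` and `‖offAxis‖ ≤ 2` in the ball
  -- leave `l ≥ β`.
  set β := p ^ α / 16 with hβ
  have hpα : p ^ α = 16 * β := by rw [hβ]; ring
  have hβ0 : 0 < β := by positivity
  set c := 2 * β * c₁ with hc
  have hc0 : 0 ≤ c := by positivity
  -- the affine part and the values at the three points
  set l₀ : EuclideanSpace ℝ (Fin N) → ℝ := fun x => 4 * β + β * x i₀ with hl₀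
  have hl₀b : ∀ x ∈ Metric.ball (0 : EuclideanSpace ℝ (Fin N)) 1, 3 * β ≤ l₀ x ∧ l₀ x ≤ 5 * β := by
    intro x hx
    have h1 : ‖x‖ < 1 := by simpa using hx
    have h2 := abs_le.1 ((PiLp.norm_apply_le x i₀).trans h1.le)
    constructor <;> simp only [hl₀] <;> nlinarith
  set n : Fin 3 → ℝ := fun j => ((j : ℝ) - 1) / 2 with hn
  have hn1 : ∀ j, -(1 / 2) ≤ n j ∧ n j ≤ 1 / 2 := by intro j; fin_cases j <;> norm_num [hn]
  set g : Fin 3 → ℝ := fun j => 4 * β + β * n j + c with hg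
  have hg0 : ∀ j, 0 < g j := fun j => by
    simp only [hg]; nlinarith [hn1 j]
  have hD : 0 < 2 * g 1 ^ (r / 2) - g 0 ^ (r / 2) - g 2 ^ (r / 2) := by
    have := (Real.strictConcaveOn_rpow (show 0 < r / 2 by linarith) (show r / 2 < 1 by linarith)).2
      (show g 0 ∈ Ici 0 from (hg0 0).le) (show g 2 ∈ Ici 0 from (hg0 2).le)
      (by simp only [hg, hn]; norm_num; intro h; linarith)
      (show (0 : ℝ) < 1 / 2 by norm_num) (show (0 : ℝ) < 1 / 2 by norm_num) (by norm_num)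
    simp only [smul_eq_mul] at this
    rw [show 1 / 2 * g 0 + 1 / 2 * g 2 = g 1 by simp only [hg, hn]; norm_num; ring] at this
    linarith
  -- the part of the rate which does not depend on `w`
  set X : Fin 3 → ℝ := fun j => ((m - 1) * (r - 1) + r) * g j ^ (r - 1) * β ^ 2
    + (m - 1) / r * g j * G (g j ^ r) with hX
  set Y := (m - 1) * β * (N - 1) * (2 * g 1 ^ (r / 2) - g 0 ^ (r / 2) - g 2 ^ (r / 2)) with hY
  have hY0 : 0 < Y := by positivity
  -- The convexity gained from diffusion is `Y / w`; this `w` makes it exceed the possible concavity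
  -- of the remaining terms by at least one.
  set w := Y / (|2 * X 1 - X 0 - X 2| + 1) with hw
  have hw0 : 0 < w := by positivity
  have hwX : 2 * X 1 - X 0 - X 2 < 1 / w * Y := by
    have h1 : 1 / w * Y = |2 * X 1 - X 0 - X 2| + 1 := by rw [hw]; field_simp
    rw [h1]
    linarith [le_abs_self (2 * X 1 - X 0 - X 2)]
  -- The curvature radius across the axis is proportional to `k`. The power `r/2 ≤ 1` keeps `k`,
  -- hence `l`, concave, and turns `g^r / k` into a multiple of `g^(r/2)`.
  set k : EuclideanSpace ℝ (Fin N) → ℝ := fun x => w * (l₀ x + c) ^ (r / 2) with hk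
  set l : EuclideanSpace ℝ (Fin N) → ℝ := fun x =>
    l₀ x + β * (k x - √(k x ^ 2 + ‖offAxis i₀ x‖ ^ 2)) with hl
  have hk0 : ∀ x ∈ Metric.ball (0 : EuclideanSpace ℝ (Fin N)) 1, 0 < k x := fun x hx => by
    have := (hl₀b x hx).1
    have : 0 < l₀ x + c := by linarith
    positivity
  have hl₀C : ContDiff ℝ ∞ l₀ := by simp only [hl₀]; fun_prop
  have hkC : ContDiffOn ℝ ∞ k (Metric.ball 0 1) :=
    contDiffOn_const.mul ((hl₀C.add contDiff_const).contDiffOn.rpow_const_of_ne fun x hx => by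
      linarith [(hl₀b x hx).1])
  have hlC : ContDiffOn ℝ ∞ l (Metric.ball 0 1) := by
    refine hl₀C.contDiffOn.add (contDiffOn_const.mul (hkC.sub (ContDiffOn.sqrt ((hkC.pow 2).add
      ((offAxis i₀).contDiff.norm_sq ℝ).contDiffOn) fun x hx => ?_)))
    have := hk0 x hx
    positivity
  have hl₀c : ConcaveOn ℝ (Metric.ball 0 1) l₀ := by
    refine ⟨convex_ball _ _, fun x _ y _ s t _ _ hst => le_of_eq ?_⟩
    have ht : t = 1 - s := by linarith
    subst ht
    simp [hl₀]; ring
  have hkc : ConcaveOn ℝ (Metric.ball 0 1) k := by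
    refine ⟨convex_ball _ _, fun x hx y hy s t hs ht hst => ?_⟩
    have h1 := (Real.concaveOn_rpow (show 0 ≤ r / 2 by linarith) (show r / 2 ≤ 1 by linarith)).2
      (show l₀ x + c ∈ Ici 0 from mem_Ici.2 (by linarith [(hl₀b x hx).1]))
      (show l₀ y + c ∈ Ici 0 from mem_Ici.2 (by linarith [(hl₀b y hy).1])) hs ht hst
    have h2 : s • (l₀ x + c) + t • (l₀ y + c) = l₀ (s • x + t • y) + c := by
      have ht : t = 1 - s := by linarith
      subst ht
      simp [hl₀]; ring
    rw [h2] at h1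
    have h3 := mul_le_mul_of_nonneg_left h1 hw0.le
    simp only [hk, smul_eq_mul] at h3 ⊢
    linarith
  have hlc : ConcaveOn ℝ (Metric.ball 0 1) l :=
    hl₀c.add ((concaveOn_sub_sqrt hkc (offAxis i₀).toLinearMap).smul hβ0.le)
  have hlb : ∀ x ∈ Metric.ball (0 : EuclideanSpace ℝ (Fin N)) 1, β ≤ l x := by
    intro x hx
    have h1 : ‖x‖ < 1 := by simpa using hx
    have h2 := norm_offAxis_le i₀ x
    have h3 : √(k x ^ 2 + ‖offAxis i₀ x‖ ^ 2) ≤ k x + ‖offAxis i₀ x‖ := by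
      have h4 := hk0 x hx
      have h5 := norm_nonneg (offAxis i₀ x)
      exact Real.sqrt_le_iff.2 ⟨by positivity, by nlinarith⟩
    have h4 : β * (√(k x ^ 2 + ‖offAxis i₀ x‖ ^ 2) - k x) ≤ β * 2 :=
      mul_le_mul_of_nonneg_left (by linarith) hβ0.le
    simp only [hl]
    linarith [(hl₀b x hx).1]
  set x : Fin 3 → EuclideanSpace ℝ (Fin N) := fun j => n j • EuclideanSpace.single i₀ 1 with hx
  have hxi : ∀ j, (x j) i₀ = n j := fun j => by simp [hx]
  have hxn : ∀ j, ‖x j‖ = |n j| := fun j => by simp [hx, norm_smul]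
  have hxB : ∀ j, x j ∈ Metric.ball (0 : EuclideanSpace ℝ (Fin N)) 1 := fun j => by
    rw [mem_ball_zero_iff, hxn, abs_lt]
    constructor <;> linarith [hn1 j]
  have hlx : ∀ j, l (x j) = 4 * β + β * n j := fun j => by
    simp only [hl, hl₀, hxi]
    rw [show offAxis i₀ (x j) = 0 from offAxis_axis i₀ (n j), norm_zero, zero_pow two_ne_zero,
      add_zero, Real.sqrt_sq (hk0 _ (hxB j)).le, sub_self, mul_zero, add_zero]
  have hkx : ∀ j, k (x j) = w * g j ^ (r / 2) := fun j => by
    simp only [hk, hl₀, hxi, hg]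
  have hgauge := concaveGauge_rpow hα0 hα1
  obtain ⟨ρ, hρ, hbd⟩ := hgauge.exists_radius hp (mem_Ioi.2 hβ0) hlb
  -- Along the axis the root cancels `k` and `l` is affine. Across it `l₀` and `k` are constant, and
  -- `-β √(k² + s²)` has second derivative `-β / k` at `s = 0`.
  have hj : ∀ j i, HasJet (fun s : ℝ => l (x j + s • EuclideanSpace.single i 1)) (l (x j))
      (if i = i₀ then β else 0) (if i = i₀ then 0 else -(β / k (x j))) := by
    intro j i
    have hkp := hk0 _ (hxB j)
    by_cases h : i = i₀
    · subst h
      simp only [if_true]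
      refine (((HasJet.const (l (x j))).add (HasJet.id.const_mul β)).cast (by ring) (by ring)
        (by ring)).congr ?_
      filter_upwards [(tendsto_line (x j) (EuclideanSpace.single i (1 : ℝ))).eventually
        (Metric.isOpen_ball.mem_nhds (hxB j))] with s hs
      have h1 : offAxis i (x j + s • EuclideanSpace.single i 1) = 0 := by
        rw [map_add, show offAxis i (x j) = 0 from offAxis_axis i (n j), offAxis_axis, add_zero]
      rw [hlx]
      simp only [hl]
      rw [h1, norm_zero, zero_pow two_ne_zero, add_zero, Real.sqrt_sq (hk0 _ hs).le]
      simp [hl₀, hxi]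
      ring
    · simp only [if_neg h]
      have h2 : HasJet (fun s : ℝ => l₀ (x j) + β * (k (x j) - √(k (x j) ^ 2 + s ^ 2))) _ _ _ :=
        (HasJet.const _).add (((HasJet.const _).sub (((HasJet.const (k (x j) ^ 2)).add
          HasJet.id.pow_two).sqrt (by positivity))).const_mul β)
      refine (h2.congr (Eventually.of_forall fun s => ?_)).cast ?_ ?_ ?_
      · have h1 : offAxis i₀ (x j + s • EuclideanSpace.single i 1) = s • EuclideanSpace.single i 1 := by
          rw [map_add, show offAxis i₀ (x j) = 0 from offAxis_axis i₀ (n j), map_smul,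
            offAxis_single, if_neg h, zero_add]
        have h3 : l₀ (x j + s • EuclideanSpace.single i 1) = l₀ (x j) := by
          simp [hl₀, Ne.symm h]
        simp only [hl, hk, h3]
        rw [h1, norm_smul]
        simp
      · rw [hlx, zero_pow two_ne_zero, add_zero, Real.sqrt_sq hkp.le]
        simp [hl₀, hxi]
      · simp
      · rw [zero_pow two_ne_zero, add_zero, Real.sqrt_sq hkp.le]
        field_simp
        ring
  have hsum1 : ∑ i : Fin N, (if i = i₀ then β else 0) ^ 2 = β ^ 2 := by
    simp [ite_pow, Finset.sum_ite_eq']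
  have hsum2 : ∀ q : ℝ, ∑ i : Fin N, (if i = i₀ then 0 else -q) = -((N - 1) * q) := by
    intro q
    have : ∀ i : Fin N, (if i = i₀ then 0 else -q) = -q + if i = i₀ then q else 0 := fun i => by
      split_ifs <;> ring
    simp only [this, Finset.sum_add_distrib, Finset.sum_ite_eq', Finset.sum_const,
      Finset.card_univ, Fintype.card_fin, Finset.mem_univ, if_true, nsmul_eq_mul]
    ring
  refine losesConcavity_of_rate (H := fun s => s ^ α) (E := fun g => g ^ r) (x := x) (l := l)
    (E₁ := fun g => r * g ^ (r - 1)) (E₂ := fun g => r * ((r - 1) * g ^ (r - 2)))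
    (R := fun j => X j - 1 / w * ((m - 1) * β * (N - 1) * g j ^ (r / 2)))
    hm hG hGc hp hgauge (fun g hg => (hasDerivAt_rpow_of_pos hg r).1)
    (fun g hg => (hasDerivAt_rpow_of_pos hg r).2) (hsp.scale (show 0 < 2 * β by positivity)) hc0
    hlC hlc (fun x hx => hβ0.trans_le (hlb x hx)) hρ hbd ?_ hxB (fun j => ?_) hj ?_ (fun j => ?_) ?_
  · simp only [hx]
    rw [← add_smul, smul_smul]
    norm_num [hn]
  · rw [hlx, hxn, sq_abs]
    have h1 : p * (3 / 4) ≤ p * (1 - n j ^ 2) :=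
      mul_le_mul_of_nonneg_left (by nlinarith [hn1 j]) hp.le
    have h2 := Real.rpow_le_rpow (by positivity) h1 hα0.le
    rw [Real.mul_rpow hp.le (by norm_num), hpα] at h2
    have h3 : (3 / 4 : ℝ) ≤ (3 / 4) ^ α := by
      have := Real.rpow_le_rpow_of_exponent_ge (show (0 : ℝ) < 3 / 4 by norm_num) (by norm_num) hα1
      rwa [Real.rpow_one] at this
    have h4 := mul_le_mul_of_nonneg_left h3 (show 0 ≤ 16 * β by positivity)
    nlinarith [hn1 j]
  · simp only [hlx]; norm_num [hn]; ring
  · rw [hlx, hsum1, hsum2, hkx, show 4 * β + β * n j + 2 * β * c₁ = g j from rfl,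
      gaugeRate_rpow hr0.ne' (hg0 j)]
    have h1 : g j ^ r = g j ^ (r / 2) * g j ^ (r / 2) := by
      rw [← Real.rpow_add (hg0 j)]; congr 1; ring
    have h2 : 0 < g j ^ (r / 2) := Real.rpow_pos_of_pos (hg0 j) _
    have h3 : (m - 1) * g j ^ r * -((N - 1) * (β / (w * g j ^ (r / 2))))
        = -(1 / w * ((m - 1) * β * (N - 1) * g j ^ (r / 2))) := by
      rw [h1]; field_simp
    rw [h3, hX]
    ring
  · rw [hY] at hwX
    linarith

end Case

theorem exists_profile_losing_powerConcavity {N : ℕ} {m p α : ℝ} {G : ℝ → ℝ} (hN : 2 ≤ N)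
    (hm : 1 < m) (hG : AntitoneOn G (Ici 0)) (hGc : ContinuousOn G (Icc 0 p)) (hp : 0 < p)
    (hα : α ∈ Icc (0 : ℝ) 1) (hα2 : α ≠ 1 / 2) : LosesConcavity N m p G (PowerConcave α) := by
  set i₀ : Fin N := ⟨0, by omega⟩
  set i₁ : Fin N := ⟨1, by omega⟩
  have hi : i₁ ≠ i₀ := by simp [i₀, i₁]
  rcases hα.1.eq_or_lt with h0 | h0
  · have : (PowerConcave α : (EuclideanSpace ℝ (Fin N) → ℝ) → Prop)
        = fun f => ConcaveOn ℝ (Function.support f) fun x => Real.log (f x) := by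
      funext f
      simp [PowerConcave, ← h0]
    rw [this]
    exact losesConcavity_log i₀ hm hG hGc hp
  · have : (PowerConcave α : (EuclideanSpace ℝ (Fin N) → ℝ) → Prop)
        = fun f => ConcaveOn ℝ (Function.support f) fun x => f x ^ α := by
      funext f
      simp [PowerConcave, h0.ne']
    rw [this]
    rcases lt_or_gt_of_ne hα2 with h | h
    · exact losesConcavity_rpow_of_lt i₀ hm hG hGc hp h0 h
    · exact losesConcavity_rpow_of_gt hi hm hG hGc hp h hα.2

theorem theorem1p1 (m : ℝ) (hm : 1 < m) (G : ℝ → ℝ) (P_M P_H A γ : ℝ)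
    (hPM : 0 < P_M) (hPH : P_M ≤ P_H) (hA : 0 < A) (hγ : 0 < γ)
    (hG_anti : AntitoneOn G (Ici 0)) (hG_zero : G P_M = 0)
    (hG_cont : ContinuousOn G (Icc 0 P_H)) (hG_diff : ContDiffOn ℝ 2 G (Ioc 0 P_H))
    (hG_conc : ∀ p ∈ Ioc 0 P_H,
      3 * derivWithin G (Ioc 0 P_H) p + 2 * p * iteratedDerivWithin 2 G (Ioc 0 P_H) p ≤ 0)
    (hG_growth : ∀ p ∈ Ioc 0 P_H,
      |derivWithin G (Ioc 0 P_H) p| + |p * iteratedDerivWithin 2 G (Ioc 0 P_H) p|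
        ≤ A * p ^ (γ - 1)) :
    (∀ (N : ℕ) (T : ℝ) (P₀ : EuclideanSpace ℝ (Fin N) → ℝ)
        (u : ℝ → EuclideanSpace ℝ (Fin N) → ℝ),
      0 < T →
      (∀ x, 0 ≤ P₀ x ∧ P₀ x ≤ P_H) → HasCompactSupport P₀ → PowerConcave (1 / 2) P₀ →
      IsWeakSolution m G T u → (∀ x, pressure m (u 0 x) = P₀ x) →
      SmoothUpToFreeBoundary T (fun t x => pressure m (u t x)) →
      ∀ t ∈ Ico 0 T, PowerConcave (1 / 2) (fun x => pressure m (u t x))) ∧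
    (∀ N : ℕ, 2 ≤ N → ∀ α ∈ Icc (0 : ℝ) 1, α ≠ 1 / 2 →
      ∃ v₀ : EuclideanSpace ℝ (Fin N) → ℝ,
        ContDiffOn ℝ ∞ v₀ (Metric.closedBall 0 1) ∧
        (∀ x ∈ Metric.ball 0 1, 0 < v₀ x ∧ v₀ x ≤ P_H) ∧
        (∀ x ∉ Metric.ball 0 1, v₀ x = 0) ∧
        PowerConcave α v₀ ∧
        (∀ x ∈ Metric.sphere 0 1, fderivWithin ℝ v₀ (Metric.closedBall 0 1) x ≠ 0) ∧
        ∀ (T : ℝ) (u : ℝ → EuclideanSpace ℝ (Fin N) → ℝ),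
          0 < T →
          IsWeakSolution m G T u → (∀ x, pressure m (u 0 x) = v₀ x) →
          ContDiffOn ℝ 2 (fun z : ℝ × EuclideanSpace ℝ (Fin N) => pressure m (u z.1 z.2))
            (positivitySet T (fun t x => pressure m (u t x))) →
          ∃ δ ∈ Ioc 0 T, ∀ t ∈ Ioo 0 δ, ¬ PowerConcave α (fun x => pressure m (u t x))) := by
  exact ⟨fun N T P₀ u _ hP₀ hcomp hconc hu hu0 hs t ht =>
      hu.sqrtConcave hm hPM hPH hG_anti hG_zero hG_cont hG_diff hG_conc hP₀ hcomp hconc hu0 hs ht,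
    fun N hN α hα hα2 => exists_profile_losing_powerConcavity hN hm hG_anti hG_cont
      (hPM.trans_le hPH) hα hα2⟩
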